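/- **Proposition (Convergence for vanishing noise).** Let $\Omega\subset\mathbb R^n$ be a bounded, open, convex set (its boundary is then automatically Lipschitz), let $T>0$, and let $\mathcal V$ be a reflexive Banach space that is continuously embedded into $C^{1,\alpha}_0(\Omega,\mathbb R^n)$ for some $0<\alpha\le 1$, where $C^{1,\alpha}_0(\Omega,\mathbb R^n)$ denotes the closure of $C^\infty_c(\Omega,\mathbb R^n)$ in the $C^{1,\alpha}$ norm. Let $f_0\in L^2(\Omega,\mathbb R)$. For $v\in L^2([0,T],\mathcal V)$ let $f_v\in C^0([0,T],L^2(\Omega,\mathbb R))$ be the (unique) weak solution of the continuity equation $$\partial_t f+\operatorname{div}_x(vf)=0\ \text{ in }[0,T]\times\Omega,\qquad f(0,\cdot)=f_0,$$ that is, $$\int_0^T\!\!\int_\Omega f_v(t,x)\bigl(v(t,x)\cdot\nabla_x\eta(t,x)+\partial_t\eta(t,x)\bigr)\,dx\,dt+\int_\Omega f_0(x)\,\eta(0,x)\,dx=0\quad\text{for all }\eta\in C_c^\infty([0,T)\times\Omega).$$ Let $Y$ be a Banach space, let $K\colon L^2(\Omega,\mathbb R)\to Y$ be continuous (not necessarily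 linear), and let $D\colon Y\times Y\to[0,\infty)$ be such that 1. for each $g\in Y$, $D(\cdot,g)$ is lower semicontinuous and $D(g,\cdot)$ is continuous; 2. if $f_n\to f$ and $g_n\to g$ in $Y$, then $\liminf_n D(f_n,g)\le\liminf_n D(f_n,g_n)$; 3. $D(f,g)=0$ implies $f=g$. For $\gamma>0$ and $g\in Y$ put $$J_{\gamma,g}(v)=D\bigl(K(f_v(T,\cdot)),g\bigr)+\gamma\,\|v\|^2_{L^2([0,T],\mathcal V)},\qquad v\in L^2([0,T],\mathcal V).$$ Let $g\in Y$ and suppose that there is $\hat v\in L^2([0,T],\mathcal V)$ with $K(f_{\hat v}(T,\cdot))=g$. Let $\gamma\colon(0,\infty)\to(0,\infty)$ satisfy $\gamma(\delta)\to0$ and $\delta/\gamma(\delta)\to0$ as $\delta\to0$. Let $(\delta_n)$ be a sequence of positive numbers converging to $0$, let $(g_n)$ be a sequence in $Y$ with $g_n\to g$ in $Y$ and $D(g,g_n)\le\delta_n$ for every $n$, and for every $n$ let $v_n$ be a minimiser of $J_{\gamma(\delta_n),g_n}$ over $L^2([0,T],\mathcal V)$. Then a subsequence of $(v_n)$ converges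 weakly in $L^2([0,T],\mathcal V)$ to some $v$ with $K(f_v(T,\cdot))=g$. -/

import Mathlib

open MeasureTheory Set Filter Topology
open scoped NNReal ENNReal ContDiff

/-- The `C^{1,α}` norm over `Ω` of a vector field `u` on `ℝᵈ`, as an extended nonnegative number:
`sup |u| + sup |Du| + sup |Du(x) - Du(y)| / |x - y|^α`, all suprema over `Ω`
(the pairs with `x = y` contribute `0`). -/
noncomputable def c1HolderNorm {d : ℕ} (Ω : Set (EuclideanSpace ℝ (Fin d))) (α : ℝ)
    (u : EuclideanSpace ℝ (Fin d) → EuclideanSpace ℝ (Fin d)) : ℝ≥0∞ :=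
  (⨆ x ∈ Ω, ‖u x‖ₑ) + (⨆ x ∈ Ω, ‖fderiv ℝ u x‖ₑ) +
    ⨆ x ∈ Ω, ⨆ y ∈ Ω, ‖fderiv ℝ u x - fderiv ℝ u y‖ₑ / edist x y ^ α

/-- `u ∈ C^{1,α}_0(Ω, ℝᵈ)`, the closure of `C^∞_c(Ω, ℝᵈ)` under the `C^{1,α}` norm.
An element is represented by its extension by zero to `ℝᵈ`. -/
def MemC1HolderZero {d : ℕ} (Ω : Set (EuclideanSpace ℝ (Fin d))) (α : ℝ)
    (u : EuclideanSpace ℝ (Fin d) → EuclideanSpace ℝ (Fin d)) : Prop :=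
  ContDiffOn ℝ 1 u Ω ∧ (∀ x, x ∉ Ω → u x = 0) ∧
    ∀ ε : ℝ≥0, 0 < ε → ∃ φ : EuclideanSpace ℝ (Fin d) → EuclideanSpace ℝ (Fin d),
      ContDiff ℝ ∞ φ ∧ HasCompactSupport φ ∧ tsupport φ ⊆ Ω ∧ c1HolderNorm Ω α (u - φ) ≤ ε

/-- The linear map `ι` is a continuous embedding of the normed space `𝒱` into
`C^{1,α}_0(Ω, ℝᵈ)`: it is injective, has values in that space, and is bounded. -/
def IsC1HolderZeroEmbedding {d : ℕ} {𝒱 : Type*} [NormedAddCommGroup 𝒱] [NormedSpace ℝ 𝒱]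
    (Ω : Set (EuclideanSpace ℝ (Fin d))) (α : ℝ)
    (ι : 𝒱 →ₗ[ℝ] (EuclideanSpace ℝ (Fin d) → EuclideanSpace ℝ (Fin d))) : Prop :=
  Function.Injective ι ∧ (∀ w : 𝒱, MemC1HolderZero Ω α (ι w)) ∧
    ∃ c : ℝ≥0, ∀ w : 𝒱, c1HolderNorm Ω α (ι w) ≤ c * ‖w‖ₑ

/-- A normed space is reflexive if its canonical map into the bidual is onto. -/
def IsReflexiveSpace (𝒱 : Type*) [NormedAddCommGroup 𝒱] [NormedSpace ℝ 𝒱] : Prop :=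
  Function.Surjective (NormedSpace.inclusionInDoubleDual ℝ 𝒱)

/-- The space `L²(Ω)` of real-valued functions. -/
abbrev ImageSpace {d : ℕ} (Ω : Set (EuclideanSpace ℝ (Fin d))) : Type :=
  Lp ℝ 2 (volume.restrict Ω)

/-- The Bochner space `L²([0,T], 𝒱)`. -/
abbrev VelocitySpace (T : ℝ) (𝒱 : Type*) [NormedAddCommGroup 𝒱] : Type _ :=
  Lp 𝒱 2 (volume.restrict (Icc (0 : ℝ) T))

/-- `f ∈ C⁰([0,T], L²(Ω))` is a weak solution of the Cauchy problem
`∂ₜ f + div (v f) = 0` in `[0,T] × Ω`, `f(0,·) = f₀`, where `v(t,x) = ι (v t) x`.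
The test functions in `C^∞_c([0,T) × Ω)` are the restrictions to `t ≥ 0` of smooth functions
on `ℝ × ℝᵈ` with compact support in `(-∞,T) × Ω`. -/
def IsWeakSolution {d : ℕ} {𝒱 : Type*} [NormedAddCommGroup 𝒱] [NormedSpace ℝ 𝒱]
    (Ω : Set (EuclideanSpace ℝ (Fin d))) (T : ℝ)
    (ι : 𝒱 →ₗ[ℝ] (EuclideanSpace ℝ (Fin d) → EuclideanSpace ℝ (Fin d)))
    (f₀ : ImageSpace Ω) (v : VelocitySpace T 𝒱) (f : ℝ → ImageSpace Ω) : Prop :=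
  ContinuousOn f (Icc 0 T) ∧
    ∀ η : ℝ × EuclideanSpace ℝ (Fin d) → ℝ,
      ContDiff ℝ ∞ η → HasCompactSupport η → tsupport η ⊆ Iio T ×ˢ Ω →
      (∫ t in (0 : ℝ)..T, ∫ x in Ω,
          f t x * (fderiv ℝ (fun y => η (t, y)) x (ι (v t) x) + deriv (fun s => η (s, x)) t)) +
        ∫ x in Ω, f₀ x * η (0, x) = 0

open Classical in
/-- `f_v(T,·)`, the value at time `T` of the weak solution `f_v` of the continuity equation with
velocity `v` and initial value `f₀`. (The value `0` in the absence of a weak solution only makes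
the definition total.) -/
noncomputable def finalState {d : ℕ} {𝒱 : Type*} [NormedAddCommGroup 𝒱] [NormedSpace ℝ 𝒱]
    (Ω : Set (EuclideanSpace ℝ (Fin d))) (T : ℝ)
    (ι : 𝒱 →ₗ[ℝ] (EuclideanSpace ℝ (Fin d) → EuclideanSpace ℝ (Fin d)))
    (f₀ : ImageSpace Ω) (v : VelocitySpace T 𝒱) : ImageSpace Ω :=
  if h : ∃ f : ℝ → ImageSpace Ω, IsWeakSolution Ω T ι f₀ v f then h.choose T else 0

/-- The functional `J_{γ,g}(v) = D(K(f_v(T,·)), g) + γ ‖v‖²` on `L²([0,T], 𝒱)`. -/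
noncomputable def regFunctional {d : ℕ} {𝒱 : Type*} [NormedAddCommGroup 𝒱] [NormedSpace ℝ 𝒱]
    {Y : Type*} (Ω : Set (EuclideanSpace ℝ (Fin d))) (T : ℝ)
    (ι : 𝒱 →ₗ[ℝ] (EuclideanSpace ℝ (Fin d) → EuclideanSpace ℝ (Fin d)))
    (f₀ : ImageSpace Ω) (K : ImageSpace Ω → Y) (D : Y → Y → ℝ≥0) (γ : ℝ) (g : Y)
    (v : VelocitySpace T 𝒱) : ℝ :=
  (D (K (finalState Ω T ι f₀ v)) g : ℝ) + γ * ‖v‖ ^ 2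

/-- The standing assumptions on a data discrepancy `D : Y × Y → [0,∞)`. The lower limits are
taken in `[0,∞]`. -/
structure IsDataDiscrepancy {Y : Type*} [TopologicalSpace Y] (D : Y → Y → ℝ≥0) : Prop where
  lowerSemicontinuous_left : ∀ g : Y, LowerSemicontinuous fun f => D f g
  continuous_right : ∀ g : Y, Continuous fun f => D g f
  liminf_le : ∀ (f g : ℕ → Y) (f' g' : Y), Tendsto f atTop (𝓝 f') → Tendsto g atTop (𝓝 g') →
    liminf (fun n => (D (f n) g' : ℝ≥0∞)) atTop ≤ liminf (fun n => (D (f n) (g n) : ℝ≥0∞)) atTop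
  eq_of_eq_zero : ∀ f g : Y, D f g = 0 → f = g

/-! Comparing `v n` with `vhat`, whose discrepancy to the data `gn n` is at most `δ n`, bounds the
discrepancy of `v n` plus `γ (δ n) * ‖v n‖ ^ 2` by `δ n + γ (δ n) * ‖vhat‖ ^ 2`. Dividing by `γ (δ
n)` bounds the minimisers, because `δ / γ δ` tends to zero; dropping the penalty shows that their
discrepancies tend to zero. A subsequence converges weakly to some `w`. If the final images converge
strongly along it, property 2 of `D` replaces the noisy data by `g`, lower semicontinuity gives
discrepancy zero at the limit, and property 3 concludes. Two analytic facts carry this argument.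

The first is weak sequential compactness of bounded sets in `L²([0,T], 𝒱)`
(`exists_subseq_weak_tendsto`). All values of a sequence lie in one separable closed subspace `X` of
`𝒱`, which is again reflexive and has a separable dual. Then every functional on `L²(X)` is
integration against an element of `L²(X*)` (`exists_Lp_strongDual_representation`). A weak-* limit
in the dual of `L²(X*)` is therefore an element of `L²(X**)`, that is, of `L²(X)`.

The second is that `v ↦ f_v(T)` is continuous along bounded sequences from the weak to the strong
topology (`tendsto_finalState`). By the method of characteristics `f_v(T) = (f₀ ∘ Z) |det DZ|`,
where `Z` is the flow of `v` from time `T` back to time `0`. The flow solves an integral equation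
with a right-hand side linear in `v`. Along the trajectory of the limit velocity, evaluation is a
continuous path of operators from `𝒱` to a finite-dimensional space, so weak convergence passes
through the integral; what remains is Lipschitz in the trajectory and is absorbed by Grönwall. The
linearised equation is treated alike, Hölder continuity of the spatial derivative controlling the
change of trajectory (`tendsto_flow`, `tendsto_flowDeriv`). Pointwise convergence of flows and
Jacobians gives `L²` convergence of the transported images by density of continuous functions
(`tendsto_eLpNorm_transportFun`).

The formula for `f_v(T)` must hold for every weak solution, since `finalState` selects one by
choice. Uniqueness at time `T` comes from pairing a weak solution at time `t` with `ψ` composed with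
the flow from `t` to `T`: this pairing does not depend on `t` (`integral_mul_comp_flow_eq`). -/

set_option maxSynthPendingDepth 3

/-! ### Separability and reflexivity of Banach spaces and their subspaces. -/

section Reflexive

variable {E : Type*} [NormedAddCommGroup E] [NormedSpace ℝ E]

/-- Pick for each member of a dense sequence of functionals a vector of the unit ball at which it
attains half its norm. A nonzero functional vanishing on the closed span of these vectors would be
close to some member of the sequence, which is then small at its own vector. -/
theorem separableSpace_of_separableSpace_strongDual
    [TopologicalSpace.SeparableSpace (StrongDual ℝ E)] : TopologicalSpace.SeparableSpace E := by
  have hx : ∀ ℓ : StrongDual ℝ E, ∃ x : E, ‖x‖ ≤ 1 ∧ ‖ℓ‖ / 2 ≤ ‖ℓ x‖ := by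
    intro ℓ
    by_cases h0 : ‖ℓ‖ = 0
    · exact ⟨0, by simp, by simp [h0]⟩
    · have hlt : ‖ℓ‖ / 2 < ‖ℓ‖ := by
        have := norm_nonneg ℓ
        have : 0 < ‖ℓ‖ := lt_of_le_of_ne this (Ne.symm h0)
        linarith
      obtain ⟨x, hx1, hx2⟩ := ContinuousLinearMap.exists_lt_apply_of_lt_opNorm ℓ hlt
      exact ⟨x, hx1.le, hx2.le⟩
  choose x hx1 hx2 using hx
  set u := TopologicalSpace.denseSeq (StrongDual ℝ E)
  set S : Submodule ℝ E := (Submodule.span ℝ (range fun n => x (u n))).topologicalClosure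
  have hS : S = ⊤ := by
    by_contra hne
    obtain ⟨z, hz⟩ : ∃ z, z ∉ S := by
      by_contra! h
      exact hne (eq_top_iff.2 fun z _ => h z)
    obtain ⟨f, s, hf1, hf2⟩ := geometric_hahn_banach_closed_point (s := (S : Set E)) S.convex
      (Submodule.isClosed_topologicalClosure _) hz
    -- A functional bounded above by `s` on a subspace vanishes there: otherwise a suitable multiple
    -- of `a` would have the value `s + 1`.
    have hf0 : ∀ a ∈ S, f a = 0 := by
      intro a ha
      by_contra hfa
      have := hf1 _ (S.smul_mem ((s + 1) / f a) ha)
      rw [map_smul, smul_eq_mul, div_mul_cancel₀ _ hfa] at this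
      linarith
    have hs : 0 < s := by simpa using hf1 0 S.zero_mem
    have hfpos : 0 < ‖f‖ := by
      rw [norm_pos_iff]
      rintro rfl
      simp at hf2
      linarith
    obtain ⟨n, hn⟩ : ∃ n, ‖u n - f‖ < ‖f‖ / 4 := by
      have := (TopologicalSpace.denseRange_denseSeq (StrongDual ℝ E)).exists_dist_lt f
        (show 0 < ‖f‖ / 4 by positivity)
      obtain ⟨n, hn⟩ := this
      exact ⟨n, by rwa [dist_comm, dist_eq_norm] at hn⟩
    have hxS : x (u n) ∈ S :=
      Submodule.le_topologicalClosure _ (Submodule.subset_span ⟨n, rfl⟩)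
    have h1 : ‖u n (x (u n))‖ ≤ ‖u n - f‖ := by
      have h2 : u n (x (u n)) = (u n - f) (x (u n)) := by simp [hf0 _ hxS]
      rw [h2]
      exact (ContinuousLinearMap.le_opNorm _ _).trans
        (mul_le_of_le_one_right (norm_nonneg _) (hx1 _))
    have h3 : ‖f‖ ≤ ‖u n - f‖ + ‖u n‖ := by
      have := norm_sub_le (u n) (u n - f)
      simp only [sub_sub_cancel] at this
      linarith
    -- Now `‖u n‖ ≤ 2 ‖u n - f‖ < ‖f‖ / 2`, so `h3` would give `‖f‖ < 3/4 ‖f‖`.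
    have := hx2 (u n)
    linarith
  have hsep : TopologicalSpace.IsSeparable (S : Set E) := by
    have : TopologicalSpace.IsSeparable (Submodule.span ℝ (range fun n => x (u n)) : Set E) :=
      (countable_range _).isSeparable.span
    simpa [S] using this.closure
  rw [hS] at hsep
  exact TopologicalSpace.isSeparable_univ_iff.1 (by simpa using hsep)

/-- Restricting functionals from `E` to `S` turns an element of the bidual of `S` into one of the
bidual of `E`, hence into evaluation at some `z`. Hahn–Banach puts `z` in `S`, since functionals
killing `S` kill `z`; and it extends functionals on `S` to `E`, so evaluation at `z` is the given
element. -/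
theorem IsReflexiveSpace.submodule (hE : IsReflexiveSpace E) {S : Submodule ℝ E}
    (hS : IsClosed (S : Set E)) : IsReflexiveSpace S := by
  intro Λ
  set R : StrongDual ℝ E →L[ℝ] StrongDual ℝ S :=
    (ContinuousLinearMap.compL ℝ S E ℝ).flip S.subtypeL
  obtain ⟨z, hz⟩ := hE (Λ.comp R)
  have hzℓ : ∀ ℓ : StrongDual ℝ E, ℓ z = Λ (ℓ.comp S.subtypeL) := fun ℓ => by
    have := congrArg (fun F => F ℓ) hz
    simpa [R] using this
  have hzS : z ∈ S := by
    by_contra hzn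
    obtain ⟨f, s, hf1, hf2⟩ := geometric_hahn_banach_closed_point (s := (S : Set E)) S.convex hS hzn
    have hf0 : ∀ a ∈ S, f a = 0 := by
      intro a ha
      by_contra hfa
      have := hf1 _ (S.smul_mem ((s + 1) / f a) ha)
      rw [map_smul, smul_eq_mul, div_mul_cancel₀ _ hfa] at this
      linarith
    have hs : 0 < s := by simpa using hf1 0 S.zero_mem
    have h1 : f.comp S.subtypeL = 0 := by
      ext a
      simp [hf0 a a.2]
    have := hzℓ f
    rw [h1, map_zero] at this
    linarith
  refine ⟨⟨z, hzS⟩, ?_⟩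
  ext ℓ
  obtain ⟨g, hg, -⟩ := exists_extension_norm_eq S ℓ
  have h1 : g.comp S.subtypeL = ℓ := by
    ext a
    simp [hg]
  have := hzℓ g
  rw [h1] at this
  rw [NormedSpace.dual_def, ← this, ← hg]

theorem IsReflexiveSpace.separableSpace_strongDual [TopologicalSpace.SeparableSpace E]
    (hE : IsReflexiveSpace E) : TopologicalSpace.SeparableSpace (StrongDual ℝ E) := by
  have : TopologicalSpace.SeparableSpace (StrongDual ℝ (StrongDual ℝ E)) :=
    hE.denseRange.separableSpace (NormedSpace.inclusionInDoubleDual ℝ E).continuous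
  exact separableSpace_of_separableSpace_strongDual

end Reflexive

/-! ### Scalar densities of a functional on `L²(X)` and a common majorant for them. -/

section LpDual

variable {β : Type*} [MeasurableSpace β] {μ : Measure β}
variable {X : Type*} [NormedAddCommGroup X] [NormedSpace ℝ X]

/-- For `h ∈ L²`, the map `x ↦ h x` from `X` to `L²(X)`. -/
noncomputable def smulConstLp (h : Lp ℝ 2 μ) : X →L[ℝ] Lp X 2 μ :=
  LinearMap.mkContinuous
    { toFun := fun x => (ContinuousLinearMap.toSpanSingleton ℝ x).compLp h
      map_add' := fun x y => by
        rw [ContinuousLinearMap.toSpanSingleton_add, ContinuousLinearMap.add_compLp]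
      map_smul' := fun c x => by
        rw [ContinuousLinearMap.toSpanSingleton_smul, ContinuousLinearMap.smul_compLp]
        rfl } ‖h‖ (fun x => by
      refine (ContinuousLinearMap.norm_compLp_le _ _).trans ?_
      rw [mul_comm, ContinuousLinearMap.norm_toSpanSingleton])

theorem coeFn_smulConstLp (h : Lp ℝ 2 μ) (x : X) :
    smulConstLp h x =ᵐ[μ] fun t => h t • x := by
  filter_upwards [(ContinuousLinearMap.toSpanSingleton ℝ x).coeFn_compLp h] with t ht
  exact ht

theorem smulConstLp_eq_compLpL (h : Lp ℝ 2 μ) (x : X) :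
    smulConstLp h x = (ContinuousLinearMap.toSpanSingleton ℝ x).compLpL 2 μ h := rfl

/-- The `L²` function representing `h ↦ Λ (h x)`. -/
noncomputable def dualDensity (Λ : StrongDual ℝ (Lp X 2 μ)) : X →ₗ[ℝ] Lp ℝ 2 μ where
  toFun x := (InnerProductSpace.toDual ℝ (Lp ℝ 2 μ)).symm
    (Λ.comp ((ContinuousLinearMap.toSpanSingleton ℝ x).compLpL 2 μ))
  map_add' x y := by
    rw [← map_add]
    congr 1
    ext h
    simp only [ContinuousLinearMap.comp_apply, add_apply]
    rw [← smulConstLp_eq_compLpL, map_add, map_add]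
    rfl
  map_smul' c x := by
    rw [RingHom.id_apply, ← map_smul]
    congr 1
    ext h
    simp only [ContinuousLinearMap.comp_apply, smul_apply]
    rw [← smulConstLp_eq_compLpL, map_smul, map_smul]
    rfl

theorem inner_dualDensity (Λ : StrongDual ℝ (Lp X 2 μ)) (x : X) (h : Lp ℝ 2 μ) :
    inner ℝ (dualDensity Λ x) h = Λ (smulConstLp h x) := by
  simp [dualDensity, smulConstLp_eq_compLpL]

theorem integral_dualDensity_mul (Λ : StrongDual ℝ (Lp X 2 μ)) (x : X) (h : Lp ℝ 2 μ) :
    ∫ t, dualDensity Λ x t * h t ∂μ = Λ (smulConstLp h x) := by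
  rw [← inner_dualDensity, L2.inner_def]
  exact integral_congr_ae (Eventually.of_forall fun t => by simp [mul_comm])

/-- `m` is the density of `h ↦ Λ (h s)` for some measurable `s` with values in the unit ball. -/
def IsUnitDensity (Λ : StrongDual ℝ (Lp X 2 μ)) (m : Lp ℝ 2 μ) : Prop :=
  ∃ s : β → X, AEStronglyMeasurable s μ ∧ (∀ t, ‖s t‖ ≤ 1) ∧
    ∀ (h : Lp ℝ 2 μ) (u : Lp X 2 μ), (u =ᵐ[μ] fun t => h t • s t) → Λ u = ∫ t, m t * h t ∂μ

theorem integrable_mul_Lp (m h : Lp ℝ 2 μ) : Integrable (fun t => m t * h t) μ :=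
  (Lp.memLp m).integrable_mul (Lp.memLp h)

/-- Test `Λ` on `m • s`: its norm is at most `‖m‖`, while `Λ` takes the value `‖m‖ ^ 2` there. -/
theorem IsUnitDensity.norm_le {Λ : StrongDual ℝ (Lp X 2 μ)} {m : Lp ℝ 2 μ}
    (hm : IsUnitDensity Λ m) : ‖m‖ ≤ ‖Λ‖ := by
  obtain ⟨s, hs, hs1, H⟩ := hm
  have hle : ∀ᵐ t ∂μ, ‖m t • s t‖ ≤ ‖m t‖ := Eventually.of_forall fun t => by
    rw [norm_smul]
    exact mul_le_of_le_one_right (norm_nonneg _) (hs1 t)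
  have hmem : MemLp (fun t => m t • s t) 2 μ :=
    (Lp.memLp m).mono ((Lp.aestronglyMeasurable m).smul hs) hle
  have h1 := H m hmem.toLp hmem.coeFn_toLp
  have h2 : ∫ t, m t * m t ∂μ = ‖m‖ ^ 2 := by
    rw [← real_inner_self_eq_norm_sq, L2.inner_def]
    exact integral_congr_ae (Eventually.of_forall fun t => by simp [sq])
  have h3 : ‖hmem.toLp‖ ≤ ‖m‖ := by
    refine Lp.norm_le_norm_of_ae_le ?_
    filter_upwards [hmem.coeFn_toLp, hle] with t h h'
    rwa [h]
  rw [h2] at h1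
  have h4 : ‖m‖ ^ 2 ≤ ‖Λ‖ * ‖m‖ := by
    rw [← h1]
    exact (le_abs_self _).trans ((Λ.le_opNorm _).trans (by gcongr))
  by_contra! hlt
  have : 0 < ‖m‖ := (norm_nonneg _).trans_lt hlt
  nlinarith

theorem isUnitDensity_zero (Λ : StrongDual ℝ (Lp X 2 μ)) : IsUnitDensity Λ 0 := by
  refine ⟨fun _ => 0, aestronglyMeasurable_const, by simp, fun h u hu => ?_⟩
  have : u = 0 := by
    ext1
    filter_upwards [hu, Lp.coeFn_zero X 2 μ] with t h1 h2
    rw [h1, h2]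
    simp
  rw [this, map_zero, integral_eq_zero_of_ae]
  filter_upwards [Lp.coeFn_zero ℝ 2 μ] with t h
  rw [h]
  simp

theorem isUnitDensity_dualDensity (Λ : StrongDual ℝ (Lp X 2 μ)) {x : X} (hx : ‖x‖ ≤ 1) :
    IsUnitDensity Λ (dualDensity Λ x) := by
  refine ⟨fun _ => x, aestronglyMeasurable_const, fun _ => hx, fun h u hu => ?_⟩
  rw [integral_dualDensity_mul]
  congr 1
  ext1
  exact hu.trans (coeFn_smulConstLp h x).symm

/-- Take `s` where `m` is the larger density and `s'` elsewhere. The unit ball constraint is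
pointwise, so it survives the gluing. -/
theorem IsUnitDensity.sup {Λ : StrongDual ℝ (Lp X 2 μ)} {m m' : Lp ℝ 2 μ}
    (hm : IsUnitDensity Λ m) (hm' : IsUnitDensity Λ m') : IsUnitDensity Λ (m ⊔ m') := by
  classical
  obtain ⟨s, hs, hs1, H⟩ := hm
  obtain ⟨s', hs', hs1', H'⟩ := hm'
  set A : Set β := {t | m' t ≤ m t}
  have hA : MeasurableSet A :=
    measurableSet_le (Lp.stronglyMeasurable m').measurable (Lp.stronglyMeasurable m).measurable
  refine ⟨A.piecewise s s', AEStronglyMeasurable.piecewise hA hs.restrict hs'.restrict,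
    fun t => ?_, fun h u hu => ?_⟩
  · by_cases ht : t ∈ A <;> simp [ht, hs1, hs1']
  · have e1 : MemLp (A.indicator h) 2 μ := (Lp.memLp h).indicator hA
    have e2 : MemLp (Aᶜ.indicator h) 2 μ := (Lp.memLp h).indicator hA.compl
    have u1 : MemLp (A.indicator u) 2 μ := (Lp.memLp u).indicator hA
    have u2 : MemLp (Aᶜ.indicator u) 2 μ := (Lp.memLp u).indicator hA.compl
    have hu12 : u = u1.toLp + u2.toLp := by
      ext1
      filter_upwards [u1.coeFn_toLp, u2.coeFn_toLp, Lp.coeFn_add u1.toLp u2.toLp] with t h1 h2 h3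
      rw [h3, Pi.add_apply, h1, h2, ← Pi.add_apply, indicator_self_add_compl]
    have k1 : Λ u1.toLp = ∫ t, m t * (e1.toLp : Lp ℝ 2 μ) t ∂μ := by
      refine H _ _ ?_
      filter_upwards [u1.coeFn_toLp, e1.coeFn_toLp, hu] with t h1 h2 h3
      rw [h1, h2]
      by_cases ht : t ∈ A <;> simp [ht, h3]
    have k2 : Λ u2.toLp = ∫ t, m' t * (e2.toLp : Lp ℝ 2 μ) t ∂μ := by
      refine H' _ _ ?_
      filter_upwards [u2.coeFn_toLp, e2.coeFn_toLp, hu] with t h1 h2 h3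
      rw [h1, h2]
      by_cases ht : t ∈ A <;> simp [ht, h3]
    rw [hu12, map_add, k1, k2, ← integral_add (integrable_mul_Lp _ _) (integrable_mul_Lp _ _)]
    refine integral_congr_ae ?_
    filter_upwards [e1.coeFn_toLp, e2.coeFn_toLp, Lp.coeFn_sup m m'] with t h1 h2 h3
    rw [h1, h2, h3]
    by_cases ht : t ∈ A
    · have ht' : m' t ≤ m t := ht
      simp [ht, ht']
    · have ht' : m t ≤ m' t := le_of_not_ge ht
      simp [ht, ht']

/-- `H` plays the role of the pointwise dual norm of the functional to be constructed. It is the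
increasing limit of finite suprema of densities at normalised vectors; each of these is a unit
density, hence of norm at most `‖Λ‖`, and monotone convergence passes the bound to the limit. -/
theorem exists_density_bound (Λ : StrongDual ℝ (Lp X 2 μ)) (z : ℕ → X) :
    ∃ H : β → ℝ≥0∞, Measurable H ∧ ∫⁻ t, H t ^ 2 ∂μ ≤ ‖Λ‖ₑ ^ 2 ∧
      ∀ᵐ t ∂μ, ∀ n, ‖dualDensity Λ (z n) t‖ₑ ≤ H t * ‖z n‖ₑ := by
  -- Both signs enter, so that the supremum controls the absolute value of the density. For `z n =
  -- 0` the normalised vector is `0`.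
  set q : ℕ → Lp ℝ 2 μ := fun n => dualDensity Λ (‖z n‖⁻¹ • z n) ⊔ dualDensity Λ (-(‖z n‖⁻¹ • z n))
  have hn1 : ∀ n, ‖‖z n‖⁻¹ • z n‖ ≤ 1 := fun n => by
    rw [norm_smul, norm_inv, norm_norm]
    exact inv_mul_le_one
  have hq : ∀ n, IsUnitDensity Λ (q n) := fun n =>
    (isUnitDensity_dualDensity Λ (hn1 n)).sup
      (isUnitDensity_dualDensity Λ (by rw [norm_neg]; exact hn1 n))
  -- Starting from `0` keeps all `m N` nonnegative, so that their absolute values increase as well.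
  set m : ℕ → Lp ℝ 2 μ := fun N => Nat.rec 0 (fun n r => r ⊔ q n) N
  have hm0 : m 0 = 0 := rfl
  have hms : ∀ N, m (N + 1) = m N ⊔ q N := fun _ => rfl
  have hm : ∀ N, IsUnitDensity Λ (m N) := fun N => by
    induction N with
    | zero => exact isUnitDensity_zero Λ
    | succ N ih => exact (hms N) ▸ ih.sup (hq N)
  have hmono : Monotone m := monotone_nat_of_le_succ fun N => by
    rw [hms]
    exact le_sup_left
  refine ⟨fun t => ⨆ N, ‖m N t‖ₑ,
    Measurable.iSup fun N => (Lp.stronglyMeasurable (m N)).measurable.enorm, ?_, ?_⟩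
  · have hmonoae : ∀ᵐ t ∂μ, Monotone fun N => ‖m N t‖ₑ := by
      have h1 : ∀ᵐ t ∂μ, ∀ N, m N t ≤ m (N + 1) t := ae_all_iff.2 fun N =>
        (Lp.coeFn_le _ _).2 (hmono N.le_succ)
      filter_upwards [h1, Lp.coeFn_zero ℝ 2 μ] with t ht h0
      have hmon : Monotone fun N => m N t := monotone_nat_of_le_succ ht
      intro M N hMN
      have hpos : 0 ≤ m M t := by
        have := hmon (Nat.zero_le M)
        simp only [hm0, h0] at this
        simpa using this
      have h2 : m M t ≤ m N t := hmon hMN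
      simp only [Real.enorm_of_nonneg hpos, Real.enorm_of_nonneg (hpos.trans h2)]
      exact ENNReal.ofReal_le_ofReal h2
    have h3 : ∀ᵐ t ∂μ, (⨆ N, ‖m N t‖ₑ) ^ 2 = ⨆ N, ‖m N t‖ₑ ^ 2 := by
      filter_upwards [hmonoae] with t ht
      exact Monotone.map_iSup_of_continuousAt (f := fun a : ℝ≥0∞ => a ^ 2)
        (ENNReal.continuous_pow 2).continuousAt (fun a b hab => pow_le_pow_left' hab 2) (by simp)
    rw [lintegral_congr_ae h3, lintegral_iSup'
      (fun N => ((Lp.stronglyMeasurable (m N)).measurable.enorm.pow_const 2).aemeasurable)]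
    · refine iSup_le fun N => ?_
      have h4 : ∫⁻ t, ‖m N t‖ₑ ^ 2 ∂μ = ‖m N‖ₑ ^ 2 := by
        rw [Lp.enorm_def, eLpNorm_eq_lintegral_rpow_enorm_toReal (by simp) (by simp)]
        simp only [ENNReal.toReal_ofNat, ENNReal.rpow_ofNat, one_div]
        rw [← ENNReal.rpow_ofNat, ← ENNReal.rpow_mul]
        simp
      rw [h4]
      gcongr
      exact enorm_le_iff_norm_le.2 (hm N).norm_le
    · filter_upwards [hmonoae] with t ht M N hMN
      exact pow_le_pow_left' (ht hMN) 2
  · rw [ae_all_iff]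
    intro n
    have hle : q n ≤ m (n + 1) := by
      rw [hms]
      exact le_sup_right
    by_cases hz : z n = 0
    · filter_upwards [Lp.coeFn_zero ℝ 2 μ] with t ht
      rw [hz, map_zero, ht]
      simp
    have h1 : dualDensity Λ (‖z n‖⁻¹ • z n) = ‖z n‖⁻¹ • dualDensity Λ (z n) := map_smul _ _ _
    have h2 : dualDensity Λ (-(‖z n‖⁻¹ • z n)) = (-‖z n‖⁻¹) • dualDensity Λ (z n) := by
      rw [← neg_smul, map_smul]
    filter_upwards [(Lp.coeFn_le _ _).2 hle, Lp.coeFn_sup (dualDensity Λ (‖z n‖⁻¹ • z n))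
      (dualDensity Λ (-(‖z n‖⁻¹ • z n))), Lp.coeFn_smul ‖z n‖⁻¹ (dualDensity Λ (z n)),
      Lp.coeFn_smul (-‖z n‖⁻¹) (dualDensity Λ (z n))] with t k1 k2 k3 k4
    rw [k2, h1, h2] at k1
    simp only [Pi.sup_apply, k3, k4, Pi.smul_apply, smul_eq_mul] at k1
    have hzpos : 0 < ‖z n‖ := norm_pos_iff.2 hz
    have k5 : |dualDensity Λ (z n) t| ≤ |m (n + 1) t| * ‖z n‖ := by
      have a1 := (le_sup_left.trans k1).trans (le_abs_self _)
      have a2 := (le_sup_right.trans k1).trans (le_abs_self _)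
      rw [inv_mul_le_iff₀ hzpos] at a1
      rw [neg_mul, ← mul_neg, inv_mul_le_iff₀ hzpos] at a2
      rw [abs_le]
      constructor <;> linarith
    calc ‖dualDensity Λ (z n) t‖ₑ ≤ ‖m (n + 1) t‖ₑ * ‖z n‖ₑ := by
          rw [← enorm_norm (z n), ← enorm_mul]
          refine enorm_le_iff_norm_le.2 ?_
          simpa using k5
      _ ≤ _ := by
          gcongr
          exact le_iSup (fun N => ‖m N t‖ₑ) (n + 1)

end LpDual

/-! ### Functionals on `L²(X)` as elements of `L²(X*)`. -/

section LpDualRepresentation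

variable {β : Type*} [MeasurableSpace β] {μ : Measure β}
variable {X : Type*} [NormedAddCommGroup X] [NormedSpace ℝ X]

/-- A map into a separable metric space is measurable if its distances to all points are. -/
theorem stronglyMeasurable_of_measurable_dist {Z : Type*} [MetricSpace Z]
    [TopologicalSpace.SeparableSpace Z] {g : β → Z} (h : ∀ z, Measurable fun t => dist (g t) z) :
    StronglyMeasurable g := by
  let : MeasurableSpace Z := borel Z
  have : BorelSpace Z := ⟨rfl⟩
  have : SecondCountableTopology Z := UniformSpace.secondCountable_of_separable Z
  refine Measurable.stronglyMeasurable (measurable_of_isOpen fun U hU => ?_)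
  rcases isEmpty_or_nonempty Z with hZ | hZ
  · have : g ⁻¹' U = ∅ := by
      ext t
      exact (hZ.false (g t)).elim
    simp [this]
  set u := TopologicalSpace.denseSeq Z
  have : g ⁻¹' U = ⋃ (n : ℕ) (q : ℚ) (_ : Metric.ball (u n) q ⊆ U), {t | dist (g t) (u n) < q} := by
    ext t
    simp only [mem_preimage, mem_iUnion, mem_ofPred_eq, exists_prop]
    constructor
    · intro ht
      obtain ⟨r, hr, hrU⟩ := Metric.isOpen_iff.1 hU _ ht
      obtain ⟨n, hn⟩ := (TopologicalSpace.denseRange_denseSeq Z).exists_dist_lt (g t)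
        (show 0 < r / 2 by positivity)
      obtain ⟨q, hq1, hq2⟩ := exists_rat_btwn hn
      refine ⟨n, q, fun z hz => hrU ?_, hq1⟩
      rw [Metric.mem_ball] at hz ⊢
      have hn' : dist (u n) (g t) < r / 2 := by rw [dist_comm]; exact hn
      have := dist_triangle z (u n) (g t)
      linarith
    · rintro ⟨n, q, hq, ht⟩
      exact hq ht
  rw [this]
  exact MeasurableSet.iUnion fun n => MeasurableSet.iUnion fun q => MeasurableSet.iUnion fun _ =>
    measurableSet_lt (h _) measurable_const

/-- The dual norm is a countable supremum of quotients over a dense sequence of `X`, so pointwise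
measurability makes all distances measurable. Vectors equal to `0` contribute `0 / 0 = 0`. -/
theorem stronglyMeasurable_strongDual [TopologicalSpace.SeparableSpace X]
    [TopologicalSpace.SeparableSpace (StrongDual ℝ X)] {g : β → StrongDual ℝ X}
    (h : ∀ x, Measurable fun t => g t x) : StronglyMeasurable g := by
  refine stronglyMeasurable_of_measurable_dist fun ℓ => ?_
  set u := TopologicalSpace.denseSeq X
  have hnorm : ∀ f : StrongDual ℝ X, ‖f‖ₑ = ⨆ n, ‖f (u n)‖ₑ / ‖u n‖ₑ := by
    intro f
    refine le_antisymm ?_ (iSup_le fun n => ENNReal.div_le_of_le_mul (f.le_opENorm _))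
    set S := ⨆ n, ‖f (u n)‖ₑ / ‖u n‖ₑ
    refine ContinuousLinearMap.opENorm_le_bound _ fun x => ?_
    by_cases hS : S = ⊤
    · by_cases hx : x = 0
      · simp [hx]
      · rw [hS, ENNReal.top_mul (by simpa using hx)]
        exact le_top
    refine (TopologicalSpace.denseRange_denseSeq X).induction_on
      (p := fun x => ‖f x‖ₑ ≤ S * ‖x‖ₑ) x ?_ fun n => ?_
    · exact isClosed_le (by fun_prop) (ENNReal.continuous_const_mul hS |>.comp continuous_enorm)
    · by_cases hx : u n = 0
      · simp only [u] at hx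
        simp [hx]
      · rw [← ENNReal.div_le_iff (by simpa using hx) (by simp)]
        exact le_iSup (fun n => ‖f (u n)‖ₑ / ‖u n‖ₑ) n
  have h1 : (fun t => dist (g t) ℓ) = fun t => (⨆ n, ‖g t (u n) - ℓ (u n)‖ₑ / ‖u n‖ₑ).toReal := by
    ext t
    rw [dist_eq_norm, ← toReal_enorm, hnorm]
    rfl
  rw [h1]
  exact (Measurable.iSup fun n => (((h _).sub_const _).enorm.div_const _)).ennreal_toReal

/-- Linearity of `G` holds only up to null sets. There are countably many rational combinations, so
one null set will serve for all of them. -/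
theorem coeFn_linearCombination (G : X →ₗ[ℝ] Lp ℝ 2 μ) (x : ℕ → X) [Module ℚ X] (c : ℕ →₀ ℚ) :
    (fun t => G (Finsupp.linearCombination ℚ x c) t) =ᵐ[μ]
      fun t => Finsupp.linearCombination ℚ (fun n => G (x n) t) c := by
  induction c using Finsupp.induction_linear with
  | zero =>
    filter_upwards [Lp.coeFn_zero ℝ 2 μ] with t ht
    simp only [map_zero, ht]
    rfl
  | add f g hf hg =>
    rw [map_add, map_add]
    filter_upwards [hf, hg, Lp.coeFn_add (G (Finsupp.linearCombination ℚ x f))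
      (G (Finsupp.linearCombination ℚ x g))] with t h1 h2 h3
    rw [h3, map_add, Pi.add_apply, h1, h2]
  | single n q =>
    simp only [Finsupp.linearCombination_single]
    have : q • x n = (q : ℝ) • x n := by
      have := map_ratCast_smul (AddMonoidHom.id X) ℚ ℝ q (x n)
      simpa using this
    rw [this, map_smul]
    filter_upwards [Lp.coeFn_smul (q : ℝ) (G (x n))] with t ht
    rw [ht, Pi.smul_apply, smul_eq_mul, Rat.smul_def]

/-- Pointwise realisation of `dualDensity` by functionals. -/
theorem exists_pointwise_functional [TopologicalSpace.SeparableSpace X]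
    (Λ : StrongDual ℝ (Lp X 2 μ)) :
    ∃ H : β → ℝ≥0∞, Measurable H ∧ ∫⁻ t, H t ^ 2 ∂μ ≤ ‖Λ‖ₑ ^ 2 ∧
      ∀ᵐ t ∂μ, ∃ f : StrongDual ℝ X, ‖f‖ₑ ≤ H t ∧
        ∀ n, f (TopologicalSpace.denseSeq X n) =
          dualDensity Λ (TopologicalSpace.denseSeq X n) t := by
  -- The rational span of the dense sequence is countable and dense: off one null set the densities
  -- define there a bounded rational-linear map.
  let : NormedSpace ℚ X := NormedSpace.restrictScalars ℚ ℝ X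
  set x := TopologicalSpace.denseSeq X
  set e := Finsupp.linearCombination ℚ x
  obtain ⟨c, hc⟩ := exists_surjective_nat (ℕ →₀ ℚ)
  obtain ⟨H, hH, hH2, hbound⟩ := exists_density_bound Λ (fun n => e (c n))
  refine ⟨H, hH, hH2, ?_⟩
  have hfin : ∀ᵐ t ∂μ, H t ^ 2 < ⊤ := ae_lt_top (hH.pow_const 2)
    (ne_top_of_le_ne_top (by simp) hH2)
  have hlin : ∀ᵐ t ∂μ, ∀ n, dualDensity Λ (e (c n)) t =
      Finsupp.linearCombination ℚ (fun n => dualDensity Λ (x n) t) (c n) :=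
    ae_all_iff.2 fun n => coeFn_linearCombination (dualDensity Λ) x (c n)
  filter_upwards [hbound, hfin, hlin] with t h1 h2 h3
  have hHt : H t ≠ ⊤ := fun h => by simp [h] at h2
  set φ : (ℕ →₀ ℚ) →ₗ[ℚ] ℝ := Finsupp.linearCombination ℚ (fun n => dualDensity Λ (x n) t)
  have hφ : ∀ a, ‖φ a‖ ≤ (H t).toReal * ‖e a‖ := by
    intro a
    obtain ⟨n, rfl⟩ := hc a
    rw [← h3 n]
    have := ENNReal.toReal_mono (ENNReal.mul_ne_top hHt (by simp)) (h1 n)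
    simpa using this
  have hdense : DenseRange e := by
    refine (TopologicalSpace.denseRange_denseSeq X).mono ?_
    rintro _ ⟨n, rfl⟩
    exact ⟨Finsupp.single n 1, by simp [e, x]⟩
  set F : X →L[ℚ] ℝ := φ.extendOfNorm e
  have hF : ∀ a, F (e a) = φ a := LinearMap.extendOfNorm_eq hdense ⟨_, hφ⟩
  have hFb : ∀ y, ‖F y‖ ≤ (H t).toReal * ‖y‖ :=
    LinearMap.norm_extendOfNorm_apply_le hdense _ hφ
  -- A continuous additive map is automatically real-linear.
  refine ⟨AddMonoidHom.toRealLinearMap (F : X →+ ℝ) F.continuous, ?_, fun n => ?_⟩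
  · rw [← ENNReal.ofReal_toReal hHt, ← ofReal_norm]
    exact ENNReal.ofReal_le_ofReal (ContinuousLinearMap.opNorm_le_bound _ ENNReal.toReal_nonneg hFb)
  · have h4 : e (Finsupp.single n 1) = x n := by simp [e]
    have h5 : φ (Finsupp.single n 1) = dualDensity Λ (x n) t := by simp [φ]
    have := hF (Finsupp.single n 1)
    rwa [h4, h5] at this

/-- The pointwise functionals have measurable values on a dense sequence, hence at every vector, and
separability of `X*` makes them a measurable `X*`-valued function dominated by `H`. It represents
`Λ` on indicators with values in the dense sequence, and so everywhere by continuity. -/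
theorem exists_Lp_strongDual_representation [IsFiniteMeasure μ]
    [TopologicalSpace.SeparableSpace X]
    [TopologicalSpace.SeparableSpace (StrongDual ℝ X)] (Λ : StrongDual ℝ (Lp X 2 μ)) :
    ∃ g : Lp (StrongDual ℝ X) 2 μ, ∀ v : Lp X 2 μ, Λ v = ∫ t, g t (v t) ∂μ := by
  classical
  obtain ⟨H, hH, hH2, hae⟩ := exists_pointwise_functional Λ
  set x := TopologicalSpace.denseSeq X
  obtain ⟨N, hNsub, hNmeas, hN0⟩ := exists_measurable_superset_of_null (ae_iff.1 hae)
  -- Enlarging the bad set to a measurable null set and choosing `0` on it keeps every evaluation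
  -- measurable, whatever the choice of functionals.
  have hgood : ∀ t, ∃ f : StrongDual ℝ X, ‖f‖ₑ ≤ H t ∧
      ∀ n, f (x n) = Nᶜ.indicator (fun t => dualDensity Λ (x n) t) t := by
    intro t
    by_cases ht : t ∈ N
    · exact ⟨0, by rw [← ofReal_norm, norm_zero, ENNReal.ofReal_zero]; exact bot_le, by simp [ht]⟩
    · have : ¬ ¬ ∃ f : StrongDual ℝ X, ‖f‖ₑ ≤ H t ∧ ∀ n, f (x n) = dualDensity Λ (x n) t :=
        fun h => ht (hNsub h)
      obtain ⟨f, hf1, hf2⟩ := not_not.1 this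
      exact ⟨f, hf1, fun n => by simp [ht, hf2]⟩
  choose g hg1 hg2 using hgood
  have hgx : ∀ y, Measurable fun t => g t y := by
    intro y
    obtain ⟨s, hs⟩ : ∃ s : ℕ → ℕ, Tendsto (fun k => x (s k)) atTop (𝓝 y) := by
      have hy : y ∈ closure (range x) := TopologicalSpace.denseRange_denseSeq X y
      obtain ⟨w, hw1, hw2⟩ := mem_closure_iff_seq_limit.1 hy
      choose s hs using hw1
      exact ⟨s, by simpa [hs] using hw2⟩
    refine measurable_of_tendsto_metrizable (f := fun k t => g t (x (s k))) (fun k => ?_) ?_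
    · rw [show (fun t => g t (x (s k))) = _ from funext fun t => hg2 t (s k)]
      exact (Lp.stronglyMeasurable _).measurable.indicator hNmeas.compl
    · rw [tendsto_pi_nhds]
      exact fun t => ((g t).continuous.tendsto y).comp hs
  have hgm : StronglyMeasurable g := stronglyMeasurable_strongDual hgx
  have hgL : MemLp g 2 μ := by
    refine ⟨hgm.aestronglyMeasurable, ?_⟩
    rw [eLpNorm_lt_top_iff_lintegral_rpow_enorm_lt_top (by simp) (by simp)]
    simp only [ENNReal.toReal_ofNat, ENNReal.rpow_ofNat]
    refine lt_of_le_of_lt (lintegral_mono fun t => pow_le_pow_left' (hg1 t) 2) ?_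
    exact lt_of_le_of_lt hH2 (by simp)
  set gL : Lp (StrongDual ℝ X) 2 μ := hgL.toLp with hgL_def
  refine ⟨gL, fun v => ?_⟩
  set P : StrongDual ℝ (Lp X 2 μ) :=
    (ContinuousLinearMap.id ℝ (StrongDual ℝ X)).lpPairing μ 2 2 gL
  have hP : ∀ u, P u = ∫ t, gL t (u t) ∂μ := fun u => by
    simp only [P, ContinuousLinearMap.lpPairing_eq_integral]
    rfl
  rw [← hP]
  refine Lp.induction (p := 2) (by simp) (motive := fun v => Λ v = P v) (fun c {s} hs hμs => ?_)
    (fun f₁ f₂ _ _ _ h1 h2 => by rw [map_add, map_add, h1, h2])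
    (isClosed_eq (by fun_prop) (by fun_prop)) v
  · set h : Lp ℝ 2 μ := indicatorConstLp 2 hs hμs.ne 1
    have h1 : ∀ y : X, (Lp.simpleFunc.indicatorConst 2 hs hμs.ne y : Lp X 2 μ) =
        smulConstLp h y := by
      intro y
      rw [Lp.simpleFunc.coe_indicatorConst]
      ext1
      filter_upwards [coeFn_smulConstLp h y, indicatorConstLp_coeFn (p := 2) (hs := hs)
        (hμs := hμs.ne) (c := y), indicatorConstLp_coeFn (p := 2) (hs := hs)
        (hμs := hμs.ne) (c := (1 : ℝ))] with t k1 k2 k3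
      rw [k1, k2, k3]
      by_cases ht : t ∈ s <;> simp [ht]
    rw [h1]
    refine (TopologicalSpace.denseRange_denseSeq X).induction_on
      (p := fun y => Λ (smulConstLp h y) = P (smulConstLp h y)) c ?_ fun n => ?_
    · exact isClosed_eq (by fun_prop) (by fun_prop)
    · rw [hP, ← integral_dualDensity_mul]
      refine integral_congr_ae ?_
      have hNae : ∀ᵐ t ∂μ, t ∉ N := measure_eq_zero_iff_ae_notMem.1 hN0
      filter_upwards [hNae, hgL.coeFn_toLp, coeFn_smulConstLp h (x n)] with t k1 k2 k3
      have : smulConstLp h (TopologicalSpace.denseSeq X n) t = h t • x n := k3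
      rw [hgL_def, k2, this, map_smul, hg2]
      simp [k1, mul_comm, x]

end LpDualRepresentation

/-! ### Weak sequential compactness in `L²` with values in a reflexive space. -/

section WeakCompactness

variable {β : Type*} [MeasurableSpace β] {μ : Measure β}
variable {X : Type*} [NormedAddCommGroup X] [NormedSpace ℝ X]

/-- Sequential Banach–Alaoglu: `v n` acts through `B` as a bounded sequence of functionals on the
separable space `F`. The limit is found only in the dual of `F`. -/
theorem exists_subseq_tendsto_bilinear {A F : Type*} [NormedAddCommGroup A] [NormedSpace ℝ A]
    [NormedAddCommGroup F] [NormedSpace ℝ F] [TopologicalSpace.SeparableSpace F]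
    (B : F →L[ℝ] A →L[ℝ] ℝ) (v : ℕ → A) {R : ℝ} (hv : ∀ n, ‖v n‖ ≤ R) :
    ∃ (φ : ℕ → ℕ) (Λ : StrongDual ℝ F), StrictMono φ ∧
      ∀ g, Tendsto (fun k => B g (v (φ k))) atTop (𝓝 (Λ g)) := by
  have hball : ∀ n, StrongDual.toWeakDual (B.flip (v n)) ∈
      WeakDual.toStrongDual ⁻¹' Metric.closedBall (0 : StrongDual ℝ F) (‖B.flip‖ * R) := by
    intro n
    rw [mem_preimage, mem_closedBall_zero_iff]
    exact (B.flip.le_opNorm _).trans (by gcongr; exact hv n)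
  obtain ⟨Λ, -, φ, hφ, hlim⟩ := WeakDual.isSeqCompact_closedBall ℝ F 0 (‖B.flip‖ * R) hball
  exact ⟨φ, WeakDual.toStrongDual Λ, hφ, fun g =>
    ((WeakDual.eval_continuous g).tendsto Λ).comp hlim⟩

/-- Let `v n` act on `L²(X*)`, which is separable. The weak-* limit is represented by an
`X**`-valued function, and reflexivity turns it pointwise into an `X`-valued `w`. Since each
functional on `L²(X)` comes from an element of `L²(X*)`, this is weak convergence to `w`. -/
theorem exists_subseq_weak_tendsto_of_separable [IsFiniteMeasure μ]
    [MeasurableSpace.CountablyGenerated β] [TopologicalSpace.SeparableSpace X]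
    (hX : IsReflexiveSpace X) (v : ℕ → Lp X 2 μ) {R : ℝ} (hv : ∀ n, ‖v n‖ ≤ R) :
    ∃ (φ : ℕ → ℕ) (w : Lp X 2 μ), StrictMono φ ∧
      ∀ ℓ : StrongDual ℝ (Lp X 2 μ), Tendsto (fun k => ℓ (v (φ k))) atTop (𝓝 (ℓ w)) := by
  have h1 : TopologicalSpace.SeparableSpace (StrongDual ℝ X) := hX.separableSpace_strongDual
  have h2 : TopologicalSpace.SeparableSpace (StrongDual ℝ (StrongDual ℝ X)) :=
    hX.denseRange.separableSpace (NormedSpace.inclusionInDoubleDual ℝ X).continuous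
  have h3 : Fact ((2 : ℝ≥0∞) ≠ ⊤) := ⟨by simp⟩
  obtain ⟨φ, Λ, hφ, hlim⟩ := exists_subseq_tendsto_bilinear
    ((ContinuousLinearMap.id ℝ (StrongDual ℝ X)).lpPairing μ 2 2) v hv
  obtain ⟨h, hh⟩ := exists_Lp_strongDual_representation Λ
  set J : X ≃ₗᵢ[ℝ] StrongDual ℝ (StrongDual ℝ X) :=
    LinearIsometryEquiv.ofSurjective (NormedSpace.inclusionInDoubleDualLi ℝ (E := X)) hX
  have hJ : ∀ (z : StrongDual ℝ (StrongDual ℝ X)) (ℓ : StrongDual ℝ X), z ℓ = ℓ (J.symm z) := by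
    intro z ℓ
    conv_lhs => rw [← J.apply_symm_apply z]
    rfl
  set w : Lp X 2 μ := (J.symm.toContinuousLinearEquiv : _ →L[ℝ] X).compLp h
  refine ⟨φ, w, hφ, fun ℓ => ?_⟩
  obtain ⟨g, hg⟩ := exists_Lp_strongDual_representation ℓ
  have hw : ℓ w = Λ g := by
    rw [hg, hh]
    refine integral_congr_ae ?_
    filter_upwards [(J.symm.toContinuousLinearEquiv : _ →L[ℝ] X).coeFn_compLp h] with t ht
    rw [ht, hJ]
    rfl
  rw [hw]
  refine (hlim g).congr fun k => ?_
  rw [hg, ContinuousLinearMap.lpPairing_eq_integral]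
  rfl

theorem exists_Lp_subtype_lift {S : Submodule ℝ X} (v : Lp X 2 μ) (h : ∀ t, v t ∈ S) :
    ∃ u : Lp S 2 μ, S.subtypeL.compLp u = v ∧ ‖u‖ = ‖v‖ := by
  have hm : AEStronglyMeasurable (fun t => (⟨v t, h t⟩ : S)) μ :=
    Topology.IsEmbedding.subtypeVal.aestronglyMeasurable_comp_iff.1 (Lp.aestronglyMeasurable v)
  have hL : MemLp (fun t => (⟨v t, h t⟩ : S)) 2 μ :=
    (Lp.memLp v).of_le hm (Eventually.of_forall fun t => le_rfl)
  refine ⟨hL.toLp, ?_, ?_⟩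
  · ext1
    filter_upwards [S.subtypeL.coeFn_compLp hL.toLp, hL.coeFn_toLp] with t h1 h2
    rw [h1, h2]
    rfl
  · rw [Lp.norm_toLp, Lp.norm_def]
    rfl

/-- Strongly measurable representatives have separable range, so countably many of them live in one
separable closed subspace, to which reflexivity descends. -/
theorem exists_subseq_weak_tendsto [IsFiniteMeasure μ] [MeasurableSpace.CountablyGenerated β]
    (hX : IsReflexiveSpace X) (v : ℕ → Lp X 2 μ) {R : ℝ} (hv : ∀ n, ‖v n‖ ≤ R) :
    ∃ (φ : ℕ → ℕ) (w : Lp X 2 μ), StrictMono φ ∧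
      ∀ ℓ : StrongDual ℝ (Lp X 2 μ), Tendsto (fun k => ℓ (v (φ k))) atTop (𝓝 (ℓ w)) := by
  set S : Submodule ℝ X := (Submodule.span ℝ (⋃ n, range (v n))).topologicalClosure
  have hvS : ∀ n t, v n t ∈ S := fun n t =>
    Submodule.le_topologicalClosure _ (Submodule.subset_span (mem_iUnion.2 ⟨n, t, rfl⟩))
  have hsep : TopologicalSpace.IsSeparable (S : Set X) := by
    have : TopologicalSpace.IsSeparable (Submodule.span ℝ (⋃ n, range (v n)) : Set X) :=
      (TopologicalSpace.IsSeparable.iUnion fun n =>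
        (Lp.stronglyMeasurable (v n)).isSeparable_range).span
    simpa [S] using this.closure
  have hsep' : TopologicalSpace.SeparableSpace S := hsep.separableSpace
  choose u hu hun using fun n => exists_Lp_subtype_lift (v n) (hvS n)
  obtain ⟨φ, w, hφ, hw⟩ := exists_subseq_weak_tendsto_of_separable
    (hX.submodule (Submodule.isClosed_topologicalClosure _)) u (fun n => (hun n).trans_le (hv n))
  refine ⟨φ, S.subtypeL.compLp w, hφ, fun ℓ => ?_⟩
  have := hw (ℓ.comp (S.subtypeL.compLpL 2 μ))
  refine this.congr fun k => ?_
  rw [← hu (φ k)]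
  rfl

end WeakCompactness

/-! ### Chain rule along absolutely continuous curves and Grönwall's inequality. -/

section Gronwall

variable {E : Type*} [NormedAddCommGroup E] [NormedSpace ℝ E]
variable {G : Type*} [NormedAddCommGroup G]

/-- A function of time whose increments are `o(1)` times an absolutely continuous function
has no total increment. -/
theorem eq_of_forall_increment_le {h : ℝ → G} {m : ℝ → ℝ} {a b : ℝ} (hab : a ≤ b)
    (hm : IntervalIntegrable m volume a b)
    (H : ∀ ε > 0, ∃ δ > 0, ∀ s t, a ≤ s → s ≤ t → t ≤ b → t - s ≤ δ →
      ‖h t - h s‖ ≤ ε * ∫ r in s..t, m r) : h b = h a := by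
  have key : ∀ ε > 0, ‖h b - h a‖ ≤ ε * ∫ r in a..b, m r := by
    intro ε hε
    obtain ⟨δ, hδ, hH⟩ := H ε hε
    -- Cut `[a, b]` into `n` equal pieces shorter than `δ`; the bounds on the pieces add up to `ε`
    -- times the whole integral.
    obtain ⟨n, hn⟩ := exists_nat_gt ((b - a) / δ)
    have hn0 : (0 : ℝ) < n := lt_of_le_of_lt (div_nonneg (by linarith) hδ.le) hn
    set p : ℕ → ℝ := fun i => a + i * ((b - a) / n)
    have hp0 : p 0 = a := by simp [p]
    have hpn : p n = b := by
      simp only [p]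
      field_simp
      ring
    have hstep : 0 ≤ (b - a) / n := div_nonneg (by linarith) hn0.le
    have hmono : Monotone p := fun i j hij => by
      simp only [p]
      gcongr
    have hdiff : ∀ i, p (i + 1) - p i = (b - a) / n := fun i => by
      simp only [p]
      push_cast
      ring
    have hle : ∀ i ≤ n, p i ≤ b := fun i hi => hpn ▸ hmono hi
    have hge : ∀ i, a ≤ p i := fun i => hp0 ▸ hmono (Nat.zero_le i)
    have hint : ∀ i < n, IntervalIntegrable m volume (p i) (p (i + 1)) := fun i hi => by
      refine hm.mono_set ?_
      rw [uIcc_of_le (hmono i.le_succ), uIcc_of_le hab]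
      exact Icc_subset_Icc (hge i) (hle _ hi)
    have h1 : h b - h a = ∑ i ∈ Finset.range n, (h (p (i + 1)) - h (p i)) := by
      rw [Finset.sum_range_sub (fun i => h (p i)), hp0, hpn]
    rw [h1, ← hpn, ← hp0, ← intervalIntegral.sum_integral_adjacent_intervals hint,
      Finset.mul_sum]
    refine (norm_sum_le _ _).trans (Finset.sum_le_sum fun i hi => ?_)
    have hi' := Finset.mem_range.1 hi
    refine hH _ _ (hge i) (hmono i.le_succ) (hle _ hi') ?_
    rw [hdiff, div_le_iff₀ hn0]
    rw [div_lt_iff₀ hδ] at hn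
    linarith
  have hlim : Tendsto (fun ε : ℝ => ε * ∫ r in a..b, m r) (𝓝[>] 0) (𝓝 0) := by
    have : Tendsto (fun ε : ℝ => ε * ∫ r in a..b, m r) (𝓝 0) (𝓝 (0 * ∫ r in a..b, m r)) :=
      (continuous_id.mul continuous_const).tendsto 0
    rw [zero_mul] at this
    exact this.mono_left nhdsWithin_le_nhds
  have : ‖h b - h a‖ ≤ 0 := ge_of_tendsto hlim (by
    filter_upwards [self_mem_nhdsWithin] with ε hε using key ε hε)
  exact sub_eq_zero.1 (norm_le_zero_iff.1 this)

/-- Modulus of continuity of an absolutely continuous function. -/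
theorem exists_forall_integral_le {m : ℝ → ℝ} (hm : Integrable m) (a b : ℝ) {ε : ℝ}
    (hε : 0 < ε) : ∃ δ > 0, ∀ s t, a ≤ s → s ≤ t → t ≤ b → t - s ≤ δ →
      ∫ r in s..t, m r ≤ ε := by
  have hc : Continuous fun t => ∫ r in a..t, m r :=
    intervalIntegral.continuous_primitive (fun _ _ => hm.intervalIntegrable) a
  have hu : UniformContinuousOn (fun t => ∫ r in a..t, m r) (Icc a b) :=
    isCompact_Icc.uniformContinuousOn_of_continuous hc.continuousOn
  rw [Metric.uniformContinuousOn_iff] at hu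
  obtain ⟨δ, hδ, hH⟩ := hu ε hε
  refine ⟨δ / 2, by positivity, fun s t has hst htb hts => ?_⟩
  have := hH t ⟨has.trans hst, htb⟩ s ⟨has, hst.trans htb⟩ (by
    rw [Real.dist_eq, abs_of_nonneg (by linarith)]
    linarith)
  rw [Real.dist_eq, intervalIntegral.integral_interval_sub_left
    hm.intervalIntegrable hm.intervalIntegrable] at this
  exact (le_abs_self _).trans this.le

/-- The chain rule, in integrated form, along an absolutely continuous curve. -/
theorem sub_eq_integral_of_chain [NormedSpace ℝ G] [CompleteSpace G] [CompleteSpace E]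
    {g : E → G} {g' : E → E →L[ℝ] G} {S : Set E} (hS : Convex ℝ S)
    (hg : ∀ x ∈ S, HasFDerivWithinAt g (g' x) S x) (hg' : UniformContinuousOn g' S)
    {y b : ℝ → E} {s t : ℝ} (hst : s ≤ t) (hb : Integrable b) (hyS : ∀ r, y r ∈ S)
    (hy : ∀ p q, y q - y p = ∫ r in p..q, b r)
    (hgb : ∀ p q, IntervalIntegrable (fun r => g' (y r) (b r)) volume p q) :
    g (y t) - g (y s) = ∫ r in s..t, g' (y r) (b r) := by
  -- The difference of the two sides has increments at most `ε ∫ ‖b‖` over short intervals: half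
  -- comes from linearising `g` at `y p`, half from freezing `g'` at `y p` in the integral. No
  -- differentiability of `y` is needed.
  have hgoal : g (y t) - ∫ r in s..t, g' (y r) (b r) =
      g (y s) - ∫ r in s..s, g' (y r) (b r) := by
    refine eq_of_forall_increment_le (h := fun t => g (y t) - ∫ r in s..t, g' (y r) (b r))
      hst hb.norm.intervalIntegrable fun ε hε => ?_
    rw [Metric.uniformContinuousOn_iff] at hg'
    obtain ⟨ρ, hρ, hgρ⟩ := hg' (ε / 2) (by positivity)
    obtain ⟨δ, hδ, hδ'⟩ := exists_forall_integral_le hb.norm s t (show 0 < ρ / 2 by positivity)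
    refine ⟨δ, hδ, fun p q hp hpq hq hpqδ => ?_⟩
    have hclose : ∀ r ∈ Icc p q, ‖y r - y p‖ ≤ ρ / 2 := fun r hr => by
      rw [hy]
      refine (intervalIntegral.norm_integral_le_integral_norm hr.1).trans ?_
      exact hδ' p r hp hr.1 (hr.2.trans hq) (by linarith [hr.2])
    have hI : IntervalIntegrable (fun r => g' (y p) (b r)) volume p q :=
      ((g' (y p)).integrable_comp hb).intervalIntegrable
    have e1 : g (y q) - (∫ r in s..q, g' (y r) (b r)) - (g (y p) - ∫ r in s..p, g' (y r) (b r)) =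
        (g (y q) - g (y p) - g' (y p) (y q - y p)) -
          ∫ r in p..q, (g' (y r) (b r) - g' (y p) (b r)) := by
      rw [intervalIntegral.integral_sub (hgb _ _) hI, hy p q,
        (g' (y p)).intervalIntegral_comp_comm hb.intervalIntegrable,
        ← intervalIntegral.integral_interval_sub_left (hgb s q) (hgb s p)]
      abel
    have hseg : segment ℝ (y p) (y q) ⊆ S := hS.segment_subset (hyS p) (hyS q)
    have e2 : ‖g (y q) - g (y p) - g' (y p) (y q - y p)‖ ≤ ε / 2 * ‖y q - y p‖ := by
      refine (convex_segment (y p) (y q)).norm_image_sub_le_of_norm_hasFDerivWithin_le'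
        (f' := g') (fun x hx => (hg x (hseg hx)).mono hseg) (fun x hx => ?_)
        (left_mem_segment ℝ _ _) (right_mem_segment ℝ _ _)
      rw [← dist_eq_norm]
      refine (hgρ x (hseg hx) (y p) (hyS p) ?_).le
      rw [dist_eq_norm]
      have := norm_sub_le_of_mem_segment hx
      have := hclose q ⟨hpq, le_rfl⟩
      rw [norm_sub_rev]
      have h3 := norm_sub_rev (y p) (y q)
      linarith [norm_sub_rev x (y p)]
    have e3 : ‖∫ r in p..q, (g' (y r) (b r) - g' (y p) (b r))‖ ≤ ε / 2 * ∫ r in p..q, ‖b r‖ := by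
      rw [← intervalIntegral.integral_const_mul]
      refine intervalIntegral.norm_integral_le_of_norm_le hpq ?_
        (hb.norm.const_mul _).intervalIntegrable
      refine Eventually.of_forall fun r hr => ?_
      rw [← sub_apply]
      refine (ContinuousLinearMap.le_opNorm _ _).trans ?_
      gcongr
      rw [← dist_eq_norm]
      refine (hgρ (y r) (hyS r) (y p) (hyS p) ?_).le
      rw [dist_eq_norm]
      have := hclose r ⟨hr.1.le, hr.2⟩
      linarith
    have e4 : ‖y q - y p‖ ≤ ∫ r in p..q, ‖b r‖ := by
      rw [hy]
      exact intervalIntegral.norm_integral_le_integral_norm hpq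
    rw [e1]
    refine (norm_sub_le _ _).trans ?_
    nlinarith
  rw [intervalIntegral.integral_same, sub_zero] at hgoal
  rw [← hgoal]
  abel

/-- `|∫ₛᵗ L exp(2 |∫ₛʳ L|) dr| ≤ exp(2 |∫ₛᵗ L|) / 2`. -/
theorem abs_integral_mul_exp_le {L : ℝ → ℝ} (hL : Integrable L) (hL0 : ∀ t, 0 ≤ L t) (s t : ℝ) :
    |∫ r in s..t, L r * Real.exp (2 * |∫ q in s..r, L q|)| ≤
      Real.exp (2 * |∫ q in s..t, L q|) / 2 := by
  set A : ℝ → ℝ := fun r => ∫ q in s..r, L q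
  have hAc : Continuous A :=
    intervalIntegral.continuous_primitive (fun _ _ => hL.intervalIntegrable) s
  have hAsub : ∀ p q, A q - A p = ∫ r in p..q, L r := fun p q =>
    intervalIntegral.integral_interval_sub_left hL.intervalIntegrable hL.intervalIntegrable
  set B := ∫ q, L q
  have hAB : ∀ r, |A r| ≤ B := fun r => by
    have := intervalIntegral.norm_integral_le_integral_norm_uIoc (f := L) (a := s) (b := r)
      (μ := volume)
    refine this.trans ?_
    simp only [Real.norm_of_nonneg (hL0 _)]
    exact setIntegral_le_integral hL (Eventually.of_forall hL0)
  -- Since `|A|` is `A` after time `s` and `-A` before it, `σ = 2` and `σ = -2` cover both time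
  -- directions. The chain rule is applied on `[-B, B]`, where the derivative of the exponential is
  -- uniformly continuous.
  have main : ∀ σ : ℝ, ∀ p q, p ≤ q →
      Real.exp (σ * A q) - Real.exp (σ * A p) = ∫ r in p..q, σ * (L r * Real.exp (σ * A r)) := by
    intro σ p q hpq
    set g' : ℝ → ℝ →L[ℝ] ℝ := fun x =>
      ContinuousLinearMap.toSpanSingleton ℝ (σ * Real.exp (σ * x))
    have hg'c : Continuous g' := by
      refine (ContinuousLinearMap.toSpanSingletonCLE (𝕜 := ℝ) (E := ℝ)).continuous.comp ?_
      fun_prop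
    have := sub_eq_integral_of_chain (g := fun x : ℝ => Real.exp (σ * x)) (g' := g')
      (S := Icc (-B) B) (y := A) (b := L) (s := p) (t := q) (convex_Icc _ _)
      (fun x _ => ?_)
      (isCompact_Icc.uniformContinuousOn_of_continuous hg'c.continuousOn) hpq hL
      (fun r => abs_le.1 (hAB r)) hAsub (fun p q => ?_)
    · rw [this]
      refine intervalIntegral.integral_congr fun r _ => ?_
      simp [g']
      ring
    · have : HasDerivAt (fun x : ℝ => Real.exp (σ * x)) (σ * Real.exp (σ * x)) x := by
        have h1 : HasDerivAt (fun x : ℝ => σ * x) σ x := by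
          simpa using (hasDerivAt_id x).const_mul σ
        simpa [mul_comm] using h1.exp
      exact this.hasFDerivAt.hasFDerivWithinAt
    · have : (fun r => g' (A r) (L r)) = fun r => (σ * Real.exp (σ * A r)) * L r := by
        ext r
        simp [g', mul_comm]
      rw [this]
      exact hL.intervalIntegrable.continuousOn_mul (by fun_prop)
  have hA0 : A s = 0 := intervalIntegral.integral_same
  rcases le_total s t with hst | hst
  · have hpos : ∀ r ∈ Icc s t, |A r| = A r := fun r hr =>
      abs_of_nonneg (intervalIntegral.integral_nonneg hr.1 fun q _ => hL0 q)
    have e1 : ∫ r in s..t, L r * Real.exp (2 * |A r|) = ∫ r in s..t, L r * Real.exp (2 * A r) :=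
      intervalIntegral.integral_congr fun r hr => by
        rw [hpos r (by rwa [uIcc_of_le hst] at hr)]
    have e2 := main 2 s t hst
    rw [intervalIntegral.integral_const_mul, hA0, mul_zero, Real.exp_zero] at e2
    rw [e1, hpos t ⟨hst, le_rfl⟩, abs_of_nonneg (intervalIntegral.integral_nonneg hst
      fun r _ => mul_nonneg (hL0 r) (Real.exp_nonneg _))]
    linarith
  · have hneg : ∀ r ∈ Icc t s, |A r| = -A r := fun r hr => by
      refine abs_of_nonpos ?_
      simp only [A]
      rw [intervalIntegral.integral_symm]
      exact neg_nonpos.2 (intervalIntegral.integral_nonneg hr.2 fun q _ => hL0 q)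
    have e1 : ∫ r in t..s, L r * Real.exp (2 * |A r|) =
        ∫ r in t..s, L r * Real.exp (-2 * A r) :=
      intervalIntegral.integral_congr fun r hr => by
        rw [hneg r (by rwa [uIcc_of_le hst] at hr)]
        congr 2
        ring
    have e2 := main (-2) t s hst
    rw [intervalIntegral.integral_const_mul, hA0, mul_zero, Real.exp_zero] at e2
    rw [intervalIntegral.integral_symm, abs_neg, e1, hneg t ⟨le_rfl, hst⟩,
      abs_of_nonneg (intervalIntegral.integral_nonneg hst
        fun r _ => mul_nonneg (hL0 r) (Real.exp_nonneg _))]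
    have : Real.exp (2 * -A t) = Real.exp (-2 * A t) := by
      congr 1
      ring
    rw [this]
    linarith

theorem abs_integral_le_abs_integral_of_le {f g : ℝ → ℝ} {s t : ℝ}
    (hg : IntervalIntegrable g volume s t) (hf0 : ∀ r, 0 ≤ f r)
    (hfg : ∀ r ∈ uIcc s t, f r ≤ g r) : |∫ r in s..t, f r| ≤ |∫ r in s..t, g r| := by
  have hg0 : ∀ r ∈ uIcc s t, 0 ≤ g r := fun r hr => (hf0 r).trans (hfg r hr)
  have := intervalIntegral.norm_integral_le_abs_of_norm_le (f := f) (g := g) (a := s) (b := t)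
    (μ := volume) ((ae_restrict_mem measurableSet_uIoc).mono fun r hr => by
      rw [Real.norm_of_nonneg (hf0 r)]
      exact hfg r (uIoc_subset_uIcc hr)) hg
  exact this

/-- Grönwall's inequality, in both time directions, with a non-optimal constant. -/
theorem gronwall_two_sided {L u : ℝ → ℝ} (hL : Integrable L) (hL0 : ∀ t, 0 ≤ L t)
    (hu : Continuous u) (hu0 : ∀ t, 0 ≤ u t) {s t ε : ℝ}
    (h : ∀ r ∈ uIcc s t, u r ≤ ε + |∫ q in s..r, L q * u q|) :
    u t ≤ 2 * ε * Real.exp (2 * |∫ q in s..t, L q|) := by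
  set A : ℝ → ℝ := fun r => |∫ q in s..r, L q|
  have hAc : Continuous A :=
    (intervalIntegral.continuous_primitive (fun _ _ => hL.intervalIntegrable) s).abs
  -- Maximise `u` against the weight `exp (-2A)`. With the factor `2` in the exponent, the integral
  -- term at the maximum point is at most half of `u p` and can be absorbed; this is where the
  -- constant `2` in front of `ε` comes from.
  obtain ⟨p, hp, hmax⟩ := isCompact_uIcc.exists_isMaxOn (nonempty_uIcc (a := s) (b := t))
    (f := fun r => u r * Real.exp (-(2 * A r))) (by fun_prop)
  set M := u p * Real.exp (-(2 * A p))
  have hM0 : 0 ≤ M := mul_nonneg (hu0 _) (Real.exp_nonneg _)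
  have huM : ∀ r ∈ uIcc s t, u r ≤ M * Real.exp (2 * A r) := fun r hr => by
    have : u r * Real.exp (-(2 * A r)) ≤ M := hmax hr
    rwa [Real.exp_neg, ← div_eq_mul_inv, div_le_iff₀ (Real.exp_pos _)] at this
  have hsub : uIcc s p ⊆ uIcc s t := uIcc_subset_uIcc left_mem_uIcc hp
  have hint : IntervalIntegrable (fun r => L r * (M * Real.exp (2 * A r))) volume s p :=
    hL.intervalIntegrable.mul_continuousOn (by fun_prop)
  have h1 : |∫ q in s..p, L q * u q| ≤ M * (Real.exp (2 * A p) / 2) := by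
    refine (abs_integral_le_abs_integral_of_le hint (fun r => mul_nonneg (hL0 r) (hu0 r))
      fun r hr => mul_le_mul_of_nonneg_left (huM r (hsub hr)) (hL0 r)).trans ?_
    have : ∫ r in s..p, L r * (M * Real.exp (2 * A r)) =
        M * ∫ r in s..p, L r * Real.exp (2 * A r) := by
      rw [← intervalIntegral.integral_const_mul]
      congr 1
      ext r
      ring
    rw [this, abs_mul, abs_of_nonneg hM0]
    exact mul_le_mul_of_nonneg_left (abs_integral_mul_exp_le hL hL0 s p) hM0
  have h2 : u p = M * Real.exp (2 * A p) := by
    simp only [M]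
    rw [mul_assoc, ← Real.exp_add]
    simp
  have h3 := h p hp
  have h4 : M * Real.exp (2 * A p) ≤ 2 * ε := by
    rw [h2] at h3
    linarith
  have hM2 : M ≤ 2 * ε := by
    refine le_trans ?_ h4
    refine le_mul_of_one_le_right hM0 (Real.one_le_exp ?_)
    positivity
  refine (huM t right_mem_uIcc).trans ?_
  gcongr

end Gronwall

/-! ### Carathéodory differential equations with integrable Lipschitz constants. -/

section Picard

variable {E : Type*} [NormedAddCommGroup E] [NormedSpace ℝ E]

/-- `y` solves `y' = F(t, y)`, `y(s) = x` in the sense of Carathéodory. -/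
def IsCaratheodorySol (F : ℝ → E → E) (s : ℝ) (x : E) (y : ℝ → E) : Prop :=
  Continuous y ∧ ∀ t, y t = x + ∫ r in s..t, F r (y r)

/-- A right-hand side that is Lipschitz in space with an integrable constant. -/
structure IsCaratheodoryField (F : ℝ → E → E) (L : ℝ → ℝ) : Prop where
  integrable : Integrable L
  nonneg : ∀ t, 0 ≤ L t
  aestronglyMeasurable : ∀ y : ℝ → E, Continuous y → AEStronglyMeasurable (fun r => F r (y r))
  lipschitz : ∀ t x z, ‖F t x - F t z‖ ≤ L t * ‖x - z‖
  bound : ∀ x, ∃ C, ∀ t, ‖F t x‖ ≤ C * L t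

variable {F : ℝ → E → E} {L : ℝ → ℝ}

omit [NormedSpace ℝ E] in
theorem IsCaratheodoryField.intervalIntegrable (hF : IsCaratheodoryField F L) {y : ℝ → E}
    (hy : Continuous y) (a b : ℝ) : IntervalIntegrable (fun r => F r (y r)) volume a b := by
  obtain ⟨C, hC⟩ := hF.bound 0
  have h1 : IntervalIntegrable (fun r => L r * (‖y r‖ + C)) volume a b :=
    hF.integrable.intervalIntegrable.mul_continuousOn (by fun_prop)
  refine h1.mono_fun (hF.aestronglyMeasurable y hy).restrict (Eventually.of_forall fun r => ?_)
  have h2 := hF.lipschitz r (y r) 0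
  rw [sub_zero] at h2
  have h3 := norm_sub_norm_le (F r (y r)) (F r 0)
  have h4 := hC r
  refine le_trans ?_ (le_abs_self _)
  linarith

theorem IsCaratheodorySol.norm_sub_le (hF : IsCaratheodoryField F L) {s x z : _} {y w : ℝ → E}
    (hy : IsCaratheodorySol F s x y) (hw : IsCaratheodorySol F s z w) (t : ℝ) :
    ‖y t - w t‖ ≤ 2 * ‖x - z‖ * Real.exp (2 * |∫ q in s..t, L q|) := by
  have hyc := hy.1
  have hwc := hw.1
  refine gronwall_two_sided (u := fun r => ‖y r - w r‖) hF.integrable hF.nonneg (by fun_prop)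
    (fun r => norm_nonneg _) fun r _ => ?_
  have h1 : y r - w r = (x - z) + ∫ q in s..r, (F q (y q) - F q (w q)) := by
    rw [intervalIntegral.integral_sub (hF.intervalIntegrable hyc _ _)
      (hF.intervalIntegrable hwc _ _), hy.2 r, hw.2 r]
    abel
  rw [h1]
  refine (norm_add_le _ _).trans ?_
  gcongr
  refine intervalIntegral.norm_integral_le_abs_of_norm_le
    (Eventually.of_forall fun q => hF.lipschitz q _ _) ?_
  exact hF.integrable.intervalIntegrable.mul_continuousOn (by fun_prop)

theorem IsCaratheodorySol.unique (hF : IsCaratheodoryField F L) {s : ℝ} {x : E} {y w : ℝ → E}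
    (hy : IsCaratheodorySol F s x y) (hw : IsCaratheodorySol F s x w) : y = w := by
  ext t
  have := hy.norm_sub_le hF hw t
  rw [sub_self, norm_zero, mul_zero, zero_mul] at this
  exact sub_eq_zero.1 (norm_le_zero_iff.1 this)

theorem abs_intervalIntegral_le_integral {L : ℝ → ℝ} (hL : Integrable L) (hL0 : ∀ t, 0 ≤ L t)
    (s t : ℝ) : |∫ r in s..t, L r| ≤ ∫ r, L r := by
  refine (intervalIntegral.norm_integral_le_integral_norm_uIoc (f := L)).trans ?_
  simp only [Real.norm_of_nonneg (hL0 _)]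
  exact setIntegral_le_integral hL (Eventually.of_forall hL0)

/-- Picard iteration measured against the weight `exp (2A)`: by `abs_integral_mul_exp_le` each step
halves the distance, so the iterates converge uniformly on the whole line without a restriction to
short times. -/
theorem IsCaratheodoryField.exists_sol [CompleteSpace E] (hF : IsCaratheodoryField F L)
    (s : ℝ) (x : E) : ∃ y, IsCaratheodorySol F s x y := by
  obtain ⟨C, hC⟩ := hF.bound x
  set w : ℕ → ℝ → E := fun n => Nat.rec (fun _ => x) (fun _ y t => x + ∫ r in s..t, F r (y r)) n
  have hws : ∀ n t, w (n + 1) t = x + ∫ r in s..t, F r (w n r) := fun _ _ => rfl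
  have hwc : ∀ n, Continuous (w n) := fun n => by
    induction n with
    | zero => exact continuous_const
    | succ n ih =>
      exact continuous_const.add
        (intervalIntegral.continuous_primitive (fun a b => hF.intervalIntegrable ih a b) s)
  set A : ℝ → ℝ := fun r => |∫ q in s..r, L q|
  have hAc : Continuous A :=
    (intervalIntegral.continuous_primitive (fun _ _ => hF.integrable.intervalIntegrable) s).abs
  have hstep : ∀ n t, ‖w (n + 1) t - w n t‖ ≤ |C| * (1 / 2) ^ n * Real.exp (2 * A t) := by
    intro n
    induction n with
    | zero =>
      intro t
      have h1 : w (0 + 1) t - w 0 t = ∫ r in s..t, F r x := by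
        rw [hws]
        simp [w]
      rw [h1, pow_zero, mul_one]
      have h2 : ‖∫ r in s..t, F r x‖ ≤ |∫ r in s..t, |C| * L r| := by
        refine intervalIntegral.norm_integral_le_abs_of_norm_le
          (Eventually.of_forall fun r => (hC r).trans ?_)
          (hF.integrable.intervalIntegrable.const_mul _)
        exact mul_le_mul_of_nonneg_right (le_abs_self _) (hF.nonneg r)
      refine h2.trans ?_
      rw [intervalIntegral.integral_const_mul, abs_mul, abs_abs]
      gcongr
      have := Real.add_one_le_exp (2 * A t)
      have : 0 ≤ A t := abs_nonneg _
      change A t ≤ _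
      linarith
    | succ n ih =>
      intro t
      have h1 : w (n + 2) t - w (n + 1) t = ∫ r in s..t, (F r (w (n + 1) r) - F r (w n r)) := by
        rw [intervalIntegral.integral_sub (hF.intervalIntegrable (hwc (n + 1)) _ _)
          (hF.intervalIntegrable (hwc n) _ _), hws (n + 1), hws n]
        abel
      rw [h1]
      have hint : IntervalIntegrable (fun r => L r * (|C| * (1 / 2) ^ n * Real.exp (2 * A r)))
          volume s t := hF.integrable.intervalIntegrable.mul_continuousOn (by fun_prop)
      refine (intervalIntegral.norm_integral_le_abs_of_norm_le
        (Eventually.of_forall fun r => (hF.lipschitz r _ _).trans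
          (mul_le_mul_of_nonneg_left (ih r) (hF.nonneg r))) hint).trans ?_
      have h2 : ∫ r in s..t, L r * (|C| * (1 / 2) ^ n * Real.exp (2 * A r)) =
          |C| * (1 / 2) ^ n * ∫ r in s..t, L r * Real.exp (2 * A r) := by
        rw [← intervalIntegral.integral_const_mul]
        congr 1
        ext r
        ring
      rw [h2, abs_mul, abs_of_nonneg (by positivity : 0 ≤ |C| * (1 / 2) ^ n)]
      calc _ ≤ |C| * (1 / 2) ^ n * (Real.exp (2 * A t) / 2) := by
            gcongr
            exact abs_integral_mul_exp_le hF.integrable hF.nonneg s t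
        _ = _ := by ring
  set B := |C| * Real.exp (2 * ∫ r, L r)
  have hdist : ∀ t n, dist (w n t) (w (n + 1) t) ≤ B * (1 / 2) ^ n := fun t n => by
    rw [dist_comm, dist_eq_norm]
    refine (hstep n t).trans ?_
    have : Real.exp (2 * A t) ≤ Real.exp (2 * ∫ r, L r) := by
      gcongr
      exact abs_intervalIntegral_le_integral hF.integrable hF.nonneg s t
    calc _ ≤ |C| * (1 / 2) ^ n * Real.exp (2 * ∫ r, L r) := by gcongr
      _ = _ := by simp only [B]; ring
  have hcauchy : ∀ t, ∃ z, Tendsto (fun n => w n t) atTop (𝓝 z) := fun t =>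
    cauchySeq_tendsto_of_complete
      (cauchySeq_of_le_geometric (1 / 2) B (by norm_num) (hdist t))
  choose y hy using hcauchy
  have hyd : ∀ n t, ‖w n t - y t‖ ≤ B * (1 / 2) ^ n / (1 - 1 / 2) := fun n t => by
    rw [← dist_eq_norm]
    exact dist_le_of_le_geometric_of_tendsto (1 / 2) B (by norm_num) (hdist t) (hy t) n
  have hpow : Tendsto (fun n : ℕ => B * (1 / 2) ^ n / (1 - 1 / 2)) atTop (𝓝 0) := by
    have := ((tendsto_pow_atTop_nhds_zero_of_lt_one (r := (1 / 2 : ℝ)) (by norm_num)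
      (by norm_num)).const_mul B).div_const (1 - 1 / 2)
    simpa using this
  have hunif : TendstoUniformly w y atTop := by
    rw [Metric.tendstoUniformly_iff]
    intro ε hε
    filter_upwards [(tendsto_order.1 hpow).2 ε hε] with n hn t
    rw [dist_comm, dist_eq_norm]
    exact (hyd n t).trans_lt hn
  have hyc : Continuous y := hunif.continuous (Frequently.of_forall hwc)
  refine ⟨y, hyc, fun t => ?_⟩
  have hlim : Tendsto (fun n => w (n + 1) t) atTop (𝓝 (y t)) :=
    (hy t).comp (tendsto_add_atTop_nat 1)
  refine tendsto_nhds_unique hlim ?_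
  have hint : Tendsto (fun n => ∫ r in s..t, F r (w n r)) atTop (𝓝 (∫ r in s..t, F r (y r))) := by
    rw [tendsto_iff_norm_sub_tendsto_zero]
    refine squeeze_zero (fun n => norm_nonneg _)
      (g := fun n => (B * (1 / 2) ^ n / (1 - 1 / 2)) * |∫ r in s..t, L r|) (fun n => ?_) ?_
    · rw [← intervalIntegral.integral_sub (hF.intervalIntegrable (hwc _) _ _)
        (hF.intervalIntegrable hyc _ _)]
      have hK : 0 ≤ B * (1 / 2) ^ n / (1 - 1 / 2) := (norm_nonneg _).trans (hyd n s)
      rw [← abs_of_nonneg hK, ← abs_mul, ← intervalIntegral.integral_const_mul]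
      refine intervalIntegral.norm_integral_le_abs_of_norm_le
        (Eventually.of_forall fun r => (hF.lipschitz r _ _).trans ?_)
        (hF.integrable.intervalIntegrable.const_mul _)
      rw [mul_comm]
      exact mul_le_mul_of_nonneg_right (hyd n r) (hF.nonneg r)
    · simpa using hpow.mul_const |∫ r in s..t, L r|
  exact hint.const_add x

end Picard

/-! ### The flow of a time-dependent field, its derivative and their regularity. -/

section VelocityModel

variable {E : Type*} [NormedAddCommGroup E] [NormedSpace ℝ E]
variable {𝒱 : Type*} [NormedAddCommGroup 𝒱] [NormedSpace ℝ 𝒱]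

/-- Evaluation maps of a space `𝒱` of `C^{1,α}` vector fields vanishing outside `Ω`:
`ev x w` is the value of `w` at `x` and `Dv x w` its derivative. -/
structure IsVelocityModel (Ω : Set E) (ev : E → 𝒱 →L[ℝ] E) (Dv : E → 𝒱 →L[ℝ] E →L[ℝ] E)
    (c α : ℝ) : Prop where
  nonneg : 0 ≤ c
  pos : 0 < α
  norm_deriv_le : ∀ x, ‖Dv x‖ ≤ c
  norm_le : ∀ x, ‖ev x‖ ≤ c
  lipschitz : ∀ x z, ‖ev x - ev z‖ ≤ c * ‖x - z‖
  holder : ∀ x z, ‖Dv x - Dv z‖ ≤ c * ‖x - z‖ ^ α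
  hasFDerivAt : ∀ w x, HasFDerivAt (fun x => ev x w) (Dv x w) x
  eq_zero : ∀ x, x ∉ Ω → ev x = 0

variable {Ω : Set E} {ev : E → 𝒱 →L[ℝ] E} {Dv : E → 𝒱 →L[ℝ] E →L[ℝ] E} {c α : ℝ}
variable {u : ℝ → 𝒱}

/-- Grönwall for a linear equation with forcing `L r * ε`. It serves for the bound on the derivative
of the flow, for the Taylor remainder of the flow and for the Hölder estimate of its derivative. -/
theorem norm_le_of_eq_integral {G : Type*} [NormedAddCommGroup G] [NormedSpace ℝ G] {L : ℝ → ℝ}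
    (hL : Integrable L) (hL0 : ∀ t, 0 ≤ L t) {w b : ℝ → G} {w₀ : G} {s ε : ℝ} (hε : 0 ≤ ε)
    (hw : Continuous w) (hwb : ∀ t, w t = w₀ + ∫ r in s..t, b r)
    (hb : ∀ r, ‖b r‖ ≤ L r * ‖w r‖ + L r * ε) (t : ℝ) :
    ‖w t‖ ≤ 2 * (‖w₀‖ + ε * ∫ r, L r) * Real.exp (2 * ∫ r, L r) := by
  have hI : 0 ≤ ∫ r, L r := integral_nonneg hL0
  have h1 := gronwall_two_sided (u := fun r => ‖w r‖) (s := s) (t := t)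
    (ε := ‖w₀‖ + ε * ∫ r, L r) hL hL0 (by fun_prop)
    (fun r => norm_nonneg _) fun r _ => by
      have hi1 : IntervalIntegrable (fun q => L q * ‖w q‖) volume s r :=
        hL.intervalIntegrable.mul_continuousOn (by fun_prop)
      have hi2 : IntervalIntegrable (fun q => L q * ε) volume s r :=
        hL.intervalIntegrable.mul_const _
      have h2 : ‖∫ q in s..r, b q‖ ≤ |∫ q in s..r, (L q * ‖w q‖ + L q * ε)| :=
        intervalIntegral.norm_integral_le_abs_of_norm_le (Eventually.of_forall hb) (hi1.add hi2)
      rw [intervalIntegral.integral_add hi1 hi2, intervalIntegral.integral_mul_const] at h2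
      have h3 : |(∫ q in s..r, L q) * ε| ≤ ε * ∫ q, L q := by
        rw [abs_mul, abs_of_nonneg hε, mul_comm]
        gcongr
        exact abs_intervalIntegral_le_integral hL hL0 s r
      have h4 := abs_add_le (∫ q in s..r, L q * ‖w q‖) ((∫ q in s..r, L q) * ε)
      change ‖w r‖ ≤ _
      rw [hwb r]
      have := norm_add_le w₀ (∫ q in s..r, b q)
      rw [← hwb r] at this ⊢
      linarith
  refine h1.trans ?_
  gcongr
  exact abs_intervalIntegral_le_integral hL hL0 s t

theorem hasFDerivAt_of_norm_le_rpow {F : Type*} [NormedAddCommGroup F] [NormedSpace ℝ F]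
    {f : E → F} {f' : E →L[ℝ] F} {x : E} {K : ℝ} (hα : 0 < α)
    (h : ∀ k, ‖f (x + k) - f x - f' k‖ ≤ K * (‖k‖ ^ α * ‖k‖)) : HasFDerivAt f f' x := by
  rw [hasFDerivAt_iff_isLittleO_nhds_zero, Asymptotics.isLittleO_iff]
  intro ε hε
  have h1 : Tendsto (fun k : E => K * ‖k‖ ^ α) (𝓝 0) (𝓝 0) := by
    have : Continuous fun k : E => K * ‖k‖ ^ α :=
      continuous_const.mul (continuous_norm.rpow_const fun _ => Or.inr hα.le)
    simpa [hα.ne'] using this.tendsto 0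
  filter_upwards [(tendsto_order.1 h1).2 ε hε] with k hk
  refine (h k).trans ?_
  rw [← mul_assoc]
  gcongr

namespace IsVelocityModel

theorem continuous (hM : IsVelocityModel Ω ev Dv c α) : Continuous ev := by
  refine (LipschitzWith.of_dist_le_mul (K := ⟨c, hM.nonneg⟩) fun x z => ?_).continuous
  rw [dist_eq_norm, dist_eq_norm]
  exact hM.lipschitz x z

theorem continuous_deriv (hM : IsVelocityModel Ω ev Dv c α) : Continuous Dv := by
  rw [continuous_iff_continuousAt]
  intro x
  rw [ContinuousAt, tendsto_iff_norm_sub_tendsto_zero]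
  refine squeeze_zero (fun _ => norm_nonneg _) (fun z => hM.holder z x) ?_
  have : Continuous fun z : E => c * ‖z - x‖ ^ α :=
    continuous_const.mul ((continuous_id.sub continuous_const).norm.rpow_const
      fun _ => Or.inr hM.pos.le)
  simpa [hM.pos.ne'] using this.tendsto x

theorem norm_apply_le (hM : IsVelocityModel Ω ev Dv c α) (x : E) (w : 𝒱) : ‖ev x w‖ ≤ c * ‖w‖ :=
  ((ev x).le_opNorm w).trans (by gcongr; exact hM.norm_le x)

theorem norm_apply_sub_le (hM : IsVelocityModel Ω ev Dv c α) (x z : E) (w : 𝒱) :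
    ‖ev x w - ev z w‖ ≤ c * ‖w‖ * ‖x - z‖ := by
  rw [← sub_apply]
  refine ((ev x - ev z).le_opNorm w).trans ?_
  have := mul_le_mul_of_nonneg_right (hM.lipschitz x z) (norm_nonneg w)
  linarith

theorem norm_deriv_apply_le (hM : IsVelocityModel Ω ev Dv c α) (x : E) (w : 𝒱) :
    ‖Dv x w‖ ≤ c * ‖w‖ :=
  ((Dv x).le_opNorm w).trans (by gcongr; exact hM.norm_deriv_le x)

theorem norm_deriv_apply_sub_le (hM : IsVelocityModel Ω ev Dv c α) (x z : E) (w : 𝒱) :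
    ‖Dv x w - Dv z w‖ ≤ c * ‖w‖ * ‖x - z‖ ^ α := by
  rw [← sub_apply]
  refine ((Dv x - Dv z).le_opNorm w).trans ?_
  have := mul_le_mul_of_nonneg_right (hM.holder x z) (norm_nonneg w)
  linarith

/-- Mean value inequality on the segment, where the derivative differs from `Dv z w` by the Hölder
bound. -/
theorem norm_taylor_le (hM : IsVelocityModel Ω ev Dv c α) (x z : E) (w : 𝒱) :
    ‖ev x w - ev z w - Dv z w (x - z)‖ ≤ c * ‖w‖ * (‖x - z‖ ^ α * ‖x - z‖) := by
  rw [← mul_assoc]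
  refine (convex_segment z x).norm_image_sub_le_of_norm_hasFDerivWithin_le'
    (f := fun x => ev x w) (f' := fun x => Dv x w)
    (fun p _ => (hM.hasFDerivAt w p).hasFDerivWithinAt) (fun p hp => ?_)
    (left_mem_segment ℝ _ _) (right_mem_segment ℝ _ _)
  refine (hM.norm_deriv_apply_sub_le p z w).trans ?_
  have := hM.nonneg
  have := hM.pos
  gcongr
  exact norm_sub_le_of_mem_segment hp

theorem aestronglyMeasurable_apply (hM : IsVelocityModel Ω ev Dv c α)
    (hu : AEStronglyMeasurable u) {y : ℝ → E} (hy : Continuous y) :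
    AEStronglyMeasurable fun r => ev (y r) (u r) :=
  isBoundedBilinearMap_apply.continuous.comp_aestronglyMeasurable
    ((hM.continuous.comp hy).aestronglyMeasurable.prodMk hu)

theorem aestronglyMeasurable_deriv_apply (hM : IsVelocityModel Ω ev Dv c α)
    (hu : AEStronglyMeasurable u) {y : ℝ → E} (hy : Continuous y) :
    AEStronglyMeasurable fun r => Dv (y r) (u r) :=
  isBoundedBilinearMap_apply.continuous.comp_aestronglyMeasurable
    ((hM.continuous_deriv.comp hy).aestronglyMeasurable.prodMk hu)

theorem integrable_apply (hM : IsVelocityModel Ω ev Dv c α) (hu : Integrable u) {y : ℝ → E}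
    (hy : Continuous y) : Integrable fun r => ev (y r) (u r) :=
  (hu.norm.const_mul c).mono' (hM.aestronglyMeasurable_apply hu.aestronglyMeasurable hy)
    (Eventually.of_forall fun _ => hM.norm_apply_le _ _)

theorem isCaratheodoryField (hM : IsVelocityModel Ω ev Dv c α) (hu : Integrable u) :
    IsCaratheodoryField (fun t x => ev x (u t)) (fun t => c * ‖u t‖) where
  integrable := hu.norm.const_mul c
  nonneg t := mul_nonneg hM.nonneg (norm_nonneg _)
  aestronglyMeasurable y hy := hM.aestronglyMeasurable_apply hu.aestronglyMeasurable hy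
  lipschitz t x z := hM.norm_apply_sub_le x z (u t)
  bound x := ⟨1, fun t => by simpa using hM.norm_apply_le x (u t)⟩

theorem isCaratheodoryField_deriv (hM : IsVelocityModel Ω ev Dv c α) (hu : Integrable u)
    {y : ℝ → E} (hy : Continuous y) :
    IsCaratheodoryField (fun t (N : E →L[ℝ] E) => (Dv (y t) (u t)).comp N) (fun t => c * ‖u t‖) where
  integrable := hu.norm.const_mul c
  nonneg t := mul_nonneg hM.nonneg (norm_nonneg _)
  aestronglyMeasurable N hN :=
    isBoundedBilinearMap_comp.continuous.comp_aestronglyMeasurable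
      ((hM.aestronglyMeasurable_deriv_apply hu.aestronglyMeasurable hy).prodMk
        hN.aestronglyMeasurable)
  lipschitz t x z := by
    rw [← ContinuousLinearMap.comp_sub]
    refine (ContinuousLinearMap.opNorm_comp_le _ _).trans ?_
    gcongr
    exact hM.norm_deriv_apply_le _ _
  bound x := ⟨‖x‖, fun t => by
    refine (ContinuousLinearMap.opNorm_comp_le _ _).trans ?_
    rw [mul_comm]
    gcongr
    exact hM.norm_deriv_apply_le _ _⟩

end IsVelocityModel

/-- The flow of the time-dependent field `(t, x) ↦ ev x (u t)` from time `s` to time `t`. -/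
noncomputable def flow (ev : E → 𝒱 →L[ℝ] E) (u : ℝ → 𝒱) (s t : ℝ) (x : E) : E :=
  Classical.epsilon (fun y => IsCaratheodorySol (fun t x => ev x (u t)) s x y) t

/-- The solution of the linearised flow equation. -/
noncomputable def flowDeriv (ev : E → 𝒱 →L[ℝ] E) (Dv : E → 𝒱 →L[ℝ] E →L[ℝ] E) (u : ℝ → 𝒱)
    (s t : ℝ) (x : E) : E →L[ℝ] E :=
  Classical.epsilon (fun N => IsCaratheodorySol
    (fun t N => (Dv (flow ev u s t x) (u t)).comp N) s (ContinuousLinearMap.id ℝ E) N) t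

/-- A Lipschitz constant for the flow. -/
noncomputable def flowConst (c : ℝ) (u : ℝ → 𝒱) : ℝ :=
  2 * Real.exp (2 * ∫ r, c * ‖u r‖)

omit [NormedSpace ℝ 𝒱] in
theorem flowConst_pos (c : ℝ) (u : ℝ → 𝒱) : 0 < flowConst c u := by
  unfold flowConst
  positivity

variable [CompleteSpace E]

namespace IsVelocityModel

theorem isCaratheodorySol_flow (hM : IsVelocityModel Ω ev Dv c α) (hu : Integrable u) (s : ℝ)
    (x : E) : IsCaratheodorySol (fun t x => ev x (u t)) s x (fun t => flow ev u s t x) :=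
  Classical.epsilon_spec ((hM.isCaratheodoryField hu).exists_sol s x)

theorem continuous_flow_right (hM : IsVelocityModel Ω ev Dv c α) (hu : Integrable u) (s : ℝ)
    (x : E) : Continuous fun t => flow ev u s t x :=
  (hM.isCaratheodorySol_flow hu s x).1

theorem flow_eq (hM : IsVelocityModel Ω ev Dv c α) (hu : Integrable u) (s t : ℝ) (x : E) :
    flow ev u s t x = x + ∫ r in s..t, ev (flow ev u s r x) (u r) :=
  (hM.isCaratheodorySol_flow hu s x).2 t

theorem flow_sub_flow (hM : IsVelocityModel Ω ev Dv c α) (hu : Integrable u) (s p q : ℝ) (x : E) :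
    flow ev u s q x - flow ev u s p x = ∫ r in p..q, ev (flow ev u s r x) (u r) := by
  have hi := hM.integrable_apply hu (hM.continuous_flow_right hu s x)
  rw [hM.flow_eq hu s q, hM.flow_eq hu s p, add_sub_add_left_eq_sub,
    intervalIntegral.integral_interval_sub_left hi.intervalIntegrable hi.intervalIntegrable]

theorem flow_self (hM : IsVelocityModel Ω ev Dv c α) (hu : Integrable u) (s : ℝ) (x : E) :
    flow ev u s s x = x := by
  rw [hM.flow_eq hu, intervalIntegral.integral_same, add_zero]

/-- A trajectory is also the trajectory restarted from its position at time `t`, by uniqueness. -/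
theorem flow_flow (hM : IsVelocityModel Ω ev Dv c α) (hu : Integrable u) (s t r : ℝ) (x : E) :
    flow ev u t r (flow ev u s t x) = flow ev u s r x := by
  have h1 : IsCaratheodorySol (fun t x => ev x (u t)) t (flow ev u s t x)
      (fun r => flow ev u s r x) :=
    ⟨hM.continuous_flow_right hu s x, fun r => by rw [← hM.flow_sub_flow hu]; abel⟩
  exact congrFun ((hM.isCaratheodorySol_flow hu t _).unique (hM.isCaratheodoryField hu) h1) r

theorem norm_flow_sub_flow_le (hM : IsVelocityModel Ω ev Dv c α) (hu : Integrable u) (s t : ℝ)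
    (x z : E) : ‖flow ev u s t x - flow ev u s t z‖ ≤ flowConst c u * ‖x - z‖ := by
  have hF := hM.isCaratheodoryField hu
  refine ((hM.isCaratheodorySol_flow hu s x).norm_sub_le hF
    (hM.isCaratheodorySol_flow hu s z) t).trans ?_
  rw [flowConst, mul_right_comm]
  gcongr
  exact abs_intervalIntegral_le_integral hF.integrable hF.nonneg s t

theorem continuous_flow_left (hM : IsVelocityModel Ω ev Dv c α) (hu : Integrable u) (s t : ℝ) :
    Continuous (flow ev u s t) := by
  refine (LipschitzWith.of_dist_le_mul (K := ⟨flowConst c u, (flowConst_pos c u).le⟩)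
    fun x z => ?_).continuous
  rw [dist_eq_norm, dist_eq_norm]
  exact hM.norm_flow_sub_flow_le hu s t x z

theorem norm_flow_sub_self_le (hM : IsVelocityModel Ω ev Dv c α) (hu : Integrable u) (s t : ℝ)
    (x : E) : ‖flow ev u s t x - x‖ ≤ |∫ r in s..t, c * ‖u r‖| := by
  rw [hM.flow_eq hu, add_sub_cancel_left]
  exact intervalIntegral.norm_integral_le_abs_of_norm_le
    (Eventually.of_forall fun r => hM.norm_apply_le _ _) (hu.norm.const_mul c).intervalIntegrable

/-- The field vanishes outside `Ω`, so the constant path is a solution. -/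
theorem flow_of_notMem (hM : IsVelocityModel Ω ev Dv c α) (hu : Integrable u) (s t : ℝ) {x : E}
    (hx : x ∉ Ω) : flow ev u s t x = x := by
  have h1 : IsCaratheodorySol (fun t x => ev x (u t)) s x (fun _ => x) :=
    ⟨continuous_const, fun r => by simp [hM.eq_zero x hx]⟩
  exact congrFun ((hM.isCaratheodorySol_flow hu s x).unique (hM.isCaratheodoryField hu) h1) t

/-- If the flow reached a point outside `Ω`, flowing back would leave that point fixed, so the start
would lie outside `Ω` too. -/
theorem flow_mem (hM : IsVelocityModel Ω ev Dv c α) (hu : Integrable u) (s t : ℝ) {x : E}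
    (hx : x ∈ Ω) : flow ev u s t x ∈ Ω := by
  by_contra h
  have h1 := hM.flow_of_notMem hu t s h
  rw [hM.flow_flow hu, hM.flow_self hu] at h1
  exact h (h1 ▸ hx)

theorem flow_left_inv (hM : IsVelocityModel Ω ev Dv c α) (hu : Integrable u) (s t : ℝ) (x : E) :
    flow ev u t s (flow ev u s t x) = x := by
  rw [hM.flow_flow hu, hM.flow_self hu]

theorem isCaratheodorySol_flowDeriv (hM : IsVelocityModel Ω ev Dv c α) (hu : Integrable u)
    (s : ℝ) (x : E) : IsCaratheodorySol (fun t N => (Dv (flow ev u s t x) (u t)).comp N) s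
      (ContinuousLinearMap.id ℝ E) (fun t => flowDeriv ev Dv u s t x) :=
  Classical.epsilon_spec ((hM.isCaratheodoryField_deriv hu
    (hM.continuous_flow_right hu s x)).exists_sol s _)

theorem flowDeriv_eq (hM : IsVelocityModel Ω ev Dv c α) (hu : Integrable u) (s t : ℝ) (x : E) :
    flowDeriv ev Dv u s t x = ContinuousLinearMap.id ℝ E +
      ∫ r in s..t, (Dv (flow ev u s r x) (u r)).comp (flowDeriv ev Dv u s r x) :=
  (hM.isCaratheodorySol_flowDeriv hu s x).2 t

theorem norm_flowDeriv_le (hM : IsVelocityModel Ω ev Dv c α) (hu : Integrable u) (s t : ℝ)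
    (x : E) : ‖flowDeriv ev Dv u s t x‖ ≤ flowConst c u := by
  have hsol := hM.isCaratheodorySol_flowDeriv hu s x
  have hF := hM.isCaratheodoryField_deriv hu (hM.continuous_flow_right hu s x)
  have h1 := norm_le_of_eq_integral hF.integrable hF.nonneg le_rfl hsol.1 hsol.2 (fun r => by
    rw [mul_zero, add_zero]
    refine (ContinuousLinearMap.opNorm_comp_le _ _).trans ?_
    gcongr
    exact hM.norm_deriv_apply_le _ _) t
  refine h1.trans ?_
  rw [zero_mul, add_zero, flowConst]
  gcongr
  have := ContinuousLinearMap.norm_id_le (𝕜 := ℝ) (E := E)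
  linarith

/-- The remainder solves the linearised equation along the trajectory of `x` from initial value
zero. Its forcing is the Taylor error of the field between two trajectories, of order `1 + α` in
their distance, which is at most `flowConst c u * ‖k‖`. -/
theorem norm_flow_taylor_le (hM : IsVelocityModel Ω ev Dv c α) (hu : Integrable u) (s t : ℝ)
    (x k : E) :
    ‖flow ev u s t (x + k) - flow ev u s t x - flowDeriv ev Dv u s t x k‖ ≤
      2 * ((flowConst c u * ‖k‖) ^ α * (flowConst c u * ‖k‖) * ∫ r, c * ‖u r‖) *
        Real.exp (2 * ∫ r, c * ‖u r‖) := by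
  have hF := hM.isCaratheodoryField hu
  have hFd := hM.isCaratheodoryField_deriv hu (hM.continuous_flow_right hu s x)
  have hsol := hM.isCaratheodorySol_flowDeriv hu s x
  have hC := flowConst_pos c u
  have hi1 := hM.integrable_apply hu (hM.continuous_flow_right hu s (x + k))
  have hi2 := hM.integrable_apply hu (hM.continuous_flow_right hu s x)
  have hi3 : ∀ p q, IntervalIntegrable (fun r => (Dv (flow ev u s r x) (u r)).comp
      (flowDeriv ev Dv u s r x)) volume p q := fun p q => hFd.intervalIntegrable hsol.1 p q
  have hw : ∀ t, flow ev u s t (x + k) - flow ev u s t x - flowDeriv ev Dv u s t x k =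
      0 + ∫ r in s..t, (ev (flow ev u s r (x + k)) (u r) - ev (flow ev u s r x) (u r) -
        Dv (flow ev u s r x) (u r) (flowDeriv ev Dv u s r x k)) := by
    intro t
    have h1 : flowDeriv ev Dv u s t x k = k + ∫ r in s..t,
        Dv (flow ev u s r x) (u r) (flowDeriv ev Dv u s r x k) := by
      conv_lhs => rw [hM.flowDeriv_eq hu s t x, add_apply, ContinuousLinearMap.intervalIntegral_apply (hi3 s t)]
      rfl
    have hi4 : IntervalIntegrable (fun r => Dv (flow ev u s r x) (u r)
        (flowDeriv ev Dv u s r x k)) volume s t :=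
      ⟨(hi3 s t).1.apply_continuousLinearMap k, (hi3 s t).2.apply_continuousLinearMap k⟩
    rw [intervalIntegral.integral_sub
      (hi1.intervalIntegrable.sub hi2.intervalIntegrable) hi4,
      intervalIntegral.integral_sub hi1.intervalIntegrable hi2.intervalIntegrable, h1,
      hM.flow_eq hu s t (x + k), hM.flow_eq hu s t x]
    abel
  have hε : 0 ≤ (flowConst c u * ‖k‖) ^ α * (flowConst c u * ‖k‖) := by positivity
  have h2 := norm_le_of_eq_integral hF.integrable hF.nonneg hε
    (((hM.continuous_flow_right hu s (x + k)).sub (hM.continuous_flow_right hu s x)).sub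
      (hsol.1.clm_apply continuous_const)) hw (fun r => ?_) t
  · simpa using h2
  · set a := flow ev u s r (x + k)
    set b := flow ev u s r x
    set N := flowDeriv ev Dv u s r x
    have h3 : ev a (u r) - ev b (u r) - Dv b (u r) (N k) =
        Dv b (u r) (a - b - N k) + (ev a (u r) - ev b (u r) - Dv b (u r) (a - b)) := by
      rw [map_sub (Dv b (u r)) (a - b)]
      abel
    rw [h3]
    refine (norm_add_le _ _).trans (add_le_add ?_ ?_)
    · exact ((Dv b (u r)).le_opNorm _).trans
        (mul_le_mul_of_nonneg_right (hM.norm_deriv_apply_le _ _) (norm_nonneg _))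
    · have h4 : ‖a - b‖ ≤ flowConst c u * ‖k‖ := by
        simpa using hM.norm_flow_sub_flow_le hu s r (x + k) x
      have := hM.nonneg
      have := hM.pos
      refine (hM.norm_taylor_le a b (u r)).trans ?_
      gcongr

theorem hasFDerivAt_flow (hM : IsVelocityModel Ω ev Dv c α) (hu : Integrable u) (s t : ℝ)
    (x : E) : HasFDerivAt (flow ev u s t) (flowDeriv ev Dv u s t x) x := by
  refine hasFDerivAt_of_norm_le_rpow (K := 2 * (flowConst c u ^ α * flowConst c u *
    ∫ r, c * ‖u r‖) * Real.exp (2 * ∫ r, c * ‖u r‖)) hM.pos fun k => ?_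
  refine (hM.norm_flow_taylor_le hu s t x k).trans (le_of_eq ?_)
  rw [Real.mul_rpow (flowConst_pos c u).le (norm_nonneg k)]
  ring

/-- A Hölder constant for the derivative of the flow. -/
theorem norm_flowDeriv_sub_le (hM : IsVelocityModel Ω ev Dv c α) (hu : Integrable u) (s t : ℝ)
    (x z : E) : ‖flowDeriv ev Dv u s t x - flowDeriv ev Dv u s t z‖ ≤
      (2 * (flowConst c u ^ α * flowConst c u * ∫ r, c * ‖u r‖) *
        Real.exp (2 * ∫ r, c * ‖u r‖)) * ‖x - z‖ ^ α := by
  have hF := hM.isCaratheodoryField hu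
  have hx := hM.isCaratheodorySol_flowDeriv hu s x
  have hz := hM.isCaratheodorySol_flowDeriv hu s z
  have hix := (hM.isCaratheodoryField_deriv hu (hM.continuous_flow_right hu s x)).intervalIntegrable
    hx.1
  have hiz := (hM.isCaratheodoryField_deriv hu (hM.continuous_flow_right hu s z)).intervalIntegrable
    hz.1
  have hC := flowConst_pos c u
  have hw : ∀ t, flowDeriv ev Dv u s t x - flowDeriv ev Dv u s t z = 0 + ∫ r in s..t,
      ((Dv (flow ev u s r x) (u r)).comp (flowDeriv ev Dv u s r x) -
        (Dv (flow ev u s r z) (u r)).comp (flowDeriv ev Dv u s r z)) := by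
    intro t
    rw [intervalIntegral.integral_sub (hix s t) (hiz s t),
      hM.flowDeriv_eq hu s t x, hM.flowDeriv_eq hu s t z]
    abel
  have hε : 0 ≤ (flowConst c u * ‖x - z‖) ^ α * flowConst c u := by positivity
  have h2 := norm_le_of_eq_integral hF.integrable hF.nonneg hε (hx.1.sub hz.1) hw (fun r => ?_) t
  · refine h2.trans (le_of_eq ?_)
    rw [Real.mul_rpow hC.le (norm_nonneg _), norm_zero]
    ring
  · set a := flow ev u s r x
    set b := flow ev u s r z
    set N := flowDeriv ev Dv u s r x
    set N' := flowDeriv ev Dv u s r z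
    -- The first summand is linear in the unknown `N - N'` and goes to Grönwall; the second is the
    -- forcing, small by Hölder continuity of the field's derivative.
    have h3 : (Dv a (u r)).comp N - (Dv b (u r)).comp N' =
        (Dv a (u r)).comp (N - N') + (Dv a (u r) - Dv b (u r)).comp N' := by
      rw [ContinuousLinearMap.comp_sub, ContinuousLinearMap.sub_comp]
      abel
    rw [h3]
    refine (norm_add_le _ _).trans (add_le_add ?_ ?_)
    · exact (ContinuousLinearMap.opNorm_comp_le _ _).trans
        (mul_le_mul_of_nonneg_right (hM.norm_deriv_apply_le _ _) (norm_nonneg _))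
    · have h4 : ‖a - b‖ ≤ flowConst c u * ‖x - z‖ := hM.norm_flow_sub_flow_le hu s r x z
      have := hM.nonneg
      have := hM.pos
      refine (ContinuousLinearMap.opNorm_comp_le _ _).trans ?_
      rw [← mul_assoc]
      gcongr
      · exact (hM.norm_deriv_apply_sub_le a b (u r)).trans (by gcongr)
      · exact hM.norm_flowDeriv_le hu s r z

theorem norm_flowDeriv_sub_id_le (hM : IsVelocityModel Ω ev Dv c α) (hu : Integrable u) (s t : ℝ)
    (x : E) : ‖flowDeriv ev Dv u s t x - ContinuousLinearMap.id ℝ E‖ ≤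
      flowConst c u * |∫ r in s..t, c * ‖u r‖| := by
  rw [hM.flowDeriv_eq hu s t x, add_sub_cancel_left, ← abs_of_nonneg (flowConst_pos c u).le, ← abs_mul,
    ← intervalIntegral.integral_const_mul]
  refine intervalIntegral.norm_integral_le_abs_of_norm_le (Eventually.of_forall fun r => ?_)
    ((hu.norm.const_mul c).const_mul _).intervalIntegrable
  refine (ContinuousLinearMap.opNorm_comp_le _ _).trans ?_
  rw [mul_comm]
  have := flowConst_pos c u
  gcongr
  · exact hM.norm_flowDeriv_le hu s r x
  · exact hM.norm_deriv_apply_le _ _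

/-- Chain rule for `flow_flow` and uniqueness of the derivative. -/
theorem flowDeriv_comp (hM : IsVelocityModel Ω ev Dv c α) (hu : Integrable u) (s t r : ℝ)
    (x : E) : flowDeriv ev Dv u s r x =
      (flowDeriv ev Dv u t r (flow ev u s t x)).comp (flowDeriv ev Dv u s t x) := by
  have h1 := (hM.hasFDerivAt_flow hu t r (flow ev u s t x)).comp x (hM.hasFDerivAt_flow hu s t x)
  have h2 : flow ev u t r ∘ flow ev u s t = flow ev u s r :=
    funext fun x => hM.flow_flow hu s t r x
  rw [h2] at h1
  exact (hM.hasFDerivAt_flow hu s r x).unique h1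

theorem continuous_flowDeriv_left (hM : IsVelocityModel Ω ev Dv c α) (hu : Integrable u)
    (s t : ℝ) : Continuous (flowDeriv ev Dv u s t) := by
  rw [continuous_iff_continuousAt]
  intro x
  rw [ContinuousAt, tendsto_iff_norm_sub_tendsto_zero]
  refine squeeze_zero (fun _ => norm_nonneg _) (fun z => hM.norm_flowDeriv_sub_le hu s t z x) ?_
  have : Continuous fun z : E => (2 * (flowConst c u ^ α * flowConst c u * ∫ r, c * ‖u r‖) *
        Real.exp (2 * ∫ r, c * ‖u r‖)) * ‖z - x‖ ^ α :=
    continuous_const.mul ((continuous_id.sub continuous_const).norm.rpow_const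
      fun _ => Or.inr hM.pos.le)
  simpa [hM.pos.ne'] using this.tendsto x

theorem tendsto_abs_integral_zero {L : ℝ → ℝ} (hL : Integrable L) (s : ℝ) :
    Tendsto (fun p => |∫ r in p..s, L r|) (𝓝 s) (𝓝 0) := by
  have h3 : Continuous fun p => |∫ r in p..s, L r| := by
    simp only [intervalIntegral.integral_symm s, abs_neg]
    exact (intervalIntegral.continuous_primitive (fun _ _ => hL.intervalIntegrable) s).abs
  simpa using h3.tendsto s

theorem tendsto_flow_start_self (hM : IsVelocityModel Ω ev Dv c α) (hu : Integrable u) (s : ℝ)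
    (x : E) : Tendsto (fun p => flow ev u p s x) (𝓝 s) (𝓝 x) := by
  rw [tendsto_iff_norm_sub_tendsto_zero]
  exact squeeze_zero (fun _ => norm_nonneg _) (fun p => hM.norm_flow_sub_self_le hu p s x)
    (tendsto_abs_integral_zero (hu.norm.const_mul c) s)

/-- Continuity of the flow in the initial time. -/
theorem continuous_flow_start (hM : IsVelocityModel Ω ev Dv c α) (hu : Integrable u) (t : ℝ)
    (x : E) : Continuous fun s => flow ev u s t x := by
  rw [continuous_iff_continuousAt]
  intro s
  -- The flow from `p` to `t` factors through time `s`; the piece from `p` to `s` tends to the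
  -- identity.
  have h1 := ((hM.continuous_flow_left hu s t).tendsto x).comp (hM.tendsto_flow_start_self hu s x)
  exact h1.congr fun p => hM.flow_flow hu p s t x

/-- Continuity of the derivative of the flow in the initial time. -/
theorem continuous_flowDeriv_start (hM : IsVelocityModel Ω ev Dv c α) (hu : Integrable u) (t : ℝ)
    (x : E) : Continuous fun s => flowDeriv ev Dv u s t x := by
  rw [continuous_iff_continuousAt]
  intro s
  have h1 := ((hM.continuous_flowDeriv_left hu s t).tendsto x).comp
    (hM.tendsto_flow_start_self hu s x)
  have h2 : Tendsto (fun p => flowDeriv ev Dv u p s x) (𝓝 s) (𝓝 (ContinuousLinearMap.id ℝ E)) := by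
    rw [tendsto_iff_norm_sub_tendsto_zero]
    refine squeeze_zero (fun _ => norm_nonneg _) (fun p => hM.norm_flowDeriv_sub_id_le hu p s x) ?_
    simpa using (tendsto_abs_integral_zero (hu.norm.const_mul c) s).const_mul (flowConst c u)
  have h3 := (isBoundedBilinearMap_comp (𝕜 := ℝ) (E := E) (F := E) (G := E)).continuous.tendsto
    (flowDeriv ev Dv u s t x, ContinuousLinearMap.id ℝ E) |>.comp (h1.prodMk_nhds h2)
  rw [ContinuousAt]
  have h4 : (flowDeriv ev Dv u s t x).comp (ContinuousLinearMap.id ℝ E) =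
      flowDeriv ev Dv u s t x := ContinuousLinearMap.comp_id _
  simp only [h4] at h3
  exact h3.congr fun p => (hM.flowDeriv_comp hu p s t x).symm

end IsVelocityModel

end VelocityModel

/-! ### Weakly converging velocities and a Grönwall argument for sequences. -/

section Stability

variable {𝒱 : Type*} [NormedAddCommGroup 𝒱] [NormedSpace ℝ 𝒱]

/-- Bounded convergence of velocities, tested against continuous functions of time with values
in the dual space. -/
structure TendstoVelocity (u : ℕ → ℝ → 𝒱) (w : ℝ → 𝒱) (R : ℝ) : Prop where
  integrable : ∀ k, Integrable (u k)
  integrable_limit : Integrable w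
  integrable_sq : ∀ k, Integrable fun r => ‖u k r‖ ^ 2
  integral_norm_le : ∀ k, ∫ r, ‖u k r‖ ≤ R
  integral_sq_le : ∀ k, ∫ r, ‖u k r‖ ^ 2 ≤ R
  tendsto : ∀ A : ℝ → StrongDual ℝ 𝒱, Continuous A → ∀ s t,
    Tendsto (fun k => ∫ r in s..t, A r (u k r)) atTop (𝓝 (∫ r in s..t, A r (w r)))

variable {u : ℕ → ℝ → 𝒱} {w : ℝ → 𝒱} {R : ℝ}

theorem intervalIntegrable_clm_apply {G : Type*} [NormedAddCommGroup G] [NormedSpace ℝ G]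
    {A : ℝ → 𝒱 →L[ℝ] G} (hA : Continuous A) {f : ℝ → 𝒱} (hf : Integrable f) (s t : ℝ) :
    IntervalIntegrable (fun r => A r (f r)) volume s t := by
  have h1 : IntervalIntegrable (fun r => ‖f r‖ * ‖A r‖) volume s t :=
    hf.norm.intervalIntegrable.mul_continuousOn (by fun_prop)
  refine h1.mono_fun ?_ (Eventually.of_forall fun r => ?_)
  · exact (isBoundedBilinearMap_apply.continuous.comp_aestronglyMeasurable
      (hA.aestronglyMeasurable.prodMk hf.aestronglyMeasurable)).restrict
  · simp only [norm_mul, norm_norm]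
    rw [mul_comm]
    exact (A r).le_opNorm _

theorem tendsto_of_forall_strongDual {G : Type*} [NormedAddCommGroup G] [NormedSpace ℝ G]
    [FiniteDimensional ℝ G] {ι : Type*} {l : Filter ι} {f : ι → G} {z : G}
    (h : ∀ ℓ : StrongDual ℝ G, Tendsto (fun i => ℓ (f i)) l (𝓝 (ℓ z))) : Tendsto f l (𝓝 z) := by
  set b := Module.finBasis ℝ G
  have h1 : Tendsto (fun i => b.equivFunL (f i)) l (𝓝 (b.equivFunL z)) := by
    rw [tendsto_pi_nhds]
    intro j
    exact h (LinearMap.toContinuousLinearMap (b.coord j))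
  have h2 := (b.equivFunL.symm.continuous.tendsto _).comp h1
  simpa [Function.comp_def] using h2

/-- In finite dimensions convergence can be checked on functionals, and a functional composed with
`A` is again a continuous path in the dual. -/
theorem TendstoVelocity.tendsto_clm {G : Type*} [NormedAddCommGroup G] [NormedSpace ℝ G]
    [FiniteDimensional ℝ G] (h : TendstoVelocity u w R) {A : ℝ → 𝒱 →L[ℝ] G} (hA : Continuous A)
    (s t : ℝ) :
    Tendsto (fun k => ∫ r in s..t, A r (u k r)) atTop (𝓝 (∫ r in s..t, A r (w r))) := by
  have : CompleteSpace G := FiniteDimensional.complete ℝ G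
  refine tendsto_of_forall_strongDual fun ℓ => ?_
  have hA' : Continuous fun r => ℓ.comp (A r) := continuous_const.clm_comp hA
  have h1 := h.tendsto _ hA' s t
  have h2 : ∀ f : ℝ → 𝒱, Integrable f →
      ℓ (∫ r in s..t, A r (f r)) = ∫ r in s..t, (ℓ.comp (A r)) (f r) := fun f hf =>
    (ℓ.intervalIntegral_comp_comm (intervalIntegrable_clm_apply hA hf s t)).symm
  rw [h2 w h.integrable_limit]
  exact h1.congr fun k => (h2 _ (h.integrable k)).symm

/-- Hölder's inequality in the limit: integrals of an `L²`-bounded sequence against a bounded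
sequence converging pointwise to `0`. -/
theorem tendsto_abs_integral_mul_zero {L e : ℕ → ℝ → ℝ} {R B : ℝ}
    (hL0 : ∀ k r, 0 ≤ L k r) (hLsq : ∀ k, Integrable fun r => L k r ^ 2)
    (hLR : ∀ k, ∫ r, L k r ^ 2 ≤ R) (he : ∀ k, Continuous (e k)) (he0 : ∀ k r, 0 ≤ e k r)
    (heB : ∀ k r, e k r ≤ B) (hlim : ∀ r, Tendsto (fun k => e k r) atTop (𝓝 0)) (s t : ℝ) :
    Tendsto (fun k => |∫ r in s..t, L k r * e k r|) atTop (𝓝 0) := by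
  have hR : 0 ≤ R := (integral_nonneg fun r => sq_nonneg _).trans (hLR 0)
  have hB : 0 ≤ B := (he0 0 0).trans (heB 0 0)
  have hesq : Tendsto (fun k => ∫ r in s..t, e k r ^ 2) atTop (𝓝 0) := by
    have := intervalIntegral.tendsto_integral_filter_of_dominated_convergence
      (μ := volume) (a := s) (b := t) (F := fun k r => e k r ^ 2) (f := fun _ => (0 : ℝ))
      (l := atTop) (fun _ => B ^ 2)
      (Eventually.of_forall fun k => ((he k).pow 2).aestronglyMeasurable)
      (Eventually.of_forall fun k => Eventually.of_forall fun r _ => by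
        rw [Real.norm_of_nonneg (sq_nonneg _)]
        exact pow_le_pow_left₀ (he0 k r) (heB k r) 2)
      intervalIntegrable_const
      (Eventually.of_forall fun r _ => by simpa using (hlim r).pow 2)
    simpa using this
  -- Young's inequality with a free parameter: `τ` first makes the bounded part small, then `k` does
  -- the rest through dominated convergence.
  have key : ∀ τ > 0, ∀ k, |∫ r in s..t, L k r * e k r| ≤
      τ * R + τ⁻¹ * |∫ r in s..t, e k r ^ 2| := by
    intro τ hτ k
    have hi1 : IntervalIntegrable (fun r => τ * L k r ^ 2) volume s t :=
      ((hLsq k).const_mul τ).intervalIntegrable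
    have hi2 : IntervalIntegrable (fun r => τ⁻¹ * e k r ^ 2) volume s t :=
      (continuous_const.mul ((he k).pow 2)).intervalIntegrable _ _
    refine (abs_integral_le_abs_integral_of_le (hi1.add hi2)
      (fun r => mul_nonneg (hL0 k r) (he0 k r)) fun r _ => ?_).trans ?_
    · have h1 : 0 ≤ (τ * L k r - e k r) ^ 2 := sq_nonneg _
      have h2 : 0 ≤ τ⁻¹ * (τ * L k r - e k r) ^ 2 := by positivity
      have h3 : τ⁻¹ * (τ * L k r - e k r) ^ 2 =
          τ * L k r ^ 2 + τ⁻¹ * e k r ^ 2 - 2 * (L k r * e k r) := by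
        field_simp
        ring
      have h4 := mul_nonneg (hL0 k r) (he0 k r)
      linarith
    · rw [intervalIntegral.integral_add hi1 hi2]
      refine (abs_add_le _ _).trans ?_
      rw [intervalIntegral.integral_const_mul, intervalIntegral.integral_const_mul, abs_mul,
        abs_mul, abs_of_pos hτ, abs_of_pos (inv_pos.2 hτ)]
      gcongr
      exact (abs_intervalIntegral_le_integral (hLsq k) (fun r => sq_nonneg _) s t).trans (hLR k)
  rw [Metric.tendsto_atTop]
  intro ε hε
  set τ := ε / (2 * (R + 1))
  have hτ : 0 < τ := by positivity
  have hτR : τ * R < ε / 2 + 0 := by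
    simp only [τ]
    rw [add_zero, div_mul_eq_mul_div, div_lt_div_iff₀ (by positivity) (by positivity)]
    nlinarith
  have h1 : Tendsto (fun k => τ⁻¹ * |∫ r in s..t, e k r ^ 2|) atTop (𝓝 0) := by
    simpa using hesq.abs.const_mul τ⁻¹
  obtain ⟨N, hN⟩ := eventually_atTop.1 ((tendsto_order.1 h1).2 (ε / 2) (by positivity))
  refine ⟨N, fun k hk => ?_⟩
  rw [Real.dist_eq, sub_zero, abs_abs]
  have := key τ hτ k
  have := hN k hk
  linarith

/-- A Grönwall argument for sequences with `L²`-bounded coefficients. -/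
theorem tendsto_zero_of_gronwall {G : Type*} [NormedAddCommGroup G] [NormedSpace ℝ G]
    {L : ℕ → ℝ → ℝ} {R B : ℝ}
    (hL : ∀ k, Integrable (L k)) (hL0 : ∀ k r, 0 ≤ L k r)
    (hLsq : ∀ k, Integrable fun r => L k r ^ 2)
    (hLR1 : ∀ k, ∫ r, L k r ≤ R) (hLR : ∀ k, ∫ r, L k r ^ 2 ≤ R)
    {z a e : ℕ → ℝ → G} {s : ℝ} (hz : ∀ k, Continuous (z k)) (he : ∀ k, Continuous (e k))
    (heB : ∀ k t, ‖e k t‖ ≤ B) (hlim : ∀ t, Tendsto (fun k => e k t) atTop (𝓝 0))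
    (hzae : ∀ k t, z k t = (∫ r in s..t, a k r) + e k t)
    (ha : ∀ k r, ‖a k r‖ ≤ L k r * ‖z k r‖) (t : ℝ) :
    Tendsto (fun k => z k t) atTop (𝓝 0) := by
  -- Grönwall is applied to the integral `V`, not to `z`: the error `e k` tends to zero only
  -- pointwise in time, whereas its integral against `L k` gives one constant `η k` that tends to
  -- zero.
  set V : ℕ → ℝ → ℝ := fun k r => |∫ q in s..r, L k q * ‖z k q‖|
  have hLz : ∀ k p q, IntervalIntegrable (fun r => L k r * ‖z k r‖) volume p q := fun k p q =>
    (hL k).intervalIntegrable.mul_continuousOn (by have := hz k; fun_prop)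
  have hLe : ∀ k p q, IntervalIntegrable (fun r => L k r * ‖e k r‖) volume p q := fun k p q =>
    (hL k).intervalIntegrable.mul_continuousOn (by have := he k; fun_prop)
  have hVc : ∀ k, Continuous (V k) := fun k =>
    (intervalIntegral.continuous_primitive (hLz k) s).abs
  have hzV : ∀ k r, ‖z k r‖ ≤ V k r + ‖e k r‖ := fun k r => by
    rw [hzae k r]
    refine (norm_add_le _ _).trans ?_
    gcongr
    exact intervalIntegral.norm_integral_le_abs_of_norm_le (Eventually.of_forall (ha k))
      (hLz k s r)
  set η : ℕ → ℝ := fun k => |∫ r in s..t, L k r * ‖e k r‖|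
  have hη : Tendsto η atTop (𝓝 0) := by
    refine tendsto_abs_integral_mul_zero (e := fun k r => ‖e k r‖) hL0 hLsq hLR
      (fun k => (he k).norm) (fun k r => norm_nonneg _) heB (fun r => ?_) s t
    simpa using (hlim r).norm
  have hVη : ∀ k, V k t ≤ 2 * η k * Real.exp (2 * R) := by
    intro k
    have h1 := gronwall_two_sided (s := s) (t := t) (ε := η k) (hL k) (hL0 k) (hVc k)
      (fun r => abs_nonneg _) fun r hr => by
        have hLV : IntervalIntegrable (fun q => L k q * V k q) volume s r :=
          (hL k).intervalIntegrable.mul_continuousOn (hVc k).continuousOn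
        have h2 : V k r ≤ |∫ q in s..r, (L k q * V k q + L k q * ‖e k q‖)| := by
          refine abs_integral_le_abs_integral_of_le (hLV.add (hLe k s r))
            (fun q => mul_nonneg (hL0 k q) (norm_nonneg _)) fun q _ => ?_
          rw [← mul_add]
          exact mul_le_mul_of_nonneg_left (hzV k q) (hL0 k q)
        rw [intervalIntegral.integral_add hLV (hLe k s r)] at h2
        have h3 : |∫ q in s..r, L k q * ‖e k q‖| ≤ η k := by
          refine intervalIntegral.abs_integral_mono_interval ?_ ?_ (hLe k s t)
          · exact uIoc_subset_uIoc_of_uIcc_subset_uIcc (uIcc_subset_uIcc left_mem_uIcc hr)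
          · exact Eventually.of_forall fun q => mul_nonneg (hL0 k q) (norm_nonneg _)
        have := abs_add_le (∫ q in s..r, L k q * V k q) (∫ q in s..r, L k q * ‖e k q‖)
        linarith
    refine h1.trans ?_
    have : 0 ≤ η k := abs_nonneg _
    gcongr
    exact (abs_intervalIntegral_le_integral (hL k) (hL0 k) s t).trans (hLR1 k)
  rw [tendsto_zero_iff_norm_tendsto_zero]
  refine squeeze_zero (fun _ => norm_nonneg _)
    (fun k => (hzV k t).trans (add_le_add_left (hVη k) _)) ?_
  have h1 : Tendsto (fun k => ‖e k t‖) atTop (𝓝 0) := by simpa using (hlim t).norm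
  have h2 := ((hη.const_mul 2).mul_const (Real.exp (2 * R))).add h1
  simpa using h2

end Stability

/-! ### Weak continuity of the flow and of its derivative in the velocity. -/

section FlowStability

variable {E : Type*} [NormedAddCommGroup E] [NormedSpace ℝ E] [FiniteDimensional ℝ E]
variable {𝒱 : Type*} [NormedAddCommGroup 𝒱] [NormedSpace ℝ 𝒱]
variable {Ω : Set E} {ev : E → 𝒱 →L[ℝ] E} {Dv : E → 𝒱 →L[ℝ] E →L[ℝ] E} {c α : ℝ}
variable {u : ℕ → ℝ → 𝒱} {w : ℝ → 𝒱} {R : ℝ}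

namespace IsVelocityModel

omit [FiniteDimensional ℝ E] in
theorem flowConst_le (hM : IsVelocityModel Ω ev Dv c α) (h : TendstoVelocity u w R) (k : ℕ) :
    flowConst c (u k) ≤ 2 * Real.exp (2 * (c * R)) := by
  unfold flowConst
  rw [integral_const_mul]
  have := hM.nonneg
  have := h.integral_norm_le k
  gcongr

theorem integral_sq_le (h : TendstoVelocity u w R) (k : ℕ) :
    ∫ r, (c * ‖u k r‖) ^ 2 ≤ c ^ 2 * R := by
  simp only [mul_pow]
  rw [integral_const_mul]
  have := h.integral_sq_le k
  gcongr

theorem integrable_sq (h : TendstoVelocity u w R) (k : ℕ) :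
    Integrable fun r => (c * ‖u k r‖) ^ 2 := by
  simp only [mul_pow]
  exact (h.integrable_sq k).const_mul _

omit [FiniteDimensional ℝ E] in
theorem abs_integral_norm_le (hM : IsVelocityModel Ω ev Dv c α) (h : TendstoVelocity u w R)
    (k : ℕ) (s t : ℝ) : |∫ r in s..t, c * ‖u k r‖| ≤ c * R := by
  refine (abs_intervalIntegral_le_integral ((h.integrable k).norm.const_mul c)
    (fun r => mul_nonneg hM.nonneg (norm_nonneg _)) s t).trans ?_
  rw [integral_const_mul]
  have := hM.nonneg
  have := h.integral_norm_le k
  gcongr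

theorem nonneg_bound (h : TendstoVelocity u w R) : 0 ≤ R :=
  (integral_nonneg fun _ => norm_nonneg _).trans (h.integral_norm_le 0)

/-- The flow depends continuously on the velocity, in the weak topology. -/
theorem tendsto_flow (hM : IsVelocityModel Ω ev Dv c α) (h : TendstoVelocity u w R) (s t : ℝ)
    (x : E) : Tendsto (fun k => flow ev (u k) s t x) atTop (𝓝 (flow ev w s t x)) := by
  have : CompleteSpace E := FiniteDimensional.complete ℝ E
  have hcw := hM.continuous_flow_right h.integrable_limit s x
  have hck := fun k => hM.continuous_flow_right (h.integrable k) s x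
  have hF := fun k => hM.isCaratheodoryField (h.integrable k)
  have hA : Continuous fun r => ev (flow ev w s r x) := hM.continuous.comp hcw
  have hi1 := fun k => hM.integrable_apply (h.integrable k) (hck k)
  have hi2 := fun k => hM.integrable_apply (h.integrable k) hcw
  have hi3 := hM.integrable_apply h.integrable_limit hcw
  -- The trajectory in `e` is that of the limit velocity and does not depend on `k`, so weak
  -- convergence makes `e` tend to zero. The rest of the difference of the flows is Lipschitz in
  -- that difference.
  set e : ℕ → ℝ → E := fun k t =>
    ∫ r in s..t, (ev (flow ev w s r x) (u k r) - ev (flow ev w s r x) (w r))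
  have hB : ∀ k t, ‖e k t‖ ≤ c * R + ∫ r, c * ‖w r‖ := by
    intro k t
    simp only [e]
    rw [intervalIntegral.integral_sub (hi2 k).intervalIntegrable hi3.intervalIntegrable]
    refine (norm_sub_le _ _).trans (add_le_add ?_ ?_)
    · refine le_trans ?_ (hM.abs_integral_norm_le h k s t)
      exact intervalIntegral.norm_integral_le_abs_of_norm_le
        (Eventually.of_forall fun r => hM.norm_apply_le _ _) (hF k).integrable.intervalIntegrable
    · refine le_trans ?_ (abs_intervalIntegral_le_integral (h.integrable_limit.norm.const_mul c)
        (fun r => mul_nonneg hM.nonneg (norm_nonneg _)) s t)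
      exact intervalIntegral.norm_integral_le_abs_of_norm_le
        (Eventually.of_forall fun r => hM.norm_apply_le _ _)
        (h.integrable_limit.norm.const_mul c).intervalIntegrable
  rw [tendsto_iff_norm_sub_tendsto_zero]
  have key := tendsto_zero_of_gronwall (L := fun k r => c * ‖u k r‖)
    (R := max (c * R) (c ^ 2 * R)) (fun k => (hF k).integrable)
    (fun k => (hF k).nonneg) (integrable_sq h)
    (fun k => by
      rw [integral_const_mul]
      refine le_trans ?_ (le_max_left _ _)
      exact mul_le_mul_of_nonneg_left (h.integral_norm_le k) hM.nonneg)
    (fun k => (integral_sq_le h k).trans (le_max_right _ _))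
    (z := fun k r => flow ev (u k) s r x - flow ev w s r x)
    (a := fun k r => ev (flow ev (u k) s r x) (u k r) - ev (flow ev w s r x) (u k r))
    (e := e) (s := s)
    (fun k => (hck k).sub hcw)
    (fun k => intervalIntegral.continuous_primitive
      (fun _ _ => ((hi2 k).sub hi3).intervalIntegrable) s)
    hB
    (fun t => by
      have h1 := (h.tendsto_clm hA s t).sub_const (∫ r in s..t, ev (flow ev w s r x) (w r))
      rw [sub_self] at h1
      refine h1.congr fun k => ?_
      simp only [e]
      rw [intervalIntegral.integral_sub (hi2 k).intervalIntegrable hi3.intervalIntegrable])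
    (fun k t => by
      simp only [e]
      rw [intervalIntegral.integral_sub (hi2 k).intervalIntegrable hi3.intervalIntegrable,
        intervalIntegral.integral_sub (hi1 k).intervalIntegrable (hi2 k).intervalIntegrable,
        hM.flow_eq (h.integrable k) s t x, hM.flow_eq h.integrable_limit s t x]
      abel)
    (fun k r => hM.norm_apply_sub_le _ _ _) t
  simpa using key.norm

/-- The derivative of the flow depends continuously on the velocity, in the weak topology. -/
theorem tendsto_flowDeriv (hM : IsVelocityModel Ω ev Dv c α) (h : TendstoVelocity u w R)
    (s t : ℝ) (x : E) :
    Tendsto (fun k => flowDeriv ev Dv (u k) s t x) atTop (𝓝 (flowDeriv ev Dv w s t x)) := by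
  have : CompleteSpace E := FiniteDimensional.complete ℝ E
  have hcw := hM.continuous_flow_right h.integrable_limit s x
  have hck := fun k => hM.continuous_flow_right (h.integrable k) s x
  have hF := fun k => hM.isCaratheodoryField (h.integrable k)
  have hFw := hM.isCaratheodoryField h.integrable_limit
  have hNw := (hM.isCaratheodorySol_flowDeriv h.integrable_limit s x).1
  have hNk := fun k => (hM.isCaratheodorySol_flowDeriv (h.integrable k) s x).1
  set y := fun r => flow ev w s r x with hy
  set yk := fun k r => flow ev (u k) s r x with hyk
  set N := fun r => flowDeriv ev Dv w s r x with hN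
  set Nk := fun k r => flowDeriv ev Dv (u k) s r x with hNk_def
  set C := flowConst c w
  have hC : 0 < C := flowConst_pos c w
  have hNC : ∀ r, ‖N r‖ ≤ C := fun r => hM.norm_flowDeriv_le h.integrable_limit s r x
  set A : ℝ → 𝒱 →L[ℝ] E →L[ℝ] E := fun r =>
    ((ContinuousLinearMap.compL ℝ E E E).flip (N r)).comp (Dv (y r))
  have hAapp : ∀ r v, A r v = (Dv (y r) v).comp (N r) := fun _ _ => rfl
  have hA : Continuous A :=
    ((ContinuousLinearMap.compL ℝ E E E).flip.continuous.comp hNw).clm_comp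
      (hM.continuous_deriv.comp hcw)
  have hik : ∀ k p q, IntervalIntegrable (fun r => (Dv (yk k r) (u k r)).comp (Nk k r))
      volume p q := fun k p q =>
    (hM.isCaratheodoryField_deriv (h.integrable k) (hck k)).intervalIntegrable (hNk k) p q
  have hikm : ∀ k p q, IntervalIntegrable (fun r => (Dv (yk k r) (u k r)).comp (N r))
      volume p q := fun k p q =>
    (hM.isCaratheodoryField_deriv (h.integrable k) (hck k)).intervalIntegrable hNw p q
  have hiku : ∀ k p q, IntervalIntegrable (fun r => (Dv (y r) (u k r)).comp (N r))
      volume p q := fun k p q =>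
    (hM.isCaratheodoryField_deriv (h.integrable k) hcw).intervalIntegrable hNw p q
  have hiw : ∀ p q, IntervalIntegrable (fun r => (Dv (y r) (w r)).comp (N r))
      volume p q := fun p q =>
    (hM.isCaratheodoryField_deriv h.integrable_limit hcw).intervalIntegrable hNw p q
  have hcomp : ∀ (P : E →L[ℝ] E) (r : ℝ), ‖P.comp (N r)‖ ≤ C * ‖P‖ := fun P r => by
    refine (ContinuousLinearMap.opNorm_comp_le _ _).trans ?_
    rw [mul_comm]
    gcongr
    exact hNC r
  have hbnd : ∀ (v : ℝ → 𝒱) (q : ℝ → E), Integrable v →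
      ∀ t, ‖∫ r in s..t, (Dv (q r) (v r)).comp (N r)‖ ≤ C * ∫ r, c * ‖v r‖ := by
    intro v q hv t
    have hi := hv.norm.const_mul c
    have h1 : ‖∫ r in s..t, (Dv (q r) (v r)).comp (N r)‖ ≤ |∫ r in s..t, C * (c * ‖v r‖)| := by
      refine intervalIntegral.norm_integral_le_abs_of_norm_le (Eventually.of_forall fun r => ?_)
        (hi.const_mul C).intervalIntegrable
      refine (hcomp _ _).trans ?_
      gcongr
      exact hM.norm_deriv_apply_le _ _
    rw [intervalIntegral.integral_const_mul, abs_mul, abs_of_pos hC] at h1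
    refine h1.trans ?_
    gcongr
    exact abs_intervalIntegral_le_integral hi (fun r => mul_nonneg hM.nonneg (norm_nonneg _)) s t
  -- Here `N` is the limit solution, but the trajectory `yk k` still varies with `k`; it is
  -- exchanged for `y` in `hdiff`, after which weak convergence applies to the fixed path `A`.
  set e : ℕ → ℝ → E →L[ℝ] E := fun k t =>
    (∫ r in s..t, (Dv (yk k r) (u k r)).comp (N r)) - ∫ r in s..t, (Dv (y r) (w r)).comp (N r)
  have heB : ∀ k t, ‖e k t‖ ≤ C * (c * R) + C * ∫ r, c * ‖w r‖ := by
    intro k t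
    refine (norm_sub_le _ _).trans (add_le_add ((hbnd _ _ (h.integrable k) t).trans ?_)
      (hbnd _ _ h.integrable_limit t))
    rw [integral_const_mul]
    have := hM.nonneg
    have := h.integral_norm_le k
    gcongr
  -- By Hölder continuity the integrand is at most `c ‖u k r‖` times `C ‖yk k r - y r‖ ^ α`: the
  -- first factor is bounded in `L²`, the second is bounded and tends to zero pointwise by
  -- `tendsto_flow`.
  have hdiff : ∀ t, Tendsto (fun k => ∫ r in s..t,
      ((Dv (yk k r) (u k r)).comp (N r) - (Dv (y r) (u k r)).comp (N r))) atTop (𝓝 0) := by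
    intro t
    have hR := nonneg_bound h
    have hlim := tendsto_abs_integral_mul_zero (L := fun k r => c * ‖u k r‖)
      (e := fun k r => C * ‖yk k r - y r‖ ^ α) (R := c ^ 2 * R)
      (B := C * (c * R + ∫ r, c * ‖w r‖) ^ α)
      (fun k => (hF k).nonneg) (integrable_sq h) (integral_sq_le h)
      (fun k => continuous_const.mul (((hck k).sub hcw).norm.rpow_const
        fun _ => Or.inr hM.pos.le))
      (fun k r => by positivity)
      (fun k r => by
        have := hM.pos
        gcongr
        have h1 := (hM.norm_flow_sub_self_le (h.integrable k) s r x).trans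
          (hM.abs_integral_norm_le h k s r)
        have h2 := (hM.norm_flow_sub_self_le h.integrable_limit s r x).trans
          (abs_intervalIntegral_le_integral hFw.integrable hFw.nonneg s r)
        have h3 := norm_sub_le_norm_sub_add_norm_sub (yk k r) x (y r)
        rw [norm_sub_rev x (y r)] at h3
        exact h3.trans (add_le_add h1 h2))
      (fun r => by
        have h1 := tendsto_iff_norm_sub_tendsto_zero.1 (hM.tendsto_flow h s r x)
        have h2 := (h1.rpow_const (p := α) (Or.inr hM.pos.le)).const_mul C
        simpa [hM.pos.ne'] using h2) s t
    refine squeeze_zero_norm (fun k => ?_) hlim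
    refine intervalIntegral.norm_integral_le_abs_of_norm_le (Eventually.of_forall fun r => ?_)
      ((hF k).integrable.intervalIntegrable.mul_continuousOn (continuous_const.mul
        (((hck k).sub hcw).norm.rpow_const fun _ => Or.inr hM.pos.le)).continuousOn)
    rw [← ContinuousLinearMap.sub_comp]
    refine (hcomp _ _).trans ?_
    have := mul_le_mul_of_nonneg_left (hM.norm_deriv_apply_sub_le (yk k r) (y r) (u k r)) hC.le
    refine this.trans (le_of_eq ?_)
    ring
  have helim : ∀ t, Tendsto (fun k => e k t) atTop (𝓝 0) := by
    intro t
    have h1 := (h.tendsto_clm hA s t).sub_const (∫ r in s..t, A r (w r))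
    rw [sub_self] at h1
    have h2 := (hdiff t).add h1
    rw [add_zero] at h2
    refine h2.congr fun k => ?_
    rw [intervalIntegral.integral_sub (hikm k s t) (hiku k s t)]
    simp only [hAapp, e]
    abel
  rw [tendsto_iff_norm_sub_tendsto_zero]
  have key := tendsto_zero_of_gronwall (L := fun k r => c * ‖u k r‖)
    (R := max (c * R) (c ^ 2 * R)) (fun k => (hF k).integrable)
    (fun k => (hF k).nonneg) (integrable_sq h)
    (fun k => by
      rw [integral_const_mul]
      refine le_trans ?_ (le_max_left _ _)
      exact mul_le_mul_of_nonneg_left (h.integral_norm_le k) hM.nonneg)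
    (fun k => (integral_sq_le h k).trans (le_max_right _ _))
    (z := fun k r => Nk k r - N r)
    (a := fun k r => (Dv (yk k r) (u k r)).comp (Nk k r) - (Dv (yk k r) (u k r)).comp (N r))
    (e := e) (s := s) (fun k => (hNk k).sub hNw)
    (fun k => (intervalIntegral.continuous_primitive (hikm k) s).sub
      (intervalIntegral.continuous_primitive hiw s))
    heB helim
    (fun k t => by
      simp only [e]
      rw [intervalIntegral.integral_sub (hik k s t) (hikm k s t)]
      have e1 := hM.flowDeriv_eq (h.integrable k) s t x
      have e2 := hM.flowDeriv_eq h.integrable_limit s t x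
      simp only [hNk_def, hN, hyk, hy]
      rw [e1, e2]
      abel)
    (fun k r => by
      rw [← ContinuousLinearMap.comp_sub]
      exact (ContinuousLinearMap.opNorm_comp_le _ _).trans
        (mul_le_mul_of_nonneg_right (hM.norm_deriv_apply_le _ _) (norm_nonneg _))) t
  simpa using key.norm

end IsVelocityModel

end FlowStability

/-! ### Transport of `L²` functions by diffeomorphisms and its stability. -/

section Transport

variable {d : ℕ} {Ω : Set (EuclideanSpace ℝ (Fin d))}

/-- `Z` is a diffeomorphism of `Ω` with derivative `J`. -/
structure IsDiffeoOn (Ω : Set (EuclideanSpace ℝ (Fin d)))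
    (Z : EuclideanSpace ℝ (Fin d) → EuclideanSpace ℝ (Fin d))
    (J : EuclideanSpace ℝ (Fin d) → EuclideanSpace ℝ (Fin d) →L[ℝ] EuclideanSpace ℝ (Fin d)) :
    Prop where
  image_eq : Z '' Ω = Ω
  injOn : InjOn Z Ω
  hasFDerivAt : ∀ x, HasFDerivAt Z (J x) x
  continuous_deriv : Continuous J

/-- The density of the image of the measure `f dx` under the inverse of `Z`. -/
noncomputable def transportFun
    (Z : EuclideanSpace ℝ (Fin d) → EuclideanSpace ℝ (Fin d))
    (J : EuclideanSpace ℝ (Fin d) → EuclideanSpace ℝ (Fin d) →L[ℝ] EuclideanSpace ℝ (Fin d))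
    (f : EuclideanSpace ℝ (Fin d) → ℝ) (y : EuclideanSpace ℝ (Fin d)) : ℝ :=
  f (Z y) * |(J y).det|

variable {Z : EuclideanSpace ℝ (Fin d) → EuclideanSpace ℝ (Fin d)}
variable {J : EuclideanSpace ℝ (Fin d) → EuclideanSpace ℝ (Fin d) →L[ℝ] EuclideanSpace ℝ (Fin d)}

theorem exists_abs_det_le (C : ℝ) : ∃ B : ℝ≥0,
    ∀ L : EuclideanSpace ℝ (Fin d) →L[ℝ] EuclideanSpace ℝ (Fin d), ‖L‖ ≤ C → |L.det| ≤ B := by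
  have hc : IsCompact (Metric.closedBall
      (0 : EuclideanSpace ℝ (Fin d) →L[ℝ] EuclideanSpace ℝ (Fin d)) C) :=
    have := FiniteDimensional.proper ℝ (EuclideanSpace ℝ (Fin d) →L[ℝ] EuclideanSpace ℝ (Fin d))
    isCompact_closedBall _ _
  obtain ⟨B, hB⟩ := hc.exists_bound_of_continuousOn
    (ContinuousLinearMap.continuous_det (𝕜 := ℝ) (E := EuclideanSpace ℝ (Fin d))).continuousOn
  refine ⟨B.toNNReal, fun L hL => (hB L (by simpa using hL)).trans (Real.le_coe_toNNReal B)⟩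

theorem eLpNorm_two_eq {β : Type*} [MeasurableSpace β] {μ : Measure β} (f : β → ℝ) :
    eLpNorm f 2 μ = (∫⁻ x, ‖f x‖ₑ ^ 2 ∂μ) ^ (1 / 2 : ℝ) := by
  rw [eLpNorm_eq_lintegral_rpow_enorm_toReal (by simp) (by simp)]
  simp

namespace IsDiffeoOn

theorem continuous (h : IsDiffeoOn Ω Z J) : Continuous Z :=
  continuous_iff_continuousAt.2 fun x => (h.hasFDerivAt x).continuousAt

theorem continuous_abs_det (h : IsDiffeoOn Ω Z J) : Continuous fun y => |(J y).det| :=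
  (ContinuousLinearMap.continuous_det.comp h.continuous_deriv).abs

theorem lintegral_comp (h : IsDiffeoOn Ω Z J) (hΩ : MeasurableSet Ω)
    (g : EuclideanSpace ℝ (Fin d) → ℝ≥0∞) :
    ∫⁻ y in Ω, ENNReal.ofReal |(J y).det| * g (Z y) = ∫⁻ x in Ω, g x := by
  rw [← lintegral_image_eq_lintegral_abs_det_fderiv_mul volume hΩ
    (fun x _ => (h.hasFDerivAt x).hasFDerivWithinAt) h.injOn, h.image_eq]

theorem integral_comp (h : IsDiffeoOn Ω Z J) (hΩ : MeasurableSet Ω)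
    (g : EuclideanSpace ℝ (Fin d) → ℝ) :
    ∫ y in Ω, |(J y).det| * g (Z y) = ∫ x in Ω, g x := by
  conv_rhs => rw [← h.image_eq]
  rw [integral_image_eq_integral_abs_det_fderiv_smul volume hΩ
    (fun x _ => (h.hasFDerivAt x).hasFDerivWithinAt) h.injOn]
  rfl

theorem integral_transportFun_mul (h : IsDiffeoOn Ω Z J) (hΩ : MeasurableSet Ω)
    {X : EuclideanSpace ℝ (Fin d) → EuclideanSpace ℝ (Fin d)} (hX : ∀ y, X (Z y) = y)
    (f q : EuclideanSpace ℝ (Fin d) → ℝ) :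
    ∫ y in Ω, transportFun Z J f y * q y = ∫ x in Ω, f x * q (X x) := by
  rw [← h.integral_comp hΩ fun x => f x * q (X x)]
  refine integral_congr_ae (Eventually.of_forall fun y => ?_)
  simp only [transportFun, hX]
  ring

/-- Squaring produces two Jacobian factors: one is absorbed by the change of variables, the other is
bounded by `B`. -/
theorem eLpNorm_transportFun_le (h : IsDiffeoOn Ω Z J) (hΩ : MeasurableSet Ω) {B : ℝ≥0}
    (hB : ∀ y, |(J y).det| ≤ B) (f : EuclideanSpace ℝ (Fin d) → ℝ) :
    eLpNorm (transportFun Z J f) 2 (volume.restrict Ω) ≤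
      (B : ℝ≥0∞) ^ (1 / 2 : ℝ) * eLpNorm f 2 (volume.restrict Ω) := by
  rw [eLpNorm_two_eq, eLpNorm_two_eq, ← ENNReal.mul_rpow_of_nonneg _ _ (by norm_num)]
  refine ENNReal.rpow_le_rpow ?_ (by norm_num)
  rw [← h.lintegral_comp hΩ fun x => ‖f x‖ₑ ^ 2, ← lintegral_const_mul' _ _ (by simp)]
  refine lintegral_mono fun y => ?_
  simp only [transportFun]
  rw [enorm_mul, mul_pow, Real.enorm_of_nonneg (abs_nonneg (J y).det), mul_comm, sq, mul_assoc]
  gcongr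
  rw [← ENNReal.ofReal_coe_nnreal]
  exact ENNReal.ofReal_le_ofReal (hB y)

theorem memLp_transportFun (h : IsDiffeoOn Ω Z J) (hΩ : MeasurableSet Ω) {B : ℝ≥0}
    (hB : ∀ y, |(J y).det| ≤ B) (f : ImageSpace Ω) :
    MemLp (transportFun Z J f) 2 (volume.restrict Ω) := by
  refine ⟨?_, ?_⟩
  · exact (((Lp.stronglyMeasurable f).comp_measurable h.continuous.measurable).mul
      h.continuous_abs_det.stronglyMeasurable).aestronglyMeasurable
  · refine (h.eLpNorm_transportFun_le hΩ hB f).trans_lt ?_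
    exact ENNReal.mul_lt_top (ENNReal.rpow_lt_top_of_nonneg (by norm_num) (by simp))
      (Lp.memLp f).eLpNorm_lt_top

end IsDiffeoOn

/-- For continuous `φ` the transported functions converge pointwise and are uniformly bounded, so
finite volume allows dominated convergence. -/
theorem tendsto_eLpNorm_transportFun_of_continuous {ι : Type*} {l : Filter ι}
    [l.IsCountablyGenerated]
    {Zk : ι → EuclideanSpace ℝ (Fin d) → EuclideanSpace ℝ (Fin d)}
    {Jk : ι → EuclideanSpace ℝ (Fin d) → EuclideanSpace ℝ (Fin d) →L[ℝ] EuclideanSpace ℝ (Fin d)}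
    (hk : ∀ k, IsDiffeoOn Ω (Zk k) (Jk k)) (h : IsDiffeoOn Ω Z J) (hΩb : volume Ω ≠ ⊤) {B : ℝ≥0}
    (hBk : ∀ k y, |(Jk k y).det| ≤ B) (hB : ∀ y, |(J y).det| ≤ B)
    (hZ : ∀ y, Tendsto (fun k => Zk k y) l (𝓝 (Z y)))
    (hJ : ∀ y, Tendsto (fun k => Jk k y) l (𝓝 (J y)))
    {φ : EuclideanSpace ℝ (Fin d) → ℝ} (hφ : Continuous φ) (hφc : HasCompactSupport φ) :
    Tendsto (fun k => eLpNorm (transportFun (Zk k) (Jk k) φ - transportFun Z J φ) 2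
      (volume.restrict Ω)) l (𝓝 0) := by
  obtain ⟨M, hM⟩ := hφ.bounded_above_of_compact_support hφc
  have hM0 : 0 ≤ M := (norm_nonneg _).trans (hM 0)
  have hb : ∀ {Z : EuclideanSpace ℝ (Fin d) → EuclideanSpace ℝ (Fin d)}
      {J : EuclideanSpace ℝ (Fin d) → EuclideanSpace ℝ (Fin d) →L[ℝ] EuclideanSpace ℝ (Fin d)},
      (∀ y, |(J y).det| ≤ B) → ∀ y, ‖transportFun Z J φ y‖ ≤ M * B := by
    intro Z J hB y
    rw [transportFun, norm_mul, Real.norm_eq_abs |_|, abs_abs]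
    gcongr
    · exact hM _
    · exact hB y
  have hcont : ∀ {Z : EuclideanSpace ℝ (Fin d) → EuclideanSpace ℝ (Fin d)}
      {J : EuclideanSpace ℝ (Fin d) → EuclideanSpace ℝ (Fin d) →L[ℝ] EuclideanSpace ℝ (Fin d)},
      IsDiffeoOn Ω Z J → Continuous (transportFun Z J φ) := fun h =>
    (hφ.comp h.continuous).mul h.continuous_abs_det
  have h1 : Tendsto (fun k => ∫⁻ y in Ω,
      ‖transportFun (Zk k) (Jk k) φ y - transportFun Z J φ y‖ₑ ^ 2) l (𝓝 0) := by
    have := tendsto_lintegral_filter_of_dominated_convergence (μ := volume.restrict Ω) (l := l)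
      (F := fun k y => ‖transportFun (Zk k) (Jk k) φ y - transportFun Z J φ y‖ₑ ^ 2)
      (f := fun _ => 0) (fun _ => ENNReal.ofReal (M * B + M * B) ^ 2)
      (Eventually.of_forall fun k =>
        (((hcont (hk k)).sub (hcont h)).measurable.enorm).pow_const 2)
      (Eventually.of_forall fun k => Eventually.of_forall fun y => ?_) ?_
      (Eventually.of_forall fun y => ?_)
    · simpa using this
    · refine pow_le_pow_left' ?_ 2
      rw [← ofReal_norm]
      exact ENNReal.ofReal_le_ofReal ((norm_sub_le _ _).trans
        (add_le_add (hb (hBk k) y) (hb hB y)))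
    · rw [lintegral_const, Measure.restrict_apply_univ]
      exact ENNReal.mul_ne_top (by simp) hΩb
    · have h2 : Tendsto (fun k => transportFun (Zk k) (Jk k) φ y) l (𝓝 (transportFun Z J φ y)) :=
        ((hφ.tendsto _).comp (hZ y)).mul
          ((ContinuousLinearMap.continuous_det.tendsto _).comp (hJ y)).abs
      have h3 := (h2.sub_const (transportFun Z J φ y)).enorm
      rw [sub_self, enorm_zero] at h3
      simpa using ENNReal.Tendsto.pow (n := 2) h3
  have h2 := h1.ennrpow_const (1 / 2 : ℝ)
  rw [ENNReal.zero_rpow_of_pos (by norm_num)] at h2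
  refine h2.congr fun k => ?_
  rw [eLpNorm_two_eq]
  rfl

/-- The transport operators are uniformly bounded on `L²`, so approximating `f` by a continuous
function with compact support costs at most a third of `ε` on each side. -/
theorem tendsto_eLpNorm_transportFun {ι : Type*} {l : Filter ι} [l.IsCountablyGenerated]
    {Zk : ι → EuclideanSpace ℝ (Fin d) → EuclideanSpace ℝ (Fin d)}
    {Jk : ι → EuclideanSpace ℝ (Fin d) → EuclideanSpace ℝ (Fin d) →L[ℝ] EuclideanSpace ℝ (Fin d)}
    (hk : ∀ k, IsDiffeoOn Ω (Zk k) (Jk k)) (h : IsDiffeoOn Ω Z J) (hΩ : IsOpen Ω)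
    (hΩb : volume Ω ≠ ⊤) {B : ℝ≥0}
    (hBk : ∀ k y, |(Jk k y).det| ≤ B) (hB : ∀ y, |(J y).det| ≤ B)
    (hZ : ∀ y, Tendsto (fun k => Zk k y) l (𝓝 (Z y)))
    (hJ : ∀ y, Tendsto (fun k => Jk k y) l (𝓝 (J y))) (f : ImageSpace Ω) :
    Tendsto (fun k => eLpNorm (transportFun (Zk k) (Jk k) f - transportFun Z J f) 2
      (volume.restrict Ω)) l (𝓝 0) := by
  have hfin : IsFiniteMeasure (volume.restrict Ω) := ⟨by simpa using hΩb.lt_top⟩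
  set Q : ℝ≥0∞ := (B : ℝ≥0∞) ^ (1 / 2 : ℝ)
  have hQ : Q ≠ ⊤ := ENNReal.rpow_ne_top_of_nonneg (by norm_num) (by simp)
  rw [ENNReal.tendsto_nhds_zero]
  intro ε hε
  -- Dividing by `Q + 1` covers the case `Q = 0`.
  obtain ⟨ρ, hρ, hρε⟩ : ∃ ρ : ℝ≥0∞, 0 < ρ ∧ Q * ρ ≤ ε / 3 := by
    refine ⟨(ε / 3) / (Q + 1), ?_, ?_⟩
    · exact ENNReal.div_pos (ENNReal.div_pos hε.ne' (by simp)).ne' (by simp [hQ])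
    · refine le_trans (mul_le_mul_left (le_self_add : Q ≤ Q + 1) _) ?_
      exact ENNReal.mul_div_le
  obtain ⟨φ, hφc, hφ, hφcont, hφL⟩ :=
    (Lp.memLp f).exists_hasCompactSupport_eLpNorm_sub_le (by simp) hρ.ne'
  have hsub : ∀ (Z : EuclideanSpace ℝ (Fin d) → EuclideanSpace ℝ (Fin d))
      (J : EuclideanSpace ℝ (Fin d) → EuclideanSpace ℝ (Fin d) →L[ℝ] EuclideanSpace ℝ (Fin d)),
      transportFun Z J f - transportFun Z J φ = transportFun Z J (f - φ) := fun Z J => by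
    ext y
    simp only [transportFun, Pi.sub_apply]
    ring
  have hmeas : ∀ {Z : EuclideanSpace ℝ (Fin d) → EuclideanSpace ℝ (Fin d)}
      {J : EuclideanSpace ℝ (Fin d) → EuclideanSpace ℝ (Fin d) →L[ℝ] EuclideanSpace ℝ (Fin d)},
      IsDiffeoOn Ω Z J → ∀ {g : EuclideanSpace ℝ (Fin d) → ℝ}, StronglyMeasurable g →
      AEStronglyMeasurable (transportFun Z J g) (volume.restrict Ω) := fun h g hg =>
    ((hg.comp_measurable h.continuous.measurable).mul
      h.continuous_abs_det.stronglyMeasurable).aestronglyMeasurable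
  have hf := Lp.stronglyMeasurable f
  have hφm := hφcont.stronglyMeasurable
  have hsmall : ∀ {Z : EuclideanSpace ℝ (Fin d) → EuclideanSpace ℝ (Fin d)}
      {J : EuclideanSpace ℝ (Fin d) → EuclideanSpace ℝ (Fin d) →L[ℝ] EuclideanSpace ℝ (Fin d)},
      IsDiffeoOn Ω Z J → (∀ y, |(J y).det| ≤ B) →
      eLpNorm (transportFun Z J f - transportFun Z J φ) 2 (volume.restrict Ω) ≤ ε / 3 := by
    intro Z J h hB
    rw [hsub]
    refine (h.eLpNorm_transportFun_le hΩ.measurableSet hB _).trans (le_trans ?_ hρε)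
    gcongr
  have hcont := tendsto_eLpNorm_transportFun_of_continuous hk h hΩb hBk hB hZ hJ hφcont hφc
  filter_upwards [ENNReal.tendsto_nhds_zero.1 hcont (ε / 3)
    (ENNReal.div_pos hε.ne' (by simp))] with k hkε
  have e1 : transportFun (Zk k) (Jk k) f - transportFun Z J f =
      (transportFun (Zk k) (Jk k) f - transportFun (Zk k) (Jk k) φ) +
        ((transportFun (Zk k) (Jk k) φ - transportFun Z J φ) -
          (transportFun Z J f - transportFun Z J φ)) := by abel
  rw [e1]
  refine (eLpNorm_add_le ((hmeas (hk k) hf).sub (hmeas (hk k) hφm))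
    (((hmeas (hk k) hφm).sub (hmeas h hφm)).sub ((hmeas h hf).sub (hmeas h hφm)))
    (by norm_num)).trans ?_
  refine (add_le_add (hsmall (hk k) (hBk k)) ((eLpNorm_sub_le
    ((hmeas (hk k) hφm).sub (hmeas h hφm)) ((hmeas h hf).sub (hmeas h hφm))
    (by norm_num)).trans (add_le_add hkε (hsmall h hB)))).trans ?_
  rw [← add_assoc, ENNReal.add_thirds]

end Transport

/-! ### Existence: transport along the flow is a weak solution. -/

section WeakSolution

variable {d : ℕ} {Ω : Set (EuclideanSpace ℝ (Fin d))}
variable {𝒱 : Type*} [NormedAddCommGroup 𝒱] [NormedSpace ℝ 𝒱]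
variable {ev : EuclideanSpace ℝ (Fin d) → 𝒱 →L[ℝ] EuclideanSpace ℝ (Fin d)}
variable {Dv : EuclideanSpace ℝ (Fin d) →
  𝒱 →L[ℝ] EuclideanSpace ℝ (Fin d) →L[ℝ] EuclideanSpace ℝ (Fin d)}
variable {c α : ℝ} {u : ℝ → 𝒱}

open Classical in
/-- The class in `L²(Ω)` of `transportFun Z J f`. -/
noncomputable def transportLp
    (Z : EuclideanSpace ℝ (Fin d) → EuclideanSpace ℝ (Fin d))
    (J : EuclideanSpace ℝ (Fin d) → EuclideanSpace ℝ (Fin d) →L[ℝ] EuclideanSpace ℝ (Fin d))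
    (f : ImageSpace Ω) : ImageSpace Ω :=
  if h : MemLp (transportFun Z J f) 2 (volume.restrict Ω) then h.toLp else 0

theorem transportLp_eq {Z : EuclideanSpace ℝ (Fin d) → EuclideanSpace ℝ (Fin d)}
    {J : EuclideanSpace ℝ (Fin d) → EuclideanSpace ℝ (Fin d) →L[ℝ] EuclideanSpace ℝ (Fin d)}
    {f : ImageSpace Ω} (h : MemLp (transportFun Z J f) 2 (volume.restrict Ω)) :
    transportLp Z J f = h.toLp :=
  dif_pos h

theorem coeFn_transportLp {Z : EuclideanSpace ℝ (Fin d) → EuclideanSpace ℝ (Fin d)}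
    {J : EuclideanSpace ℝ (Fin d) → EuclideanSpace ℝ (Fin d) →L[ℝ] EuclideanSpace ℝ (Fin d)}
    {f : ImageSpace Ω} (h : MemLp (transportFun Z J f) 2 (volume.restrict Ω)) :
    transportLp Z J f =ᵐ[volume.restrict Ω] transportFun Z J f := by
  rw [transportLp_eq h]
  exact h.coeFn_toLp

/-- The extension by zero of a velocity field to all times. -/
noncomputable def timeExtend (T : ℝ) (v : VelocitySpace T 𝒱) : ℝ → 𝒱 :=
  (Icc 0 T).indicator v

omit [NormedSpace ℝ 𝒱] in
theorem integrable_timeExtend {T : ℝ} (v : VelocitySpace T 𝒱) : Integrable (timeExtend T v) := by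
  rw [timeExtend, integrable_indicator_iff measurableSet_Icc]
  exact (Lp.memLp v).integrable (by norm_num)

namespace IsVelocityModel

theorem isDiffeoOn_flow (hM : IsVelocityModel Ω ev Dv c α) (hu : Integrable u) (s t : ℝ) :
    IsDiffeoOn Ω (flow ev u s t) (flowDeriv ev Dv u s t) where
  image_eq := by
    ext y
    constructor
    · rintro ⟨x, hx, rfl⟩
      exact hM.flow_mem hu s t hx
    · exact fun hy => ⟨flow ev u t s y, hM.flow_mem hu t s hy, hM.flow_left_inv hu t s y⟩
  injOn := (Function.LeftInverse.injective (hM.flow_left_inv hu s t)).injOn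
  hasFDerivAt := hM.hasFDerivAt_flow hu s t
  continuous_deriv := hM.continuous_flowDeriv_left hu s t

theorem memLp_transportFun_flow (hM : IsVelocityModel Ω ev Dv c α) (hu : Integrable u)
    (hΩ : MeasurableSet Ω) (s t : ℝ) (f : ImageSpace Ω) :
    MemLp (transportFun (flow ev u s t) (flowDeriv ev Dv u s t) f) 2 (volume.restrict Ω) := by
  obtain ⟨B, hB⟩ := exists_abs_det_le (d := d) (flowConst c u)
  exact (hM.isDiffeoOn_flow hu s t).memLp_transportFun hΩ
    (fun y => hB _ (hM.norm_flowDeriv_le hu s t y)) f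

theorem integral_transportLp_mul (hM : IsVelocityModel Ω ev Dv c α) (hu : Integrable u)
    (hΩ : MeasurableSet Ω) (s t : ℝ) (f : ImageSpace Ω) (q : EuclideanSpace ℝ (Fin d) → ℝ) :
    ∫ y in Ω, transportLp (flow ev u s t) (flowDeriv ev Dv u s t) f y * q y =
      ∫ x in Ω, f x * q (flow ev u t s x) := by
  rw [← (hM.isDiffeoOn_flow hu s t).integral_transportFun_mul hΩ (hM.flow_left_inv hu s t)]
  refine integral_congr_ae ?_
  filter_upwards [coeFn_transportLp (hM.memLp_transportFun_flow hu hΩ s t f)] with y hy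
  rw [hy]

theorem continuous_transportLp (hM : IsVelocityModel Ω ev Dv c α) (hu : Integrable u)
    (hΩ : IsOpen Ω) (hΩb : volume Ω ≠ ⊤) (t : ℝ) (f : ImageSpace Ω) :
    Continuous fun s => transportLp (flow ev u s t) (flowDeriv ev Dv u s t) f := by
  obtain ⟨B, hB⟩ := exists_abs_det_le (d := d) (flowConst c u)
  rw [continuous_iff_continuousAt]
  intro s
  simp only [ContinuousAt, transportLp_eq (hM.memLp_transportFun_flow hu hΩ.measurableSet _ t f)]
  rw [Lp.tendsto_Lp_iff_tendsto_eLpNorm'']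
  exact tendsto_eLpNorm_transportFun (fun p => hM.isDiffeoOn_flow hu p t)
    (hM.isDiffeoOn_flow hu s t) hΩ hΩb (fun p y => hB _ (hM.norm_flowDeriv_le hu p t y))
    (fun y => hB _ (hM.norm_flowDeriv_le hu s t y))
    (fun y => (hM.continuous_flow_start hu t y).tendsto s)
    (fun y => (hM.continuous_flowDeriv_start hu t y).tendsto s) f

theorem continuous_flow_uncurry (hM : IsVelocityModel Ω ev Dv c α) (hu : Integrable u) (s : ℝ) :
    Continuous fun p : ℝ × EuclideanSpace ℝ (Fin d) => flow ev u s p.1 p.2 := by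
  have := continuous_prod_of_continuous_lipschitzWith
    (fun p : EuclideanSpace ℝ (Fin d) × ℝ => flow ev u s p.2 p.1)
    ⟨flowConst c u, (flowConst_pos c u).le⟩ (fun x => hM.continuous_flow_right hu s x)
    (fun t => LipschitzWith.of_dist_le_mul fun x z => by
      rw [dist_eq_norm, dist_eq_norm]
      exact hM.norm_flow_sub_flow_le hu s t x z)
  exact this.comp continuous_swap

/-- The derivative of a test function along the flow. -/
theorem sub_eq_integral_fderiv_flow (hM : IsVelocityModel Ω ev Dv c α) (hu : Integrable u)
    {η : ℝ × EuclideanSpace ℝ (Fin d) → ℝ} (hη : ContDiff ℝ 1 η) (hηc : HasCompactSupport η)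
    {T : ℝ} (hT : 0 ≤ T) (x : EuclideanSpace ℝ (Fin d)) :
    η (T, flow ev u 0 T x) - η (0, x) =
      ∫ r in (0 : ℝ)..T, fderiv ℝ η (r, flow ev u 0 r x) (1, ev (flow ev u 0 r x) (u r)) := by
  -- Time is made a component of the curve. Its speed is cut off outside `(0, T]`, because the chain
  -- rule asks for an integrable derivative on the whole line; on `[0, T]` the primitive is still
  -- `t`.
  set e : ℝ → ℝ := (Ioc 0 T).indicator fun _ => 1
  have he : Integrable e := by
    rw [integrable_indicator_iff measurableSet_Ioc]
    simp
  have hee : ∀ r ∈ Icc 0 T, ∫ q in (0 : ℝ)..r, e q = r := fun r hr => by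
    rw [intervalIntegral.integral_of_le hr.1, setIntegral_indicator measurableSet_Ioc,
      inter_eq_left.2 (Ioc_subset_Ioc_right hr.2)]
    simp [hr.1]
  have hX := hM.continuous_flow_right hu 0 x
  have hb := hM.integrable_apply hu hX
  have hY : Continuous fun r => (∫ q in (0 : ℝ)..r, e q, flow ev u 0 r x) :=
    (intervalIntegral.continuous_primitive (fun _ _ => he.intervalIntegrable) 0).prodMk hX
  have hd := hη.continuous_fderiv (by simp)
  have hpair : ∀ p q, ∫ r in p..q, (e r, ev (flow ev u 0 r x) (u r)) =
      (∫ r in p..q, e r, ∫ r in p..q, ev (flow ev u 0 r x) (u r)) := fun p q => by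
    simp only [intervalIntegral]
    rw [integral_pair he.integrableOn hb.integrableOn, integral_pair he.integrableOn
      hb.integrableOn]
    rfl
  have h1 := sub_eq_integral_of_chain (g := η) (g' := fderiv ℝ η) (S := univ)
    (y := fun r => (∫ q in (0 : ℝ)..r, e q, flow ev u 0 r x))
    (b := fun r => (e r, ev (flow ev u 0 r x) (u r))) convex_univ
    (fun z _ => ((hη.differentiable (by simp) z).hasFDerivAt).hasFDerivWithinAt)
    ((hηc.fderiv ℝ).uniformContinuous_of_continuous hd).uniformContinuousOn hT
    (he.prodMk hb) (fun _ => mem_univ _)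
    (fun p q => by
      rw [hpair, ← hM.flow_sub_flow hu 0 p q x, Prod.mk_sub_mk,
        intervalIntegral.integral_interval_sub_left he.intervalIntegrable he.intervalIntegrable])
    (fun p q => intervalIntegrable_clm_apply (hd.comp hY) (he.prodMk hb) p q)
  rw [hee T ⟨hT, le_rfl⟩, hee 0 ⟨le_rfl, hT⟩, hM.flow_self hu] at h1
  rw [h1]
  refine intervalIntegral.integral_congr_ae (Eventually.of_forall fun r hr => ?_)
  rw [uIoc_of_le hT] at hr
  rw [hee r (Ioc_subset_Icc_self hr), show e r = 1 from indicator_of_mem hr _]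

variable {T : ℝ}

theorem integrable_mul_fderiv_flow (hM : IsVelocityModel Ω ev Dv c α) (hu : Integrable u)
    (hΩb : volume Ω ≠ ⊤) {η : ℝ × EuclideanSpace ℝ (Fin d) → ℝ} (hη : ContDiff ℝ 1 η)
    (hηc : HasCompactSupport η) (f : ImageSpace Ω) :
    Integrable (fun p : ℝ × EuclideanSpace ℝ (Fin d) =>
      f p.2 * fderiv ℝ η (p.1, flow ev u 0 p.1 p.2) (1, ev (flow ev u 0 p.1 p.2) (u p.1)))
      ((volume.restrict (Ioc 0 T)).prod (volume.restrict Ω)) := by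
  have hfin : IsFiniteMeasure (volume.restrict Ω) := ⟨by simpa using hΩb.lt_top⟩
  have hd := hη.continuous_fderiv (by simp)
  obtain ⟨C, hC⟩ := hd.bounded_above_of_compact_support (hηc.fderiv ℝ)
  have hX := hM.continuous_flow_uncurry hu 0
  have h1 : Integrable (fun r => C * (1 + c * ‖u r‖)) (volume.restrict (Ioc 0 T)) :=
    ((integrable_const 1).add (hu.norm.const_mul c).restrict).const_mul C
  have h2 := h1.mul_prod ((Lp.memLp f).integrable (by norm_num)).norm
  refine h2.mono' ?_ (Eventually.of_forall fun p => ?_)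
  · have hum : AEStronglyMeasurable (fun p : ℝ × EuclideanSpace ℝ (Fin d) => u p.1)
        ((volume.restrict (Ioc 0 T)).prod (volume.restrict Ω)) :=
      hu.aestronglyMeasurable.restrict.comp_fst
    have hfm : AEStronglyMeasurable (fun p : ℝ × EuclideanSpace ℝ (Fin d) => f p.2)
        ((volume.restrict (Ioc 0 T)).prod (volume.restrict Ω)) :=
      (Lp.aestronglyMeasurable f).comp_snd
    refine hfm.mul (isBoundedBilinearMap_apply.continuous.comp_aestronglyMeasurable
      (((hd.comp (continuous_fst.prodMk hX)).aestronglyMeasurable).prodMk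
        (aestronglyMeasurable_const.prodMk
          (isBoundedBilinearMap_apply.continuous.comp_aestronglyMeasurable
            ((hM.continuous.comp hX).aestronglyMeasurable.prodMk hum)))))
  · rw [norm_mul, mul_comm]
    gcongr
    refine (ContinuousLinearMap.le_opNorm _ _).trans ?_
    have h3 : ‖((1 : ℝ), ev (flow ev u 0 p.1 p.2) (u p.1))‖ ≤ 1 + c * ‖u p.1‖ := by
      have h4 := hM.norm_apply_le (flow ev u 0 p.1 p.2) (u p.1)
      have h5 := mul_nonneg hM.nonneg (norm_nonneg (u p.1))
      rw [Prod.norm_mk]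
      refine max_le ?_ (by linarith)
      rw [norm_one]
      linarith
    have hC0 : 0 ≤ C := (norm_nonneg _).trans (hC (p.1, flow ev u 0 p.1 p.2))
    gcongr
    exact hC _

variable {ι : 𝒱 →ₗ[ℝ] (EuclideanSpace ℝ (Fin d) → EuclideanSpace ℝ (Fin d))}

/-- Transport along the flow solves the continuity equation. -/
theorem isWeakSolution (hM : IsVelocityModel Ω ev Dv c α) (hι : ∀ w x, ι w x = ev x w)
    (hΩ : IsOpen Ω) (hΩb : volume Ω ≠ ⊤) (hT : 0 ≤ T) (f₀ : ImageSpace Ω)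
    (v : VelocitySpace T 𝒱) :
    IsWeakSolution Ω T ι f₀ v fun t =>
      transportLp (flow ev (timeExtend T v) t 0) (flowDeriv ev Dv (timeExtend T v) t 0) f₀ := by
  have hu := integrable_timeExtend v
  refine ⟨(hM.continuous_transportLp hu hΩ hΩb 0 f₀).continuousOn, fun η hη hηc hηs => ?_⟩
  set u := timeExtend T v
  have hη1 : ContDiff ℝ 1 η := hη.of_le (by exact_mod_cast le_top)
  have hfin : IsFiniteMeasure (volume.restrict Ω) := ⟨by simpa using hΩb.lt_top⟩
  -- The change of variables moves the flow onto the test function, and the spatial and temporal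
  -- terms combine into its derivative in the direction `(1, velocity)`.
  have h1 : ∀ t ∈ Icc 0 T, ∫ x in Ω, transportLp (flow ev u t 0) (flowDeriv ev Dv u t 0) f₀ x *
      (fderiv ℝ (fun y => η (t, y)) x (ι (v t) x) + deriv (fun s => η (s, x)) t) =
      ∫ x in Ω, f₀ x * fderiv ℝ η (t, flow ev u 0 t x) (1, ev (flow ev u 0 t x) (u t)) := by
    intro t ht
    rw [← hM.integral_transportLp_mul hu hΩ.measurableSet t 0 f₀
      fun y => fderiv ℝ η (t, y) (1, ev y (u t))]
    refine integral_congr_ae (Eventually.of_forall fun x => ?_)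
    simp only
    have hx := (hη1.differentiable (by simp) (t, x)).hasFDerivAt
    have e1 := (hx.comp x (hasFDerivAt_prodMk_right t x)).fderiv
    have e2 := (hx.comp_hasDerivAt t ((hasDerivAt_id t).prodMk (hasDerivAt_const t x))).deriv
    have e3 : u t = v t := indicator_of_mem ht _
    simp only [Function.comp_def, id] at e1 e2
    rw [e1, e2, hι, e3]
    simp only [ContinuousLinearMap.comp_apply, ContinuousLinearMap.inr_apply, ← map_add,
      Prod.mk_add_mk, zero_add, add_zero]
  -- After Fubini the time integral along each trajectory is a difference of end values, and `η`
  -- vanishes at time `T`.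
  have h2 : ∫ t in (0 : ℝ)..T, ∫ x in Ω,
      transportLp (flow ev u t 0) (flowDeriv ev Dv u t 0) f₀ x *
      (fderiv ℝ (fun y => η (t, y)) x (ι (v t) x) + deriv (fun s => η (s, x)) t) =
      ∫ x in Ω, f₀ x * -η (0, x) := by
    rw [intervalIntegral.integral_congr (fun t ht => h1 t (by rwa [uIcc_of_le hT] at ht)),
      intervalIntegral_integral_swap]
    · refine integral_congr_ae (Eventually.of_forall fun x => ?_)
      simp only
      rw [intervalIntegral.integral_const_mul, ← hM.sub_eq_integral_fderiv_flow hu hη1 hηc hT,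
        image_eq_zero_of_notMem_tsupport (f := η) (x := (T, _)) fun h => lt_irrefl T (hηs h).1,
        zero_sub]
    · rw [uIoc_of_le hT]
      exact hM.integrable_mul_fderiv_flow hu hΩb hη1 hηc f₀
  rw [h2]
  simp only [mul_neg, integral_neg, neg_add_cancel]

end IsVelocityModel

end WeakSolution

/-! ### Scalar weak derivatives, smooth approximation and pairings. -/

section Testing

/-- A scalar function whose weak derivative in time is integrable is its primitive. -/
theorem eq_add_integral_of_weak {T : ℝ} (hT : 0 < T) {m a : ℝ → ℝ} {m₀ : ℝ}
    (hm : ContinuousOn m (Icc 0 T)) (ha : Integrable a)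
    (H : ∀ θ : ℝ → ℝ, ContDiff ℝ ∞ θ → HasCompactSupport θ → tsupport θ ⊆ Iio T →
      (∫ t in (0 : ℝ)..T, (θ t * a t + deriv θ t * m t)) + θ 0 * m₀ = 0) :
    ∀ t ∈ Icc 0 T, m t = m₀ + ∫ r in (0 : ℝ)..t, a r := by
  set A : ℝ → ℝ := fun t => ∫ r in (0 : ℝ)..t, a r
  have hA : Continuous A := intervalIntegral.continuous_primitive (fun _ _ => ha.intervalIntegrable) 0
  have hA0 : A 0 = 0 := intervalIntegral.integral_same
  set h : ℝ → ℝ := fun t => m t - (m₀ + A t)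
  have hh : ContinuousOn h (Icc 0 T) := hm.sub (continuous_const.add hA).continuousOn
  -- Integration by parts, as the chain rule for the product along `(θ, A)`, moves `a` and `m₀` into
  -- `h`: the defect `h` is orthogonal to every `θ'`.
  have key : ∀ θ : ℝ → ℝ, ContDiff ℝ ∞ θ → HasCompactSupport θ → tsupport θ ⊆ Iio T →
      ∫ t in (0 : ℝ)..T, deriv θ t * h t = 0 := by
    intro θ hθ hθc hθs
    have hd : Continuous (deriv θ) := hθ.continuous_deriv (by simp)
    have hdi : Integrable (deriv θ) := hd.integrable_of_hasCompactSupport hθc.deriv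
    have hftc : ∀ p q, θ q - θ p = ∫ r in p..q, deriv θ r := fun p q =>
      (intervalIntegral.integral_eq_sub_of_hasDerivAt
        (fun r _ => (hθ.differentiable (by simp) r).hasDerivAt) hdi.intervalIntegrable).symm
    have hθT : θ T = 0 := image_eq_zero_of_notMem_tsupport fun h => lt_irrefl T (hθs h)
    have hbil : IsBoundedBilinearMap ℝ fun p : ℝ × ℝ => p.1 * p.2 := isBoundedBilinearMap_mul
    have i1 : IntervalIntegrable (fun t => deriv θ t * m t) volume 0 T :=
      ContinuousOn.intervalIntegrable (by
        rw [uIcc_of_le hT.le]; exact hd.continuousOn.mul hm)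
    have i2 : ∀ p q, IntervalIntegrable (fun t => θ t * a t) volume p q := fun p q =>
      ha.intervalIntegrable.continuousOn_mul hθ.continuous.continuousOn
    have i3 : ∀ p q, IntervalIntegrable (fun t => A t * deriv θ t) volume p q := fun p q =>
      (hA.mul hd).intervalIntegrable _ _
    have h1 := sub_eq_integral_of_chain (g := fun p : ℝ × ℝ => p.1 * p.2) (g' := hbil.deriv)
      (S := univ) (y := fun t => (θ t, A t)) (b := fun t => (deriv θ t, a t)) convex_univ
      (fun z _ => (hbil.hasFDerivAt z).hasFDerivWithinAt)
      (hbil.isBoundedLinearMap_deriv.toContinuousLinearMap.uniformContinuous.uniformContinuousOn)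
      hT.le (hdi.prodMk ha) (fun _ => mem_univ _)
      (fun p q => by
        simp only [intervalIntegral]
        rw [integral_pair hdi.integrableOn ha.integrableOn, integral_pair hdi.integrableOn
          ha.integrableOn, Prod.mk_sub_mk, Prod.mk_sub_mk, hftc p q,
          show A q - A p = ∫ r in p..q, a r from
            intervalIntegral.integral_interval_sub_left ha.intervalIntegrable
              ha.intervalIntegrable]
        rfl)
      (fun p q => ((i2 p q).add (i3 p q)).congr fun t _ => by
        simp [IsBoundedBilinearMap.deriv_apply, mul_comm])
    simp only [IsBoundedBilinearMap.deriv_apply, hθT, hA0, zero_mul, mul_zero, sub_zero] at h1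
    rw [intervalIntegral.integral_add (i2 0 T) ((i3 0 T).congr fun t _ => mul_comm _ _)] at h1
    have h2 := H θ hθ hθc hθs
    rw [intervalIntegral.integral_add (i2 0 T) i1] at h2
    have h3 := hftc 0 T
    rw [hθT] at h3
    have h4 : ∀ t, deriv θ t * h t = deriv θ t * m t - (deriv θ t * m₀ + deriv θ t * A t) :=
      fun t => by simp only [h]; ring
    simp only [h4]
    rw [intervalIntegral.integral_sub i1 ((hdi.intervalIntegrable.mul_const m₀).add
      ((i3 0 T).congr fun t _ => mul_comm _ _)), intervalIntegral.integral_add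
      (hdi.intervalIntegrable.mul_const m₀) ((i3 0 T).congr fun t _ => mul_comm _ _),
      intervalIntegral.integral_mul_const, ← h3]
    linarith
  have hae : ∀ᵐ t, t ∈ Ioo 0 T → h t = 0 := by
    refine isOpen_Ioo.ae_eq_zero_of_integral_contDiff_smul_eq_zero
      ((hh.mono Ioo_subset_Icc_self).locallyIntegrableOn measurableSet_Ioo) fun ζ hζ hζc hζs => ?_
    -- The support of `ζ` stays away from `T`, so a primitive normalised at `T` vanishes from `T'`
    -- on.
    obtain ⟨T', hT'0, hT'T, hT'⟩ : ∃ T', 0 < T' ∧ T' < T ∧ ∀ t, T' ≤ t → ζ t = 0 := by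
      obtain ⟨ρ, hρ, hρs⟩ := hζc.isCompact.exists_cthickening_subset_open isOpen_Ioo hζs
      refine ⟨max (T - ρ) (T / 2), by positivity, by simp [hρ, hT], fun t ht => ?_⟩
      by_contra hne
      have h1 := subset_tsupport ζ hne
      have h2 := (hζs h1).2
      have h3 : T ∈ Metric.cthickening ρ (tsupport ζ) := by
        refine Metric.mem_cthickening_of_dist_le T t ρ _ h1 ?_
        rw [Real.dist_eq, abs_of_pos (by linarith)]
        have := (le_max_left _ _).trans ht
        linarith
      exact lt_irrefl T (hρs h3).2
    set G : ℝ → ℝ := fun t => ∫ r in T..t, ζ r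
    have hG : ∀ t, HasDerivAt G (ζ t) t := fun t =>
      intervalIntegral.integral_hasDerivAt_right (hζ.continuous.intervalIntegrable _ _)
        (hζ.continuous.stronglyMeasurableAtFilter _ _) hζ.continuous.continuousAt
    have hGd : deriv G = ζ := funext fun t => (hG t).deriv
    have hGs : ContDiff ℝ ∞ G := contDiff_infty_iff_deriv.2
      ⟨fun t => (hG t).differentiableAt, by rwa [hGd]⟩
    have hGT : ∀ t, T' ≤ t → G t = 0 := fun t ht => by
      rw [show G t = ∫ r in T..t, (0 : ℝ) from intervalIntegral.integral_congr fun r hr =>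
        hT' r ((le_min hT'T.le ht).trans hr.1)]
      simp
    -- The cut-off equals `1` for `t ≥ 0` and `0` for `t ≤ -1`, so `θ` has compact support and `θ' =
    -- ζ` on `(0, T)`. As `θ 0` is free, `ζ` need not have mean zero.
    set θ : ℝ → ℝ := fun t => Real.smoothTransition (t + 1) * G t
    have hθ0 : ∀ t, t ∉ Icc (-1) T' → θ t = 0 := fun t ht => by
      simp only [θ]
      rcases lt_or_ge t (-1) with h1 | h1
      · rw [Real.smoothTransition.zero_of_nonpos (by linarith), zero_mul]
      · rw [hGT t (not_le.1 fun h2 => ht ⟨h1, h2⟩).le, mul_zero]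
    have hθs : tsupport θ ⊆ Icc (-1) T' :=
      closure_minimal (fun t ht => not_imp_comm.1 (hθ0 t) ht) isClosed_Icc
    have h1 := key θ (((Real.smoothTransition.contDiff).comp
      (contDiff_id.add contDiff_const)).mul hGs) (HasCompactSupport.intro isCompact_Icc hθ0)
      (hθs.trans fun t ht => ht.2.trans_lt hT'T)
    have h2 : ∀ t ∈ Ioo 0 T, deriv θ t = ζ t := fun t ht => by
      rw [← (hG t).deriv]
      refine Filter.EventuallyEq.deriv_eq ?_
      filter_upwards [lt_mem_nhds ht.1] with r hr
      simp only [θ]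
      rw [Real.smoothTransition.one_of_one_le (by linarith), one_mul]
    rw [intervalIntegral.integral_of_le hT.le, integral_Ioc_eq_integral_Ioo] at h1
    rw [← setIntegral_eq_integral_of_forall_compl_eq_zero (s := Ioo 0 T)]
    · refine Eq.trans ?_ h1
      exact setIntegral_congr_fun measurableSet_Ioo fun t ht => by simp only [h2 t ht, smul_eq_mul]
    · intro t ht
      rw [image_eq_zero_of_notMem_tsupport fun h => ht (hζs h), zero_smul]
  have h0 : EqOn h (fun _ => 0) (Icc 0 T) :=
    Measure.eqOn_Icc_of_ae_eq volume hT.ne (by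
      rw [restrict_Ioo_eq_restrict_Icc.symm]
      exact (ae_restrict_iff' measurableSet_Ioo).2 hae) hh continuousOn_const
  intro t ht
  have := h0 ht
  simp only [h, A] at this
  linarith

/-- Approximation of `C¹` functions with compact support in an open set by smooth ones. -/
theorem exists_contDiff_approx_fderiv {E : Type*} [NormedAddCommGroup E] [NormedSpace ℝ E]
    [FiniteDimensional ℝ E] {Ω : Set E} (hΩ : IsOpen Ω) {ψ : E → ℝ}
    (hψ : ContDiff ℝ 1 ψ) (hψc : HasCompactSupport ψ) (hψs : tsupport ψ ⊆ Ω) {ε : ℝ}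
    (hε : 0 < ε) : ∃ φ : E → ℝ, ContDiff ℝ ∞ φ ∧ HasCompactSupport φ ∧ tsupport φ ⊆ Ω ∧
      (∀ x, ‖φ x - ψ x‖ ≤ ε) ∧ ∀ x, ‖fderiv ℝ φ x - fderiv ℝ ψ x‖ ≤ ε := by
  borelize E
  have hd := hψ.continuous_fderiv (by simp)
  obtain ⟨r₁, hr₁, h₁⟩ := Metric.uniformContinuous_iff.1
    (hψc.uniformContinuous_of_continuous hψ.continuous) ε hε
  obtain ⟨r₂, hr₂, h₂⟩ := Metric.uniformContinuous_iff.1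
    ((hψc.fderiv ℝ).uniformContinuous_of_continuous hd) ε hε
  obtain ⟨r₃, hr₃, h₃⟩ := hψc.isCompact.exists_cthickening_subset_open hΩ hψs
  -- The mollification radius respects the moduli of continuity of `ψ` and of its derivative, and
  -- keeps the support inside `Ω`.
  set r := min r₁ (min r₂ r₃)
  have hr : 0 < r := lt_min hr₁ (lt_min hr₂ hr₃)
  let b : ContDiffBump (0 : E) := ⟨r / 2, r, by positivity, by linarith⟩
  let μ : Measure E := Measure.addHaar
  have hbc : HasCompactSupport (b.normed μ) := b.hasCompactSupport_normed
  have hbi : LocallyIntegrable (b.normed μ) μ :=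
    b.continuous_normed.locallyIntegrable
  set φ := convolution (b.normed μ) ψ (ContinuousLinearMap.lsmul ℝ ℝ) μ
  have hφd : ∀ x, fderiv ℝ φ x =
      convolution (b.normed μ) (fderiv ℝ ψ) (ContinuousLinearMap.lsmul ℝ ℝ) μ x := fun x => by
    rw [(hψc.hasFDerivAt_convolution_right _ hbi hψ x).fderiv, convolution_def, convolution_def]
    refine integral_congr_ae (Eventually.of_forall fun t => ?_)
    ext w
    simp [ContinuousLinearMap.precompR_apply]
  refine ⟨φ, hbc.contDiff_convolution_left _ b.contDiff_normed
    hψ.continuous.locallyIntegrable, hbc.convolution _ hψc, ?_, fun x => ?_, fun x => ?_⟩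
  · refine (closure_minimal ?_ Metric.isClosed_cthickening).trans h₃
    refine (support_convolution_subset_swap _).trans ?_
    rw [b.support_normed_eq]
    rintro _ ⟨y, hy, z, hz, rfl⟩
    refine Metric.mem_cthickening_of_dist_le _ y _ _ (subset_tsupport ψ hy) ?_
    rw [dist_eq_norm, add_sub_cancel_left]
    rw [mem_ball_zero_iff] at hz
    exact hz.le.trans ((min_le_right _ _).trans (min_le_right _ _))
  · rw [← dist_eq_norm]
    refine ContDiffBump.dist_normed_convolution_le hψ.continuous.aestronglyMeasurable
      fun y hy => (h₁ (lt_of_lt_of_le (Metric.mem_ball.1 hy) (min_le_left _ _))).le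
  · rw [← dist_eq_norm, hφd]
    refine ContDiffBump.dist_normed_convolution_le hd.aestronglyMeasurable
      fun y hy => (h₂ (lt_of_lt_of_le (Metric.mem_ball.1 hy)
        ((min_le_right _ _).trans (min_le_left _ _)))).le

variable {d : ℕ} {Ω : Set (EuclideanSpace ℝ (Fin d))}
variable {𝒱 : Type*} [NormedAddCommGroup 𝒱] [NormedSpace ℝ 𝒱]

theorem exists_integral_norm_Lp_le {β F : Type*} [MeasurableSpace β] [NormedAddCommGroup F]
    (μ : Measure β) [IsFiniteMeasure μ] :
    ∃ C : ℝ, 0 ≤ C ∧ ∀ f : Lp F 2 μ, ∫ x, ‖f x‖ ∂μ ≤ C * ‖f‖ := by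
  refine ⟨(μ univ ^ (1 / 2 : ℝ)).toReal, by positivity, fun f => ?_⟩
  have h1 := eLpNorm_le_eLpNorm_mul_rpow_measure_univ (p := 1) (q := 2) (by norm_num)
    (Lp.aestronglyMeasurable f)
  rw [integral_norm_eq_lintegral_enorm (Lp.aestronglyMeasurable f), ← eLpNorm_one_eq_lintegral_enorm,
    Lp.norm_def, mul_comm, ← ENNReal.toReal_mul]
  refine ENNReal.toReal_mono (ENNReal.mul_ne_top (Lp.eLpNorm_ne_top f)
    (ENNReal.rpow_ne_top_of_nonneg (by norm_num) (measure_ne_top μ univ)))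
    (h1.trans (le_of_eq ?_))
  norm_num

theorem exists_integral_norm_le (hΩb : volume Ω ≠ ⊤) :
    ∃ C : ℝ, 0 ≤ C ∧ ∀ f : ImageSpace Ω, ∫ x in Ω, ‖f x‖ ≤ C * ‖f‖ := by
  have hfin : IsFiniteMeasure (volume.restrict Ω) := ⟨by simpa using hΩb.lt_top⟩
  exact exists_integral_norm_Lp_le _

/-- The pairing of an image with a continuous bounded family of functionals. -/
theorem exists_pairing (hΩb : volume Ω ≠ ⊤) {C₀ : ℝ}
    (hC₀ : ∀ f : ImageSpace Ω, ∫ x in Ω, ‖f x‖ ≤ C₀ * ‖f‖)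
    {p : EuclideanSpace ℝ (Fin d) → StrongDual ℝ 𝒱} (hp : Continuous p) {C : ℝ}
    (hpC : ∀ x, ‖p x‖ ≤ C) : ∃ Φ : ImageSpace Ω →L[ℝ] StrongDual ℝ 𝒱,
      (∀ f w, Φ f w = ∫ x in Ω, f x * p x w) ∧ ∀ f, ‖Φ f‖ ≤ C * C₀ * ‖f‖ := by
  have hfin : IsFiniteMeasure (volume.restrict Ω) := ⟨by simpa using hΩb.lt_top⟩
  have hC : 0 ≤ C := (norm_nonneg _).trans (hpC 0)
  have hint : ∀ f : ImageSpace Ω, Integrable f (volume.restrict Ω) := fun f =>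
    (Lp.memLp f).integrable (by norm_num)
  have hle : ∀ (f : ImageSpace Ω) x, ‖f x • p x‖ ≤ C * ‖f x‖ := fun f x => by
    rw [norm_smul, mul_comm]
    gcongr
    exact hpC x
  have hi : ∀ f : ImageSpace Ω, Integrable (fun x => f x • p x) (volume.restrict Ω) := fun f =>
    ((hint f).norm.const_mul C).mono'
      ((Lp.aestronglyMeasurable f).smul hp.aestronglyMeasurable) (Eventually.of_forall (hle f))
  let Φ : ImageSpace Ω →ₗ[ℝ] StrongDual ℝ 𝒱 :=
    { toFun := fun f => ∫ x in Ω, f x • p x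
      map_add' := fun f g => by
        rw [← integral_add (hi f) (hi g)]
        refine integral_congr_ae ?_
        filter_upwards [Lp.coeFn_add f g] with x hx
        rw [hx, Pi.add_apply, add_smul]
      map_smul' := fun r f => by
        rw [RingHom.id_apply, ← integral_smul]
        refine integral_congr_ae ?_
        filter_upwards [Lp.coeFn_smul r f] with x hx
        rw [hx, Pi.smul_apply, smul_assoc] }
  have hΦ : ∀ f, ‖Φ f‖ ≤ C * C₀ * ‖f‖ := fun f => by
    refine (norm_integral_le_of_norm_le ((hint f).norm.const_mul C)
      (Eventually.of_forall (hle f))).trans ?_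
    rw [integral_const_mul, mul_assoc]
    gcongr
    exact hC₀ f
  refine ⟨Φ.mkContinuous _ hΦ, fun f w => ?_, hΦ⟩
  change (∫ x in Ω, f x • p x) w = _
  rw [ContinuousLinearMap.integral_apply (hi f)]
  rfl

end Testing

/-! ### The equation satisfied by pairings of a weak solution with spatial test functions. -/

section Uniqueness

variable {d : ℕ} {Ω : Set (EuclideanSpace ℝ (Fin d))}
variable {𝒱 : Type*} [NormedAddCommGroup 𝒱] [NormedSpace ℝ 𝒱]
variable {ev : EuclideanSpace ℝ (Fin d) → 𝒱 →L[ℝ] EuclideanSpace ℝ (Fin d)}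
variable {Dv : EuclideanSpace ℝ (Fin d) →
  𝒱 →L[ℝ] EuclideanSpace ℝ (Fin d) →L[ℝ] EuclideanSpace ℝ (Fin d)}
variable {c α T : ℝ} {u : ℝ → 𝒱}

theorem integrable_image_mul (hΩb : volume Ω ≠ ⊤) (f : ImageSpace Ω)
    {q : EuclideanSpace ℝ (Fin d) → ℝ} (hq : Continuous q) {B : ℝ} (hqB : ∀ x, ‖q x‖ ≤ B) :
    Integrable (fun x => f x * q x) (volume.restrict Ω) := by
  have hfin : IsFiniteMeasure (volume.restrict Ω) := ⟨by simpa using hΩb.lt_top⟩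
  exact ((Lp.memLp f).integrable (by norm_num)).mul_bdd (c := B) hq.aestronglyMeasurable
    (Eventually.of_forall hqB)

theorem norm_integral_image_mul_le (hΩb : volume Ω ≠ ⊤) {C₀ : ℝ}
    (hC₀ : ∀ f : ImageSpace Ω, ∫ x in Ω, ‖f x‖ ≤ C₀ * ‖f‖) (f : ImageSpace Ω)
    {q : EuclideanSpace ℝ (Fin d) → ℝ} {B : ℝ} (hqB : ∀ x, ‖q x‖ ≤ B) :
    ‖∫ x in Ω, f x * q x‖ ≤ B * (C₀ * ‖f‖) := by
  have hfin : IsFiniteMeasure (volume.restrict Ω) := ⟨by simpa using hΩb.lt_top⟩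
  have hB : 0 ≤ B := (norm_nonneg _).trans (hqB 0)
  refine (norm_integral_le_of_norm_le
    (((Lp.memLp f).integrable (q := 2) (by norm_num)).norm.const_mul B)
    (Eventually.of_forall fun x => ?_)).trans ?_
  · rw [norm_mul, mul_comm]
    gcongr
    exact hqB x
  · rw [integral_const_mul]
    gcongr
    exact hC₀ f

theorem norm_integral_image_mul_sub_le (hΩb : volume Ω ≠ ⊤) {C₀ : ℝ}
    (hC₀ : ∀ f : ImageSpace Ω, ∫ x in Ω, ‖f x‖ ≤ C₀ * ‖f‖) (f : ImageSpace Ω)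
    {q₁ q₂ : EuclideanSpace ℝ (Fin d) → ℝ}
    (h₁ : Integrable (fun x => f x * q₁ x) (volume.restrict Ω))
    (h₂ : Integrable (fun x => f x * q₂ x) (volume.restrict Ω)) {B : ℝ}
    (hB : ∀ x, ‖q₁ x - q₂ x‖ ≤ B) :
    ‖(∫ x in Ω, f x * q₁ x) - ∫ x in Ω, f x * q₂ x‖ ≤ B * (C₀ * ‖f‖) := by
  rw [← integral_sub h₁ h₂]
  simp only [← mul_sub]
  exact norm_integral_image_mul_le hΩb hC₀ f hB

theorem integrable_clm_apply_timeExtend (v : VelocitySpace T 𝒱) {A : ℝ → StrongDual ℝ 𝒱}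
    (hA : ContinuousOn A (Icc 0 T)) : Integrable fun r => A r (timeExtend T v r) := by
  have h1 : (fun r => A r (timeExtend T v r)) = (Icc 0 T).indicator fun r => A r (v r) := by
    ext r
    by_cases hr : r ∈ Icc 0 T <;> simp [timeExtend, hr]
  rw [h1, integrable_indicator_iff measurableSet_Icc]
  obtain ⟨M, hM⟩ := isCompact_Icc.exists_bound_of_continuousOn hA
  refine Integrable.mono' (g := fun r => M * ‖v r‖)
    (((Lp.memLp v).integrable (q := 2) (by norm_num)).norm.const_mul M) ?_ ?_
  · exact isBoundedBilinearMap_apply.continuous.comp_aestronglyMeasurable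
      ((hA.aestronglyMeasurable measurableSet_Icc).prodMk (Lp.aestronglyMeasurable v))
  · filter_upwards [ae_restrict_mem measurableSet_Icc] with r hr
    exact (ContinuousLinearMap.le_opNorm _ _).trans (by gcongr; exact hM r hr)

namespace IsVelocityModel

variable {ι : 𝒱 →ₗ[ℝ] (EuclideanSpace ℝ (Fin d) → EuclideanSpace ℝ (Fin d))}
variable {f₀ : ImageSpace Ω} {v : VelocitySpace T 𝒱} {f : ℝ → ImageSpace Ω}
variable {ψ : EuclideanSpace ℝ (Fin d) → ℝ}

theorem continuous_fderiv_comp (hM : IsVelocityModel Ω ev Dv c α) (hψ : ContDiff ℝ 1 ψ) :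
    Continuous fun x => (fderiv ℝ ψ x).comp (ev x) :=
  (hψ.continuous_fderiv (by simp)).clm_comp hM.continuous

theorem norm_fderiv_comp_le (hM : IsVelocityModel Ω ev Dv c α) {C : ℝ}
    (hC : ∀ x, ‖fderiv ℝ ψ x‖ ≤ C) (x : EuclideanSpace ℝ (Fin d)) :
    ‖(fderiv ℝ ψ x).comp (ev x)‖ ≤ C * c := by
  refine (ContinuousLinearMap.opNorm_comp_le _ _).trans ?_
  have := hM.nonneg
  have := (norm_nonneg _).trans (hC x)
  gcongr
  · exact hC x
  · exact hM.norm_le x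

/-- Product test functions `θ t * ψ x` reduce the weak formulation to a scalar weak derivative in
time, to which `eq_add_integral_of_weak` applies. -/
theorem integral_mul_eq_of_contDiff_infty (hM : IsVelocityModel Ω ev Dv c α)
    (hι : ∀ w x, ι w x = ev x w) (hΩb : volume Ω ≠ ⊤) (hT : 0 < T)
    (hf : IsWeakSolution Ω T ι f₀ v f) (hψ : ContDiff ℝ ∞ ψ) (hψc : HasCompactSupport ψ)
    (hψs : tsupport ψ ⊆ Ω) : ∀ t ∈ Icc 0 T, ∫ x in Ω, f t x * ψ x = (∫ x in Ω, f₀ x * ψ x) +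
      ∫ r in (0 : ℝ)..t, ∫ x in Ω, f r x * fderiv ℝ ψ x (ev x (timeExtend T v r)) := by
  obtain ⟨C₀, -, hC₀⟩ := exists_integral_norm_le hΩb
  have hψ1 : ContDiff ℝ 1 ψ := hψ.of_le (by exact_mod_cast le_top)
  have hd := hψ1.continuous_fderiv (by simp)
  obtain ⟨C, hC⟩ := hd.bounded_above_of_compact_support (hψc.fderiv ℝ)
  obtain ⟨B, hB⟩ := hψ.continuous.bounded_above_of_compact_support hψc
  obtain ⟨Φ, hΦ, -⟩ := exists_pairing hΩb hC₀ (hM.continuous_fderiv_comp hψ1)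
    (hM.norm_fderiv_comp_le hC)
  obtain ⟨Ψ, hΨ, -⟩ := exists_pairing hΩb hC₀
    (p := fun x => ψ x • ContinuousLinearMap.id ℝ ℝ) (by fun_prop) (C := B) fun x => by
      rw [norm_smul]
      refine (mul_le_mul_of_nonneg_left (ContinuousLinearMap.norm_id_le) (norm_nonneg _)).trans ?_
      rw [mul_one]
      exact hB x
  have hΨ' : ∀ g : ImageSpace Ω, ∫ x in Ω, g x * ψ x = Ψ g 1 := fun g => by
    rw [hΨ]
    simp
  have hm : ContinuousOn (fun t => ∫ x in Ω, f t x * ψ x) (Icc 0 T) := by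
    simp only [hΨ']
    exact (((ContinuousLinearMap.apply ℝ ℝ (1 : ℝ)).comp Ψ).continuous.comp_continuousOn hf.1)
  have ha : Integrable fun r => ∫ x in Ω, f r x * fderiv ℝ ψ x (ev x (timeExtend T v r)) := by
    have := integrable_clm_apply_timeExtend v (Φ.continuous.comp_continuousOn hf.1)
    simpa only [Function.comp_apply, hΦ, ContinuousLinearMap.comp_apply] using this
  refine eq_add_integral_of_weak hT hm ha fun θ hθ hθc hθs => ?_
  have hsupp : tsupport (fun p : ℝ × EuclideanSpace ℝ (Fin d) => θ p.1 * ψ p.2) ⊆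
      tsupport θ ×ˢ tsupport ψ := by
    refine closure_minimal (fun p hp => ⟨subset_tsupport θ (left_ne_zero_of_mul hp),
      subset_tsupport ψ (right_ne_zero_of_mul hp)⟩)
      ((isClosed_tsupport θ).prod (isClosed_tsupport ψ))
  have h1 := hf.2 (fun p => θ p.1 * ψ p.2)
    ((hθ.comp contDiff_fst).mul (hψ.comp contDiff_snd))
    ((hθc.isCompact.prod hψc.isCompact).of_isClosed_subset (isClosed_tsupport _) hsupp)
    (hsupp.trans (prod_mono hθs hψs))
  have h2 : ∫ x in Ω, f₀ x * (θ 0 * ψ x) = θ 0 * ∫ x in Ω, f₀ x * ψ x := by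
    rw [← integral_const_mul]
    exact integral_congr_ae (Eventually.of_forall fun x => by ring)
  rw [h2] at h1
  refine Eq.trans ?_ h1
  congr 1
  refine intervalIntegral.integral_congr fun t ht => ?_
  rw [uIcc_of_le hT.le] at ht
  simp only
  have e3 : timeExtend T v t = v t := indicator_of_mem ht _
  have i1 := integrable_image_mul hΩb (f t) hψ.continuous hB
  have i2 := integrable_image_mul hΩb (f t)
    ((hM.continuous_fderiv_comp hψ1).clm_apply (continuous_const (y := v t)))
    (fun x => ContinuousLinearMap.le_of_opNorm_le _ (hM.norm_fderiv_comp_le hC x) _)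
  simp only [ContinuousLinearMap.comp_apply] at i2
  rw [e3, ← integral_const_mul, ← integral_const_mul,
    ← integral_add (i2.const_mul (θ t)) (i1.const_mul (deriv θ t))]
  refine integral_congr_ae (Eventually.of_forall fun x => ?_)
  beta_reduce
  rw [fderiv_const_mul (hψ1.differentiable (by simp) x), deriv_mul_const
    (hθ.differentiable (by simp) t), hι]
  simp only [smul_apply, smul_eq_mul]
  ring

/-- Test functions composed with the flow are only `C¹`, so smoothness has to be relaxed. All three
terms depend continuously on `ψ` in the `C¹` norm, and `exists_contDiff_approx_fderiv` provides
smooth approximants. -/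
theorem integral_mul_eq (hM : IsVelocityModel Ω ev Dv c α)
    (hι : ∀ w x, ι w x = ev x w) (hΩ : IsOpen Ω) (hΩb : volume Ω ≠ ⊤) (hT : 0 < T)
    (hf : IsWeakSolution Ω T ι f₀ v f) (hψ : ContDiff ℝ 1 ψ) (hψc : HasCompactSupport ψ)
    (hψs : tsupport ψ ⊆ Ω) : ∀ t ∈ Icc 0 T, ∫ x in Ω, f t x * ψ x = (∫ x in Ω, f₀ x * ψ x) +
      ∫ r in (0 : ℝ)..t, ∫ x in Ω, f r x * fderiv ℝ ψ x (ev x (timeExtend T v r)) := by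
  intro t ht
  obtain ⟨C₀, hC₀0, hC₀⟩ := exists_integral_norm_le hΩb
  obtain ⟨M, hMf⟩ := isCompact_Icc.exists_bound_of_continuousOn hf.1
  have hM0 : 0 ≤ M := (norm_nonneg _).trans (hMf t ht)
  set u := timeExtend T v
  have hu : Integrable u := integrable_timeExtend v
  have hreg : ∀ φ : EuclideanSpace ℝ (Fin d) → ℝ, ContDiff ℝ 1 φ → HasCompactSupport φ →
      (∀ g : ImageSpace Ω, Integrable (fun x => g x * φ x) (volume.restrict Ω)) ∧
      (∀ (g : ImageSpace Ω) w,
        Integrable (fun x => g x * fderiv ℝ φ x (ev x w)) (volume.restrict Ω)) ∧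
      Integrable fun r => ∫ x in Ω, f r x * fderiv ℝ φ x (ev x (u r)) := by
    intro φ hφ hφc
    obtain ⟨C, hC⟩ := (hφ.continuous_fderiv (by simp)).bounded_above_of_compact_support
      (hφc.fderiv ℝ)
    obtain ⟨B, hB⟩ := hφ.continuous.bounded_above_of_compact_support hφc
    obtain ⟨Φ, hΦ, -⟩ := exists_pairing hΩb hC₀ (hM.continuous_fderiv_comp hφ)
      (hM.norm_fderiv_comp_le hC)
    refine ⟨fun g => integrable_image_mul hΩb g hφ.continuous hB, fun g w =>
      integrable_image_mul hΩb g
        ((hM.continuous_fderiv_comp hφ).clm_apply (continuous_const (y := w)))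
        (fun x => ContinuousLinearMap.le_of_opNorm_le _ (hM.norm_fderiv_comp_le hC x) _), ?_⟩
    have := integrable_clm_apply_timeExtend v (Φ.continuous.comp_continuousOn hf.1)
    simpa only [Function.comp_apply, hΦ, ContinuousLinearMap.comp_apply] using this
  obtain ⟨r1, r2, r3⟩ := hreg ψ hψ hψc
  -- `Q` adds up the sensitivities of the three terms to a `C¹` perturbation of the test function.
  set Q : ℝ := C₀ * M + C₀ * ‖f₀‖ + c * (C₀ * M) * ∫ r, ‖u r‖
  rw [← sub_eq_zero, ← norm_le_zero_iff]
  refine le_of_forall_pos_le_add fun ε hε => ?_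
  have hc := hM.nonneg
  have hI : 0 ≤ ∫ r, ‖u r‖ := integral_nonneg fun _ => norm_nonneg _
  have hQ : 0 ≤ Q := by positivity
  obtain ⟨φ, hφ, hφc, hφs, h1, h2⟩ := exists_contDiff_approx_fderiv hΩ hψ hψc hψs
    (ε := ε / (Q + 1)) (by positivity)
  have hφ1 : ContDiff ℝ 1 φ := hφ.of_le (by exact_mod_cast le_top)
  obtain ⟨q1, q2, q3⟩ := hreg φ hφ1 hφc
  have hW := hM.integral_mul_eq_of_contDiff_infty hι hΩb hT hf hφ hφc hφs t ht
  set ε' := ε / (Q + 1)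
  have hε' : 0 < ε' := by positivity
  have e1 := norm_integral_image_mul_sub_le hΩb hC₀ (f t) (r1 _) (q1 _)
    (fun x => by rw [norm_sub_rev]; exact h1 x)
  have e2 := norm_integral_image_mul_sub_le hΩb hC₀ f₀ (q1 _) (r1 _) h1
  have e3 : ‖(∫ r in (0 : ℝ)..t, ∫ x in Ω, f r x * fderiv ℝ φ x (ev x (u r))) -
      ∫ r in (0 : ℝ)..t, ∫ x in Ω, f r x * fderiv ℝ ψ x (ev x (u r))‖ ≤
      ε' * (c * (C₀ * M)) * ∫ r, ‖u r‖ := by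
    rw [← intervalIntegral.integral_sub q3.intervalIntegrable r3.intervalIntegrable]
    refine (intervalIntegral.norm_integral_le_of_norm_le (g := fun r =>
      ε' * (c * (C₀ * M)) * ‖u r‖) ht.1 (Eventually.of_forall fun r hr => ?_)
      (hu.norm.const_mul _).intervalIntegrable).trans ?_
    · refine (norm_integral_image_mul_sub_le hΩb hC₀ (f r) (q2 _ _) (r2 _ _)
        (B := ε' * (c * ‖u r‖)) fun x => ?_).trans ?_
      · rw [← sub_apply]
        refine (ContinuousLinearMap.le_opNorm _ _).trans ?_
        gcongr
        · exact h2 x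
        · exact hM.norm_apply_le x _
      · have := hMf r ⟨hr.1.le, hr.2.trans ht.2⟩
        calc ε' * (c * ‖u r‖) * (C₀ * ‖f r‖) ≤ ε' * (c * ‖u r‖) * (C₀ * M) := by gcongr
          _ = _ := by ring
    · rw [intervalIntegral.integral_const_mul]
      gcongr
      rw [intervalIntegral.integral_of_le ht.1]
      exact setIntegral_le_integral hu.norm (Eventually.of_forall fun _ => norm_nonneg _)
  have e4 : (∫ x in Ω, f t x * ψ x) - ((∫ x in Ω, f₀ x * ψ x) +
      ∫ r in (0 : ℝ)..t, ∫ x in Ω, f r x * fderiv ℝ ψ x (ev x (u r))) =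
      ((∫ x in Ω, f t x * ψ x) - ∫ x in Ω, f t x * φ x) +
      ((∫ x in Ω, f₀ x * φ x) - ∫ x in Ω, f₀ x * ψ x) +
      ((∫ r in (0 : ℝ)..t, ∫ x in Ω, f r x * fderiv ℝ φ x (ev x (u r))) -
      ∫ r in (0 : ℝ)..t, ∫ x in Ω, f r x * fderiv ℝ ψ x (ev x (u r))) := by
    rw [hW]
    ring
  rw [e4, zero_add]
  have e5 : ε' * (C₀ * ‖f t‖) ≤ ε' * (C₀ * M) := by
    have := hMf t ht
    gcongr
  calc _ ≤ ε' * (C₀ * M) + ε' * (C₀ * ‖f₀‖) + ε' * (c * (C₀ * M)) * ∫ r, ‖u r‖ :=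
        (norm_add₃_le).trans (add_le_add (add_le_add (e1.trans e5) e2) e3)
    _ = ε' * Q := by simp only [Q]; ring
    _ ≤ ε' * (Q + 1) := by gcongr; linarith
    _ = ε := by simp only [ε']; field_simp

end IsVelocityModel

end Uniqueness

/-! ### Test functions transported backwards by the flow. -/

section PullbackTest

variable {d : ℕ} {Ω : Set (EuclideanSpace ℝ (Fin d))}
variable {𝒱 : Type*} [NormedAddCommGroup 𝒱] [NormedSpace ℝ 𝒱]
variable {ev : EuclideanSpace ℝ (Fin d) → 𝒱 →L[ℝ] EuclideanSpace ℝ (Fin d)}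
variable {Dv : EuclideanSpace ℝ (Fin d) →
  𝒱 →L[ℝ] EuclideanSpace ℝ (Fin d) →L[ℝ] EuclideanSpace ℝ (Fin d)}
variable {c α T : ℝ} {u : ℝ → 𝒱} {ψ : EuclideanSpace ℝ (Fin d) → ℝ}

namespace IsVelocityModel

theorem hasFDerivAt_comp_flow (hM : IsVelocityModel Ω ev Dv c α) (hu : Integrable u)
    (hψ : ContDiff ℝ 1 ψ) (s t : ℝ) (x : EuclideanSpace ℝ (Fin d)) :
    HasFDerivAt (fun x => ψ (flow ev u s t x))
      ((fderiv ℝ ψ (flow ev u s t x)).comp (flowDeriv ev Dv u s t x)) x :=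
  (hψ.differentiable (by simp) _).hasFDerivAt.comp x (hM.hasFDerivAt_flow hu s t x)

theorem contDiff_comp_flow (hM : IsVelocityModel Ω ev Dv c α) (hu : Integrable u)
    (hψ : ContDiff ℝ 1 ψ) (s t : ℝ) : ContDiff ℝ 1 fun x => ψ (flow ev u s t x) :=
  contDiff_one_iff_hasFDerivAt.2 ⟨_, ((hψ.continuous_fderiv (by simp)).comp
    (hM.continuous_flow_left hu s t)).clm_comp (hM.continuous_flowDeriv_left hu s t),
    hM.hasFDerivAt_comp_flow hu hψ s t⟩

theorem tsupport_comp_flow_subset (hM : IsVelocityModel Ω ev Dv c α) (hu : Integrable u)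
    (s t : ℝ) :
    tsupport (fun x => ψ (flow ev u s t x)) ⊆ flow ev u t s '' tsupport ψ := by
  have h1 : tsupport (fun x => ψ (flow ev u s t x)) ⊆ flow ev u s t ⁻¹' tsupport ψ :=
    closure_minimal (fun x hx => subset_tsupport ψ hx)
      ((isClosed_tsupport ψ).preimage (hM.continuous_flow_left hu s t))
  exact fun x hx => ⟨_, h1 hx, hM.flow_left_inv hu s t x⟩

theorem hasCompactSupport_comp_flow (hM : IsVelocityModel Ω ev Dv c α) (hu : Integrable u)
    (hψc : HasCompactSupport ψ) (s t : ℝ) : HasCompactSupport fun x => ψ (flow ev u s t x) :=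
  (hψc.isCompact.image (hM.continuous_flow_left hu t s)).of_isClosed_subset
    (isClosed_tsupport _) (hM.tsupport_comp_flow_subset hu s t)

theorem norm_fderiv_comp_flow_le (hM : IsVelocityModel Ω ev Dv c α) (hu : Integrable u)
    (hψ : ContDiff ℝ 1 ψ) {C : ℝ} (hC : ∀ x, ‖fderiv ℝ ψ x‖ ≤ C) (s t : ℝ)
    (x : EuclideanSpace ℝ (Fin d)) :
    ‖fderiv ℝ (fun x => ψ (flow ev u s t x)) x‖ ≤ C * flowConst c u := by
  rw [(hM.hasFDerivAt_comp_flow hu hψ s t x).fderiv]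
  refine (ContinuousLinearMap.opNorm_comp_le _ _).trans ?_
  have := (norm_nonneg _).trans (hC x)
  gcongr
  · exact hC _
  · exact hM.norm_flowDeriv_le hu s t x

/-- The derivatives of a test function composed with the flow are equicontinuous. -/
theorem exists_forall_norm_fderiv_comp_flow_sub_le (hM : IsVelocityModel Ω ev Dv c α)
    (hu : Integrable u) (hψ : ContDiff ℝ 1 ψ) (hψc : HasCompactSupport ψ) {ε : ℝ} (hε : 0 < ε) :
    ∃ ρ > 0, ∀ s t x z, ‖x - z‖ ≤ ρ → ‖fderiv ℝ (fun x => ψ (flow ev u s t x)) x -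
      fderiv ℝ (fun x => ψ (flow ev u s t x)) z‖ ≤ ε := by
  have hd := hψ.continuous_fderiv (by simp)
  obtain ⟨C, hC⟩ := hd.bounded_above_of_compact_support (hψc.fderiv ℝ)
  have hC0 : 0 ≤ C := (norm_nonneg _).trans (hC 0)
  have hL := flowConst_pos c u
  set L := flowConst c u
  set H := 2 * (flowConst c u ^ α * flowConst c u * ∫ r, c * ‖u r‖) *
        Real.exp (2 * ∫ r, c * ‖u r‖)
  obtain ⟨ρ₁, hρ₁, h₁⟩ := Metric.uniformContinuous_iff.1
    ((hψc.fderiv ℝ).uniformContinuous_of_continuous hd) (ε / (2 * L)) (by positivity)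
  have h2 : Tendsto (fun r : ℝ => C * (H * r ^ α)) (𝓝 0) (𝓝 0) := by
    have : Continuous fun r : ℝ => C * (H * r ^ α) :=
      continuous_const.mul (continuous_const.mul
        (Real.continuous_rpow_const hM.pos.le))
    simpa [hM.pos.ne'] using this.tendsto 0
  obtain ⟨ρ₂, hρ₂, h₂⟩ := Metric.eventually_nhds_iff.1
    ((tendsto_order.1 h2).2 (ε / 2) (by positivity))
  refine ⟨min (ρ₁ / (2 * L)) (ρ₂ / 2), by positivity, fun s t x z hxz => ?_⟩
  rw [(hM.hasFDerivAt_comp_flow hu hψ s t x).fderiv, (hM.hasFDerivAt_comp_flow hu hψ s t z).fderiv]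
  have e1 : ‖fderiv ℝ ψ (flow ev u s t x) - fderiv ℝ ψ (flow ev u s t z)‖ ≤ ε / (2 * L) := by
    rw [← dist_eq_norm]
    refine (h₁ ?_).le
    rw [dist_eq_norm]
    calc _ ≤ L * ‖x - z‖ := hM.norm_flow_sub_flow_le hu s t x z
      _ ≤ L * (ρ₁ / (2 * L)) := by gcongr; exact hxz.trans (min_le_left _ _)
      _ = ρ₁ / 2 := by field_simp
      _ < ρ₁ := by linarith
  have e2 : C * ‖flowDeriv ev Dv u s t x - flowDeriv ev Dv u s t z‖ ≤ ε / 2 := by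
    have h3 := hM.norm_flowDeriv_sub_le hu s t x z
    refine (mul_le_mul_of_nonneg_left h3 hC0).trans (h₂ (y := ‖x - z‖) ?_).le
    rw [Real.dist_eq, sub_zero, abs_norm]
    have := hxz.trans (min_le_right _ _)
    linarith
  have e3 : (fderiv ℝ ψ (flow ev u s t x)).comp (flowDeriv ev Dv u s t x) -
      (fderiv ℝ ψ (flow ev u s t z)).comp (flowDeriv ev Dv u s t z) =
      (fderiv ℝ ψ (flow ev u s t x) - fderiv ℝ ψ (flow ev u s t z)).comp
        (flowDeriv ev Dv u s t x) +
      (fderiv ℝ ψ (flow ev u s t z)).comp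
        (flowDeriv ev Dv u s t x - flowDeriv ev Dv u s t z) := by
    rw [ContinuousLinearMap.sub_comp, ContinuousLinearMap.comp_sub]
    abel
  rw [e3]
  calc _ ≤ ε / (2 * L) * L + C * ‖flowDeriv ev Dv u s t x - flowDeriv ev Dv u s t z‖ := by
        refine (norm_add_le _ _).trans (add_le_add
          ((ContinuousLinearMap.opNorm_comp_le _ _).trans ?_)
          ((ContinuousLinearMap.opNorm_comp_le _ _).trans ?_))
        · gcongr
          exact hM.norm_flowDeriv_le hu s t x
        · gcongr
          exact hC _
    _ ≤ ε / 2 + ε / 2 := by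
        refine add_le_add (le_of_eq ?_) e2
        field_simp
    _ = ε := by ring

/-- The flow over a short time is the identity plus the integrated velocity. -/
theorem norm_flow_sub_add_le [CompleteSpace 𝒱] (hM : IsVelocityModel Ω ev Dv c α)
    (hu : Integrable u) {s t : ℝ} (hst : s ≤ t) (x : EuclideanSpace ℝ (Fin d)) :
    ‖flow ev u t s x - x‖ ≤ c * ∫ r in s..t, ‖u r‖ ∧
    ‖flow ev u t s x - x + ev x (∫ r in s..t, u r)‖ ≤ (c * ∫ r in s..t, ‖u r‖) ^ 2 := by
  have hcu := hu.norm.const_mul c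
  have hnn : ∀ r, 0 ≤ c * ‖u r‖ := fun r => mul_nonneg hM.nonneg (norm_nonneg _)
  have hle : ∀ r ∈ Icc s t, ‖flow ev u t r x - x‖ ≤ c * ∫ r in s..t, ‖u r‖ := fun r hr => by
    refine (hM.norm_flow_sub_self_le hu t r x).trans ?_
    rw [intervalIntegral.integral_symm, abs_neg, abs_of_nonneg
      (intervalIntegral.integral_nonneg_of_forall hr.2 hnn), ← intervalIntegral.integral_const_mul]
    exact intervalIntegral.integral_mono_interval hr.1 hr.2 le_rfl
      (Eventually.of_forall hnn) hcu.intervalIntegrable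
  refine ⟨hle s ⟨le_rfl, hst⟩, ?_⟩
  have hi := hM.integrable_apply hu (hM.continuous_flow_right hu t x)
  -- The sign is positive since the flow runs backwards from `t` to `s`. The integrand is Lipschitz
  -- in the displacement, itself at most `c ∫ ‖u‖`, so the error is quadratic.
  have e1 : flow ev u t s x - x + ev x (∫ r in s..t, u r) =
      ∫ r in s..t, (ev x (u r) - ev (flow ev u t r x) (u r)) := by
    rw [intervalIntegral.integral_sub ((ev x).integrable_comp hu).intervalIntegrable
      hi.intervalIntegrable, (ev x).intervalIntegral_comp_comm hu.intervalIntegrable,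
      hM.flow_eq hu t s x, intervalIntegral.integral_symm s t]
    abel
  rw [e1, sq]
  refine (intervalIntegral.norm_integral_le_of_norm_le (g := fun r =>
    (c * ∫ r in s..t, ‖u r‖) * (c * ‖u r‖)) hst (Eventually.of_forall fun r hr => ?_)
    (hcu.const_mul _).intervalIntegrable).trans ?_
  · rw [norm_sub_rev]
    refine (hM.norm_apply_sub_le _ _ _).trans ?_
    rw [mul_comm]
    have := hnn r
    gcongr
    exact hle r ⟨hr.1.le, hr.2⟩
  · rw [intervalIntegral.integral_const_mul, intervalIntegral.integral_const_mul]

/-- A test function composed with the flow solves the transport equation to first order. -/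
theorem exists_forall_norm_comp_flow_sub_le [CompleteSpace 𝒱] (hM : IsVelocityModel Ω ev Dv c α)
    (hu : Integrable u) (hψ : ContDiff ℝ 1 ψ) (hψc : HasCompactSupport ψ) (T : ℝ) {ε : ℝ}
    (hε : 0 < ε) : ∃ ρ > 0, ∀ s t, s ≤ t → ∫ r in s..t, ‖u r‖ ≤ ρ → ∀ x,
      ‖ψ (flow ev u t T x) - (ψ (flow ev u s T x) -
        fderiv ℝ (fun x => ψ (flow ev u s T x)) x (ev x (∫ r in s..t, u r)))‖ ≤
      ε * ∫ r in s..t, ‖u r‖ := by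
  have hd := hψ.continuous_fderiv (by simp)
  obtain ⟨C, hC⟩ := hd.bounded_above_of_compact_support (hψc.fderiv ℝ)
  have hC0 : 0 ≤ C := (norm_nonneg _).trans (hC 0)
  have hL := flowConst_pos c u
  have hc := hM.nonneg
  set L := flowConst c u
  obtain ⟨ρ₁, hρ₁, h₁⟩ := hM.exists_forall_norm_fderiv_comp_flow_sub_le hu hψ hψc
    (ε := ε / (2 * (c + 1))) (by positivity)
  -- The first bound keeps the displacement below `ρ₁`, where the gradient varies little; the second
  -- makes the quadratic displacement error at most `ε / 2` times the integral.
  refine ⟨min (ρ₁ / (c + 1)) (ε / (2 * (C * L * c ^ 2 + 1))), by positivity,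
    fun s t hst hm x => ?_⟩
  set I := ∫ r in s..t, ‖u r‖
  have hI : 0 ≤ I := intervalIntegral.integral_nonneg_of_forall hst fun _ => norm_nonneg _
  obtain ⟨h2, h3⟩ := hM.norm_flow_sub_add_le hu hst x
  set z := flow ev u t s x
  set U := ∫ r in s..t, u r
  set χ : EuclideanSpace ℝ (Fin d) → ℝ := fun x => ψ (flow ev u s T x)
  have hχ : ψ (flow ev u t T x) = χ z := by
    simp only [χ, z]
    rw [hM.flow_flow hu]
  have hcI : c * I ≤ ρ₁ := by
    calc c * I ≤ (c + 1) * (ρ₁ / (c + 1)) := by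
          gcongr
          · linarith
          · exact hm.trans (min_le_left _ _)
      _ = ρ₁ := by field_simp
  have e1 : ‖χ z - χ x - fderiv ℝ χ x (z - x)‖ ≤ ε / (2 * (c + 1)) * ‖z - x‖ := by
    refine (convex_segment x z).norm_image_sub_le_of_norm_hasFDerivWithin_le'
      (f := χ) (f' := fun x => fderiv ℝ χ x)
      (fun p _ => ((hM.hasFDerivAt_comp_flow hu hψ s T p).differentiableAt.hasFDerivAt
        ).hasFDerivWithinAt) (fun p hp => ?_)
      (left_mem_segment ℝ _ _) (right_mem_segment ℝ _ _)
    exact h₁ s T p x ((norm_sub_le_of_mem_segment hp).trans (h2.trans hcI))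
  have e2 : χ z - (χ x - fderiv ℝ χ x (ev x U)) =
      (χ z - χ x - fderiv ℝ χ x (z - x)) + fderiv ℝ χ x (z - x + ev x U) := by
    rw [map_add]
    ring
  rw [hχ, e2]
  have e3 : ‖fderiv ℝ χ x (z - x + ev x U)‖ ≤ C * L * (c * I) ^ 2 :=
    (ContinuousLinearMap.le_opNorm _ _).trans (mul_le_mul
      (hM.norm_fderiv_comp_flow_le hu hψ hC s T x) h3 (norm_nonneg _) (by positivity))
  calc _ ≤ ε / (2 * (c + 1)) * (c * I) + C * L * (c * I) ^ 2 :=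
        (norm_add_le _ _).trans (add_le_add (e1.trans (by gcongr)) e3)
    _ = ε / (2 * (c + 1)) * (c * I) + (C * L * c ^ 2 * I) * I := by ring
    _ ≤ ε / (2 * (c + 1)) * ((c + 1) * I) +
        ((C * L * c ^ 2 + 1) * (ε / (2 * (C * L * c ^ 2 + 1)))) * I := by
        gcongr
        · linarith
        · linarith
        · exact hm.trans (min_le_right _ _)
    _ = ε * I := by field_simp; ring

end IsVelocityModel

end PullbackTest

/-! ### Uniqueness: every weak solution has the transported image at time `T`. -/

section FinalState

variable {d : ℕ} {Ω : Set (EuclideanSpace ℝ (Fin d))}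
variable {𝒱 : Type*} [NormedAddCommGroup 𝒱] [NormedSpace ℝ 𝒱] [CompleteSpace 𝒱]
variable {ev : EuclideanSpace ℝ (Fin d) → 𝒱 →L[ℝ] EuclideanSpace ℝ (Fin d)}
variable {Dv : EuclideanSpace ℝ (Fin d) →
  𝒱 →L[ℝ] EuclideanSpace ℝ (Fin d) →L[ℝ] EuclideanSpace ℝ (Fin d)}
variable {c α T : ℝ} {ψ : EuclideanSpace ℝ (Fin d) → ℝ}
variable {ι : 𝒱 →ₗ[ℝ] (EuclideanSpace ℝ (Fin d) → EuclideanSpace ℝ (Fin d))}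
variable {f₀ : ImageSpace Ω} {v : VelocitySpace T 𝒱} {f : ℝ → ImageSpace Ω}

namespace IsVelocityModel

/-- The pairing of a weak solution with a test function transported backwards is constant. -/
theorem integral_mul_comp_flow_eq (hM : IsVelocityModel Ω ev Dv c α)
    (hι : ∀ w x, ι w x = ev x w) (hΩ : IsOpen Ω) (hΩb : volume Ω ≠ ⊤) (hT : 0 < T)
    (hf : IsWeakSolution Ω T ι f₀ v f) (hψ : ContDiff ℝ 1 ψ) (hψc : HasCompactSupport ψ)
    (hψs : tsupport ψ ⊆ Ω) :
    ∫ x in Ω, f T x * ψ x = ∫ x in Ω, f₀ x * ψ (flow ev (timeExtend T v) 0 T x) := by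
  obtain ⟨C₀, hC₀0, hC₀⟩ := exists_integral_norm_le hΩb
  obtain ⟨M, hMf⟩ := isCompact_Icc.exists_bound_of_continuousOn hf.1
  have hM0 : 0 ≤ M := (norm_nonneg _).trans (hMf 0 ⟨le_rfl, hT.le⟩)
  have hu : Integrable (timeExtend T v) := integrable_timeExtend v
  set u := timeExtend T v with hudef
  obtain ⟨C, hC⟩ := (hψ.continuous_fderiv (by simp)).bounded_above_of_compact_support
    (hψc.fderiv ℝ)
  obtain ⟨B, hB⟩ := hψ.continuous.bounded_above_of_compact_support hψc
  have hC0 : 0 ≤ C := (norm_nonneg _).trans (hC 0)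
  have hc := hM.nonneg
  have hL := flowConst_pos c u
  set P : ℝ := C * flowConst c u * c * C₀
  have hP : 0 ≤ P := by positivity
  set χ : ℝ → EuclideanSpace ℝ (Fin d) → ℝ := fun s x => ψ (flow ev u s T x)
  have hχ : ∀ s, ContDiff ℝ 1 (χ s) := fun s => hM.contDiff_comp_flow hu hψ s T
  have hχc : ∀ s, HasCompactSupport (χ s) := fun s => hM.hasCompactSupport_comp_flow hu hψc s T
  have hχs : ∀ s, tsupport (χ s) ⊆ Ω := fun s =>
    (hM.tsupport_comp_flow_subset hu s T).trans (by
      rintro _ ⟨x, hx, rfl⟩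
      exact hM.flow_mem hu T s (hψs hx))
  have hχd : ∀ s x, ‖fderiv ℝ (χ s) x‖ ≤ C * flowConst c u := fun s x =>
    hM.norm_fderiv_comp_flow_le hu hψ hC s T x
  have hi1 : ∀ s (g : ImageSpace Ω), Integrable (fun x => g x * χ s x) (volume.restrict Ω) :=
    fun s g => integrable_image_mul hΩb g (hχ s).continuous fun x => hB _
  have hW := fun s => hM.integral_mul_eq hι hΩ hΩb hT hf (hχ s) (hχc s) (hχs s)
  -- Differentiating the product would need regularity in time that neither factor has. Instead,
  -- increments over short intervals are shown to be at most `ε ∫ ‖u‖`, so that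
  -- `eq_of_forall_increment_le` applies.
  have hconst : ∫ x in Ω, f T x * χ T x = ∫ x in Ω, f 0 x * χ 0 x := by
    refine eq_of_forall_increment_le (h := fun t => ∫ x in Ω, f t x * χ t x) (m := fun r => ‖u r‖)
      hT.le hu.norm.intervalIntegrable fun ε hε => ?_
    obtain ⟨ρ, hρ, hρ'⟩ := hM.exists_forall_norm_comp_flow_sub_le hu hψ hψc T
      (ε := ε / (2 * (C₀ * M + 1))) (by positivity)
    obtain ⟨δ₁, hδ₁, h₁⟩ := exists_forall_integral_le hu.norm 0 T hρ
    obtain ⟨δ₂, hδ₂, h₂⟩ := Metric.uniformContinuousOn_iff.1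
      (isCompact_Icc.uniformContinuousOn_of_continuous hf.1) (ε / (2 * (P + 1))) (by positivity)
    refine ⟨min δ₁ (δ₂ / 2), by positivity, fun s t hs hst ht hδ => ?_⟩
    set I := ∫ r in s..t, ‖u r‖
    have hI : 0 ≤ I := intervalIntegral.integral_nonneg_of_forall hst fun _ => norm_nonneg _
    set U := ∫ r in s..t, u r
    obtain ⟨Φ, hΦ, hΦn⟩ := exists_pairing hΩb hC₀ (hM.continuous_fderiv_comp (hχ s))
      (hM.norm_fderiv_comp_le (hχd s))
    have ha : Integrable fun r => Φ (f r) (u r) :=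
      integrable_clm_apply_timeExtend v (Φ.continuous.comp_continuousOn hf.1)
    have hWs : (∫ x in Ω, f t x * χ s x) - ∫ x in Ω, f s x * χ s x =
        ∫ r in s..t, Φ (f r) (u r) := by
      rw [hW s t ⟨hs.trans hst, ht⟩, hW s s ⟨hs, hst.trans ht⟩, add_sub_add_left_eq_sub]
      simp only [hΦ, ContinuousLinearMap.comp_apply] at ha ⊢
      exact intervalIntegral.integral_interval_sub_left ha.intervalIntegrable
        ha.intervalIntegrable
    have hiU : Integrable (fun x => f t x * (fderiv ℝ (χ s) x (ev x U))) (volume.restrict Ω) :=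
      integrable_image_mul hΩb (f t)
        ((hM.continuous_fderiv_comp (hχ s)).clm_apply (continuous_const (y := U)))
        (fun x => ContinuousLinearMap.le_of_opNorm_le _ (hM.norm_fderiv_comp_le (hχd s) x) _)
    have hU : Φ (f t) U = ∫ r in s..t, Φ (f t) (u r) :=
      ((Φ (f t)).intervalIntegral_comp_comm hu.intervalIntegrable).symm
    have e0 : ∀ x, f t x * (χ s x - fderiv ℝ (χ s) x (ev x U)) =
        f t x * χ s x - f t x * fderiv ℝ (χ s) x (ev x U) := fun x => mul_sub _ _ _
    -- The change of `f`, tested with the frozen `χ s`, cancels to first order against the change of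
    -- `χ`. There remain the first-order error of `χ`, controlled by `ρ`, and the replacement of `f
    -- r` by `f t`, controlled by continuity of `f` into `L²`.
    have e1 : (∫ x in Ω, f t x * χ t x) - ∫ x in Ω, f s x * χ s x =
        ((∫ x in Ω, f t x * χ t x) -
          ∫ x in Ω, f t x * (χ s x - fderiv ℝ (χ s) x (ev x U))) +
        ∫ r in s..t, (Φ (f r) (u r) - Φ (f t) (u r)) := by
      rw [intervalIntegral.integral_sub ha.intervalIntegrable
        ((Φ (f t)).integrable_comp hu).intervalIntegrable, ← hWs, ← hU, hΦ]
      simp only [e0]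
      rw [integral_sub (hi1 s _) hiU]
      simp only [ContinuousLinearMap.comp_apply]
      ring
    have e2 := norm_integral_image_mul_sub_le hΩb hC₀ (f t) (hi1 t _)
      (q₂ := fun x => χ s x - fderiv ℝ (χ s) x (ev x U)) (by
        simp only [e0]
        exact (hi1 s _).sub hiU)
      (hρ' s t hst (h₁ s t hs hst ht (hδ.trans (min_le_left _ _))))
    have e3 : ‖∫ r in s..t, (Φ (f r) (u r) - Φ (f t) (u r))‖ ≤ P * (ε / (2 * (P + 1))) * I := by
      refine (intervalIntegral.norm_integral_le_of_norm_le (g := fun r =>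
        P * (ε / (2 * (P + 1))) * ‖u r‖) hst (Eventually.of_forall fun r hr => ?_)
        (hu.norm.const_mul _).intervalIntegrable).trans ?_
      · rw [← sub_apply, ← map_sub]
        refine (ContinuousLinearMap.le_opNorm _ _).trans ?_
        gcongr
        refine (hΦn _).trans ?_
        have h3 := h₂ r ⟨hs.trans hr.1.le, hr.2.trans ht⟩ t ⟨hs.trans hst, ht⟩ (by
          rw [Real.dist_eq, abs_sub_comm, abs_of_nonneg (by linarith [hr.2])]
          have := hδ.trans (min_le_right _ _)
          linarith [hr.1])
        rw [dist_eq_norm] at h3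
        gcongr
      · rw [intervalIntegral.integral_const_mul]
    rw [e1]
    have e4 := hMf t ⟨hs.trans hst, ht⟩
    calc _ ≤ ε / (2 * (C₀ * M + 1)) * I * (C₀ * ‖f t‖) + P * (ε / (2 * (P + 1))) * I :=
          (norm_add_le _ _).trans (add_le_add e2 e3)
      _ ≤ ε / (2 * (C₀ * M + 1)) * I * (C₀ * M + 1) + (P + 1) * (ε / (2 * (P + 1))) * I := by
          gcongr
          · nlinarith
          · linarith
      _ = ε * I := by field_simp; ring
  have h0 := hW 0 0 ⟨le_rfl, hT.le⟩
  rw [intervalIntegral.integral_same, add_zero] at h0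
  rw [← h0, ← hconst]
  simp only [χ, hM.flow_self hu]

/-- The weak solution of the continuity equation at the final time. -/
theorem eq_transportLp (hM : IsVelocityModel Ω ev Dv c α)
    (hι : ∀ w x, ι w x = ev x w) (hΩ : IsOpen Ω) (hΩb : volume Ω ≠ ⊤) (hT : 0 < T)
    (hf : IsWeakSolution Ω T ι f₀ v f) : f T =
      transportLp (flow ev (timeExtend T v) T 0) (flowDeriv ev Dv (timeExtend T v) T 0) f₀ := by
  have hfin : IsFiniteMeasure (volume.restrict Ω) := ⟨by simpa using hΩb.lt_top⟩
  have hu : Integrable (timeExtend T v) := integrable_timeExtend v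
  set g : ImageSpace Ω :=
    transportLp (flow ev (timeExtend T v) T 0) (flowDeriv ev Dv (timeExtend T v) T 0) f₀
  have hi : ∀ f : ImageSpace Ω, Integrable f (volume.restrict Ω) := fun f =>
    (Lp.memLp f).integrable (by norm_num)
  have h1 : ∀ᵐ x, x ∈ Ω → (f T : EuclideanSpace ℝ (Fin d) → ℝ) x - g x = 0 := by
    refine hΩ.ae_eq_zero_of_integral_contDiff_smul_eq_zero
      (IntegrableOn.locallyIntegrableOn ((hi (f T)).sub (hi g))) fun ψ hψ hψc hψs => ?_
    have hψ1 : ContDiff ℝ 1 ψ := hψ.of_le (by exact_mod_cast le_top)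
    obtain ⟨B, hB⟩ := hψ.continuous.bounded_above_of_compact_support hψc
    rw [← setIntegral_eq_integral_of_forall_compl_eq_zero (s := Ω) fun x hx => by
      rw [image_eq_zero_of_notMem_tsupport fun h => hx (hψs h), zero_smul]]
    have h2 : ∀ x, ψ x • ((f T : EuclideanSpace ℝ (Fin d) → ℝ) x - g x) =
        f T x * ψ x - g x * ψ x := fun x => by
      rw [smul_eq_mul]
      ring
    simp only [h2]
    rw [integral_sub (integrable_image_mul hΩb _ hψ.continuous hB)
      (integrable_image_mul hΩb _ hψ.continuous hB),
      hM.integral_mul_comp_flow_eq hι hΩ hΩb hT hf hψ1 hψc hψs,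
      hM.integral_transportLp_mul hu hΩ.measurableSet, sub_self]
  refine Lp.ext ((ae_restrict_iff' hΩ.measurableSet).2 ?_)
  filter_upwards [h1] with x hx hxΩ
  exact sub_eq_zero.1 (hx hxΩ)

/-- Existence puts the definition in its first branch; uniqueness at time `T` makes the chosen
solution irrelevant. -/
theorem finalState_eq (hM : IsVelocityModel Ω ev Dv c α)
    (hι : ∀ w x, ι w x = ev x w) (hΩ : IsOpen Ω) (hΩb : volume Ω ≠ ⊤) (hT : 0 < T)
    (f₀ : ImageSpace Ω) (v : VelocitySpace T 𝒱) : finalState Ω T ι f₀ v =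
      transportLp (flow ev (timeExtend T v) T 0) (flowDeriv ev Dv (timeExtend T v) T 0) f₀ := by
  have h : ∃ f : ℝ → ImageSpace Ω, IsWeakSolution Ω T ι f₀ v f :=
    ⟨_, hM.isWeakSolution hι hΩ hΩb hT.le f₀ v⟩
  rw [finalState, dif_pos h]
  exact hM.eq_transportLp hι hΩ hΩb hT h.choose_spec

end IsVelocityModel

end FinalState

/-! ### From the embedding into `C^{1,α}_0` to evaluation operators with global bounds. -/

section Embedding

variable {d : ℕ} {Ω : Set (EuclideanSpace ℝ (Fin d))} {α : ℝ}

theorem bounds_of_c1HolderNorm_le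
    {F : EuclideanSpace ℝ (Fin d) → EuclideanSpace ℝ (Fin d)} {ε : ℝ≥0}
    (h : c1HolderNorm Ω α F ≤ ε) : (∀ x ∈ Ω, ‖F x‖ ≤ ε) ∧ (∀ x ∈ Ω, ‖fderiv ℝ F x‖ ≤ ε) ∧
      ∀ x ∈ Ω, ∀ z ∈ Ω, ‖fderiv ℝ F x - fderiv ℝ F z‖ ≤ ε * ‖x - z‖ ^ α := by
  unfold c1HolderNorm at h
  have hnorm : ∀ {G : Type _} [NormedAddCommGroup G] {y : G}, ‖y‖ₑ ≤ ε → ‖y‖ ≤ ε :=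
    fun {G} _ {y} hy => by
      rw [← ofReal_norm, ← ENNReal.ofReal_coe_nnreal] at hy
      exact (ENNReal.ofReal_le_ofReal_iff ε.2).1 hy
  refine ⟨fun x hx => hnorm ?_, fun x hx => hnorm ?_, fun x hx z hz => ?_⟩
  · exact ((le_iSup₂ (f := fun x (_ : x ∈ Ω) => ‖F x‖ₑ) x hx).trans
      (le_self_add.trans le_self_add)).trans h
  · exact ((le_iSup₂ (f := fun x (_ : x ∈ Ω) => ‖fderiv ℝ F x‖ₑ) x hx).trans
      (le_add_self.trans le_self_add)).trans h
  · rcases eq_or_ne x z with rfl | hne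
    · rw [sub_self, norm_zero]
      positivity
    have h1 : ‖fderiv ℝ F x - fderiv ℝ F z‖ₑ / edist x z ^ α ≤ ε :=
      ((le_iSup₂ (f := fun z (_ : z ∈ Ω) =>
        ‖fderiv ℝ F x - fderiv ℝ F z‖ₑ / edist x z ^ α) z hz).trans
        (le_iSup₂ (f := fun x (_ : x ∈ Ω) => ⨆ z ∈ Ω,
          ‖fderiv ℝ F x - fderiv ℝ F z‖ₑ / edist x z ^ α) x hx)).trans (le_add_self.trans h)
    have hpos : 0 < ‖x - z‖ := norm_sub_pos_iff.2 hne
    have h2 : edist x z ^ α = ENNReal.ofReal (‖x - z‖ ^ α) := by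
      rw [edist_dist, dist_eq_norm, ENNReal.ofReal_rpow_of_pos hpos]
    rw [h2, ENNReal.div_le_iff (by simp; positivity) (by simp), ← ofReal_norm,
      ← ENNReal.ofReal_coe_nnreal, ← ENNReal.ofReal_mul ε.coe_nonneg] at h1
    exact (ENNReal.ofReal_le_ofReal_iff (by positivity)).1 h1

namespace MemC1HolderZero

variable {F : EuclideanSpace ℝ (Fin d) → EuclideanSpace ℝ (Fin d)}

/-- A field in `C^{1,α}_0` is continuously differentiable on the whole space, and its derivative
vanishes outside `Ω`. -/
theorem hasFDerivAt_and_continuous (hF : MemC1HolderZero Ω α F) (hΩ : IsOpen Ω) :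
    (∀ x, HasFDerivAt F (fderiv ℝ F x) x) ∧ (∀ x, x ∉ Ω → fderiv ℝ F x = 0) ∧
      Continuous (fderiv ℝ F) := by
  classical
  obtain ⟨hd, h0, happ⟩ := hF
  have hpos : ∀ n : ℕ, (0 : ℝ≥0) < 1 / ((n : ℝ≥0) + 1) := fun n => by positivity
  choose φ hφ hφc hφs hφn using fun n : ℕ => happ _ (hpos n)
  have hlim : Tendsto (fun n : ℕ => ((1 / ((n : ℝ≥0) + 1) : ℝ≥0) : ℝ)) atTop (𝓝 0) := by
    simpa using tendsto_one_div_add_atTop_nhds_zero_nat (𝕜 := ℝ)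
  have hφd : ∀ n x, HasFDerivAt (φ n) (fderiv ℝ (φ n) x) x := fun n x =>
    ((hφ n).differentiable (by simp) x).hasFDerivAt
  -- The derivatives of the compactly supported approximants converge uniformly on the whole space
  -- to the derivative on `Ω` extended by zero, so differentiability also holds at the boundary.
  set F' : EuclideanSpace ℝ (Fin d) → EuclideanSpace ℝ (Fin d) →L[ℝ] EuclideanSpace ℝ (Fin d) :=
    fun x => if x ∈ Ω then fderiv ℝ F x else 0
  have hFd : ∀ x ∈ Ω, DifferentiableAt ℝ F x := fun x hx =>
    (hd.differentiableOn (by simp) x hx).differentiableAt (hΩ.mem_nhds hx)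
  have hb : ∀ n x, ‖F' x - fderiv ℝ (φ n) x‖ ≤ (1 / ((n : ℝ≥0) + 1) : ℝ≥0) := fun n x => by
    by_cases hx : x ∈ Ω
    · have h1 := (bounds_of_c1HolderNorm_le (hφn n)).2.1 x hx
      rw [fderiv_sub (hFd x hx) (hφd n x).differentiableAt] at h1
      simpa only [F', if_pos hx] using h1
    · have h1 : fderiv ℝ (φ n) x = 0 :=
        Function.notMem_support.1 fun h => hx (hφs n (support_fderiv_subset ℝ h))
      simp only [F', if_neg hx, h1, sub_zero, norm_zero]
      exact NNReal.coe_nonneg _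
  have hb0 : ∀ n x, ‖F x - φ n x‖ ≤ (1 / ((n : ℝ≥0) + 1) : ℝ≥0) := fun n x => by
    by_cases hx : x ∈ Ω
    · exact (bounds_of_c1HolderNorm_le (hφn n)).1 x hx
    · rw [h0 x hx, image_eq_zero_of_notMem_tsupport fun h => hx (hφs n h), sub_zero, norm_zero]
      exact NNReal.coe_nonneg _
  have hunif : TendstoUniformly (fun n => fderiv ℝ (φ n)) F' atTop := by
    rw [Metric.tendstoUniformly_iff]
    intro ε hε
    filter_upwards [(tendsto_order.1 hlim).2 ε hε] with n hn x
    rw [dist_eq_norm]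
    exact (hb n x).trans_lt hn
  have hder : ∀ x, HasFDerivAt F (F' x) x := hasFDerivAt_of_tendstoUniformly hunif
    hφd fun x => by
      rw [tendsto_iff_norm_sub_tendsto_zero]
      refine squeeze_zero (fun _ => norm_nonneg _) (fun n => ?_) hlim
      rw [norm_sub_rev]
      exact hb0 n x
  have heq : fderiv ℝ F = F' := funext fun x => (hder x).fderiv
  refine ⟨fun x => heq ▸ hder x, fun x hx => by rw [heq]; exact if_neg hx, heq ▸ ?_⟩
  exact hunif.continuous (Frequently.of_forall fun n => (hφ n).continuous_fderiv (by simp))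

/-- The `C^{1,α}` bounds on `Ω` are valid on the whole space. -/
theorem bounds (hF : MemC1HolderZero Ω α F) (hΩ : IsOpen Ω) (hα : 0 < α) {N : ℝ≥0}
    (hN : c1HolderNorm Ω α F ≤ N) : (∀ x, ‖F x‖ ≤ N) ∧ (∀ x, ‖fderiv ℝ F x‖ ≤ N) ∧
      (∀ x z, ‖F x - F z‖ ≤ N * ‖x - z‖) ∧
      ∀ x z, ‖fderiv ℝ F x - fderiv ℝ F z‖ ≤ N * ‖x - z‖ ^ α := by
  obtain ⟨b0, b1, b2⟩ := bounds_of_c1HolderNorm_le hN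
  obtain ⟨hder, hoff, hcont⟩ := hF.hasFDerivAt_and_continuous hΩ
  have hb1 : ∀ x, ‖fderiv ℝ F x‖ ≤ N := fun x => by
    by_cases hx : x ∈ Ω
    · exact b1 x hx
    · rw [hoff x hx, norm_zero]
      exact N.2
  have hcl : ∀ x ∈ Ω, ∀ z ∈ closure Ω, ‖fderiv ℝ F x - fderiv ℝ F z‖ ≤ N * ‖x - z‖ ^ α := by
    intro x hx
    refine closure_minimal (fun z hz => b2 x hx z hz) (isClosed_le
      (continuous_const.sub hcont).norm ?_)
    exact continuous_const.mul ((continuous_const.sub continuous_id).norm.rpow_const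
      fun _ => Or.inr hα.le)
  have hmix : ∀ x ∈ Ω, ∀ z, z ∉ Ω → ‖fderiv ℝ F x - fderiv ℝ F z‖ ≤ N * ‖x - z‖ ^ α := by
    intro x hx z hz
    -- By connectedness the segment from `Ω` to its complement meets the boundary. The derivative
    -- vanishes at `p` as it does at `z`, and `p` is no farther from `x` than `z`.
    obtain ⟨p, hp, hpc, hpΩ⟩ : ∃ p ∈ segment ℝ x z, p ∈ closure Ω ∧ p ∉ Ω := by
      by_contra! h
      have hsub : segment ℝ x z ⊆ Ω ∪ (closure Ω)ᶜ := fun p hp => or_iff_not_imp_right.2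
        fun hpc => h p hp (not_not.1 hpc)
      obtain ⟨p, -, hp1, hp2⟩ := (convex_segment x z).isPreconnected Ω (closure Ω)ᶜ hΩ
        isClosed_closure.isOpen_compl hsub ⟨x, left_mem_segment ℝ x z, hx⟩
        ⟨z, right_mem_segment ℝ x z, (hsub (right_mem_segment ℝ x z)).resolve_left hz⟩
      exact hp2 (subset_closure hp1)
    have h1 := hcl x hx p hpc
    rw [hoff p hpΩ] at h1
    rw [hoff z hz]
    refine h1.trans ?_
    have h2 := norm_sub_le_of_mem_segment hp
    rw [norm_sub_rev x p, norm_sub_rev x z]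
    gcongr
  refine ⟨fun x => ?_, hb1, fun x z => ?_, fun x z => ?_⟩
  · by_cases hx : x ∈ Ω
    · exact b0 x hx
    · rw [hF.2.1 x hx, norm_zero]
      exact N.2
  · exact convex_univ.norm_image_sub_le_of_norm_hasFDerivWithin_le
      (fun p _ => (hder p).hasFDerivWithinAt) (fun p _ => hb1 p) (mem_univ z) (mem_univ x)
  · by_cases hx : x ∈ Ω
    · by_cases hz : z ∈ Ω
      · exact b2 x hx z hz
      · exact hmix x hx z hz
    · by_cases hz : z ∈ Ω
      · rw [norm_sub_rev, norm_sub_rev x]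
        exact hmix z hz x hx
      · rw [hoff x hx, hoff z hz, sub_self, norm_zero]
        positivity

end MemC1HolderZero

/-- The embedding constant bounds value, derivative, Lipschitz and Hölder quotients of `ι w`
linearly in `‖w‖`; read for fixed points and varying `w`, these are operator norm bounds. -/
theorem IsC1HolderZeroEmbedding.exists_isVelocityModel
    {𝒱 : Type*} [NormedAddCommGroup 𝒱] [NormedSpace ℝ 𝒱]
    {ι : 𝒱 →ₗ[ℝ] (EuclideanSpace ℝ (Fin d) → EuclideanSpace ℝ (Fin d))}
    (hι : IsC1HolderZeroEmbedding Ω α ι) (hΩ : IsOpen Ω) (hα : 0 < α) :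
    ∃ (ev : EuclideanSpace ℝ (Fin d) → 𝒱 →L[ℝ] EuclideanSpace ℝ (Fin d))
      (Dv : EuclideanSpace ℝ (Fin d) →
        𝒱 →L[ℝ] EuclideanSpace ℝ (Fin d) →L[ℝ] EuclideanSpace ℝ (Fin d)) (c : ℝ),
      IsVelocityModel Ω ev Dv c α ∧ ∀ w x, ι w x = ev x w := by
  obtain ⟨-, hmem, c, hc⟩ := hι
  have hder := fun w => ((hmem w).hasFDerivAt_and_continuous hΩ).1
  have hb := fun w => (hmem w).bounds hΩ hα (N := c * ‖w‖₊) (by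
    rw [ENNReal.coe_mul]
    exact hc w)
  let ev : EuclideanSpace ℝ (Fin d) → 𝒱 →L[ℝ] EuclideanSpace ℝ (Fin d) := fun x =>
    LinearMap.mkContinuous
      { toFun := fun w => ι w x
        map_add' := fun w w' => by rw [map_add]; rfl
        map_smul' := fun r w => by rw [map_smul]; rfl } c fun w => (hb w).1 x
  let Dv : EuclideanSpace ℝ (Fin d) →
      𝒱 →L[ℝ] EuclideanSpace ℝ (Fin d) →L[ℝ] EuclideanSpace ℝ (Fin d) := fun x =>
    LinearMap.mkContinuous
      { toFun := fun w => fderiv ℝ (ι w) x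
        map_add' := fun w w' => by
          rw [map_add, ((hder w x).add (hder w' x)).fderiv]
        map_smul' := fun r w => by
          rw [map_smul, ((hder w x).const_smul r).fderiv]
          rfl } c fun w => (hb w).2.1 x
  refine ⟨ev, Dv, c, ⟨c.2, hα, fun x => ?_, fun x => ?_, fun x z => ?_, fun x z => ?_,
    fun w x => hder w x, fun x hx => ?_⟩, fun w x => rfl⟩
  · exact LinearMap.mkContinuous_norm_le _ c.2 _
  · exact LinearMap.mkContinuous_norm_le _ c.2 _
  · refine ContinuousLinearMap.opNorm_le_bound _ (by positivity) fun w => ?_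
    refine ((hb w).2.2.1 x z).trans (le_of_eq ?_)
    push_cast
    ring
  · refine ContinuousLinearMap.opNorm_le_bound _ (by positivity) fun w => ?_
    refine ((hb w).2.2.2 x z).trans (le_of_eq ?_)
    push_cast
    ring
  · ext1 w
    exact (hmem w).2.1 x hx

end Embedding

/-! ### Weak-to-strong continuity of the final image. -/

section WeakContinuity

variable {d : ℕ} {Ω : Set (EuclideanSpace ℝ (Fin d))}
variable {𝒱 : Type*} [NormedAddCommGroup 𝒱] [NormedSpace ℝ 𝒱]
variable {α c T : ℝ}

omit [NormedSpace ℝ 𝒱] in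
theorem norm_timeExtend (v : VelocitySpace T 𝒱) (r : ℝ) :
    ‖timeExtend T v r‖ = (Icc 0 T).indicator (fun r => ‖v r‖) r :=
  norm_indicator_eq_indicator_norm _ _

omit [NormedSpace ℝ 𝒱] in
theorem integral_norm_timeExtend (v : VelocitySpace T 𝒱) :
    ∫ r, ‖timeExtend T v r‖ = ∫ r in Icc 0 T, ‖v r‖ := by
  simp only [norm_timeExtend]
  exact integral_indicator measurableSet_Icc

omit [NormedSpace ℝ 𝒱] in
theorem integral_norm_sq_timeExtend (v : VelocitySpace T 𝒱) :
    Integrable (fun r => ‖timeExtend T v r‖ ^ 2) ∧ ∫ r, ‖timeExtend T v r‖ ^ 2 = ‖v‖ ^ 2 := by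
  have h1 : (fun r => ‖timeExtend T v r‖ ^ 2) = (Icc 0 T).indicator fun r => ‖v r‖ ^ 2 := by
    ext r
    by_cases hr : r ∈ Icc 0 T <;> simp [timeExtend, hr]
  have h2 : Integrable (fun r => ‖v r‖ ^ 2) (volume.restrict (Icc 0 T)) :=
    (Lp.memLp v).norm.integrable_sq
  rw [h1]
  refine ⟨(integrable_indicator_iff measurableSet_Icc).2 h2, ?_⟩
  rw [integral_indicator measurableSet_Icc, Lp.norm_def,
    (Lp.memLp v).eLpNorm_eq_integral_rpow_norm (by simp) (by simp),
    ENNReal.toReal_ofReal (by positivity)]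
  simp only [ENNReal.toReal_ofNat, Real.rpow_ofNat]
  rw [← Real.rpow_natCast, ← Real.rpow_mul (integral_nonneg fun _ => by positivity)]
  norm_num

omit [NormedSpace ℝ 𝒱] in
theorem timeExtend_congr {v : VelocitySpace T 𝒱} {g : ℝ → 𝒱}
    (h : v =ᵐ[volume.restrict (Icc 0 T)] g) : timeExtend T v =ᵐ[volume] (Icc 0 T).indicator g :=
  (ae_eq_restrict_iff_indicator_ae_eq measurableSet_Icc).1 h

/-- Integration against a continuous function of time with values in the dual space is a
continuous functional on the velocities. -/
theorem exists_strongDual_eq_integral {A : ℝ → StrongDual ℝ 𝒱} (hA : Continuous A) (s t : ℝ) :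
    ∃ ℓ : StrongDual ℝ (VelocitySpace T 𝒱), ∀ v, ℓ v = ∫ r in s..t, A r (timeExtend T v r) := by
  obtain ⟨K, hK0, hK⟩ := exists_integral_norm_Lp_le (F := 𝒱) (volume.restrict (Icc 0 T))
  obtain ⟨M, hM⟩ := isCompact_uIcc.exists_bound_of_continuousOn (hA.continuousOn (s := uIcc s t))
  have hM0 : 0 ≤ M := (norm_nonneg _).trans (hM s left_mem_uIcc)
  have hi := fun v : VelocitySpace T 𝒱 =>
    intervalIntegrable_clm_apply hA (integrable_timeExtend v) s t
  let Λ : VelocitySpace T 𝒱 →ₗ[ℝ] ℝ :=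
    { toFun := fun v => ∫ r in s..t, A r (timeExtend T v r)
      map_add' := fun v w => by
        rw [← intervalIntegral.integral_add (hi v) (hi w)]
        refine intervalIntegral.integral_congr_ae ?_
        filter_upwards [timeExtend_congr (Lp.coeFn_add v w)] with r hr _
        rw [hr, indicator_add', Pi.add_apply, map_add]
        rfl
      map_smul' := fun a v => by
        rw [RingHom.id_apply, ← intervalIntegral.integral_smul]
        refine intervalIntegral.integral_congr_ae ?_
        filter_upwards [timeExtend_congr (Lp.coeFn_smul a v)] with r hr _
        rw [hr, ← map_smul, timeExtend]
        congr 1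
        exact indicator_const_smul_apply _ _ _ _ }
  refine ⟨Λ.mkContinuous (M * K) fun v => ?_, fun v => rfl⟩
  change ‖∫ r in s..t, A r (timeExtend T v r)‖ ≤ _
  have hv := (integrable_timeExtend v).norm
  calc _ ≤ |∫ r in s..t, M * ‖timeExtend T v r‖| := by
        refine intervalIntegral.norm_integral_le_abs_of_norm_le ?_
          (hv.const_mul M).intervalIntegrable
        refine (ae_restrict_iff' measurableSet_uIoc).2 (Eventually.of_forall fun r hr => ?_)
        exact ContinuousLinearMap.le_of_opNorm_le _ (hM r (uIoc_subset_uIcc hr)) _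
    _ ≤ ∫ r, M * ‖timeExtend T v r‖ := abs_intervalIntegral_le_integral (hv.const_mul M)
        (fun r => by positivity) s t
    _ = M * ∫ r in Icc 0 T, ‖v r‖ := by rw [integral_const_mul, integral_norm_timeExtend]
    _ ≤ M * (K * ‖v‖) := by gcongr; exact hK v
    _ = _ := by ring

theorem tendstoVelocity_timeExtend {v : ℕ → VelocitySpace T 𝒱} {w : VelocitySpace T 𝒱} {R : ℝ}
    (hR : ∀ k, ‖v k‖ ≤ R) (hvw : ∀ ℓ : StrongDual ℝ (VelocitySpace T 𝒱),
      Tendsto (fun k => ℓ (v k)) atTop (𝓝 (ℓ w))) :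
    ∃ R', TendstoVelocity (fun k => timeExtend T (v k)) (timeExtend T w) R' := by
  obtain ⟨K, hK0, hK⟩ := exists_integral_norm_Lp_le (F := 𝒱) (volume.restrict (Icc 0 T))
  -- `K * R` bounds the `L¹` norms on the finite interval, and `R ^ 2` the squared `L²` norms.
  refine ⟨max (K * R) (R ^ 2), fun k => integrable_timeExtend _, integrable_timeExtend _,
    fun k => (integral_norm_sq_timeExtend (v k)).1, fun k => ?_, fun k => ?_,
    fun A hA s t => ?_⟩
  · rw [integral_norm_timeExtend]
    exact ((hK _).trans (by gcongr; exact hR k)).trans (le_max_left _ _)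
  · rw [(integral_norm_sq_timeExtend (v k)).2]
    refine le_trans ?_ (le_max_right _ _)
    gcongr
    exact hR k
  · obtain ⟨ℓ, hℓ⟩ := exists_strongDual_eq_integral (T := T) hA s t
    simpa only [hℓ] using hvw ℓ

/-- The final image depends continuously on the velocity, from the weak to the strong topology. -/
theorem tendsto_finalState [CompleteSpace 𝒱]
    {ι : 𝒱 →ₗ[ℝ] (EuclideanSpace ℝ (Fin d) → EuclideanSpace ℝ (Fin d))}
    (hι : IsC1HolderZeroEmbedding Ω α ι) (hΩ : IsOpen Ω) (hΩb : volume Ω ≠ ⊤) (hα : 0 < α)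
    (hT : 0 < T) (f₀ : ImageSpace Ω) {v : ℕ → VelocitySpace T 𝒱} {w : VelocitySpace T 𝒱} {R : ℝ}
    (hR : ∀ k, ‖v k‖ ≤ R) (hvw : ∀ ℓ : StrongDual ℝ (VelocitySpace T 𝒱),
      Tendsto (fun k => ℓ (v k)) atTop (𝓝 (ℓ w))) :
    Tendsto (fun k => finalState Ω T ι f₀ (v k)) atTop (𝓝 (finalState Ω T ι f₀ w)) := by
  obtain ⟨ev, Dv, c, hM, hev⟩ := hι.exists_isVelocityModel hΩ hα
  obtain ⟨R', hV⟩ := tendstoVelocity_timeExtend hR hvw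
  -- One Jacobian bound for all flows in the sequence and for the limit: the flow constants depend
  -- only on the `L¹` norm of the velocity.
  obtain ⟨B, hB⟩ := exists_abs_det_le (d := d)
    (max (2 * Real.exp (2 * (c * R'))) (flowConst c (timeExtend T w)))
  have hu := hV.integrable
  have hw := hV.integrable_limit
  simp only [hM.finalState_eq hev hΩ hΩb hT]
  rw [transportLp_eq (hM.memLp_transportFun_flow hw hΩ.measurableSet T 0 f₀)]
  simp only [fun k => transportLp_eq (hM.memLp_transportFun_flow (hu k) hΩ.measurableSet T 0 f₀)]
  rw [Lp.tendsto_Lp_iff_tendsto_eLpNorm'']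
  exact tendsto_eLpNorm_transportFun (fun k => hM.isDiffeoOn_flow (hu k) T 0)
    (hM.isDiffeoOn_flow hw T 0) hΩ hΩb
    (fun k y => hB _ ((hM.norm_flowDeriv_le (hu k) T 0 y).trans
      ((hM.flowConst_le hV k).trans (le_max_left _ _))))
    (fun y => hB _ ((hM.norm_flowDeriv_le hw T 0 y).trans (le_max_right _ _)))
    (fun y => hM.tendsto_flow hV T 0 y) (fun y => hM.tendsto_flowDeriv hV T 0 y) f₀

end WeakContinuity

/-! ### Convergence of the minimisers. -/

theorem mainTheorem3
    {d : ℕ} (Ω : Set (EuclideanSpace ℝ (Fin d)))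
    (hΩo : IsOpen Ω) (hΩb : Bornology.IsBounded Ω) (hΩc : Convex ℝ Ω)
    (T : ℝ) (hT : 0 < T)
    {𝒱 : Type*} [NormedAddCommGroup 𝒱] [NormedSpace ℝ 𝒱] [CompleteSpace 𝒱]
    (h𝒱 : IsReflexiveSpace 𝒱)
    (α : ℝ) (hα0 : 0 < α) (hα1 : α ≤ 1)
    (ι : 𝒱 →ₗ[ℝ] (EuclideanSpace ℝ (Fin d) → EuclideanSpace ℝ (Fin d)))
    (hι : IsC1HolderZeroEmbedding Ω α ι)
    {Y : Type*} [NormedAddCommGroup Y] [NormedSpace ℝ Y] [CompleteSpace Y]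
    (K : ImageSpace Ω → Y) (hK : Continuous K)
    (D : Y → Y → ℝ≥0) (hD : IsDataDiscrepancy D)
    (f₀ : ImageSpace Ω) (g : Y)
    (hg : ∃ vhat : VelocitySpace T 𝒱, K (finalState Ω T ι f₀ vhat) = g)
    (γ : ℝ → ℝ) (hγpos : ∀ δ, 0 < δ → 0 < γ δ)
    (hγ : Tendsto γ (𝓝[>] 0) (𝓝 0))
    (hδγ : Tendsto (fun δ => δ / γ δ) (𝓝[>] 0) (𝓝 0))
    (δ : ℕ → ℝ) (hδpos : ∀ n, 0 < δ n) (hδ : Tendsto δ atTop (𝓝 0))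
    (gn : ℕ → Y) (hgn : Tendsto gn atTop (𝓝 g)) (hDgn : ∀ n, (D g (gn n) : ℝ) ≤ δ n)
    (v : ℕ → VelocitySpace T 𝒱)
    (hv : ∀ n, IsMinOn (regFunctional Ω T ι f₀ K D (γ (δ n)) (gn n)) univ (v n)) :
    ∃ (φ : ℕ → ℕ) (w : VelocitySpace T 𝒱), StrictMono φ ∧
      (∀ ℓ : StrongDual ℝ (VelocitySpace T 𝒱),
        Tendsto (fun k => ℓ (v (φ k))) atTop (𝓝 (ℓ w))) ∧
      K (finalState Ω T ι f₀ w) = g := by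
  obtain ⟨vhat, hvhat⟩ := hg
  have hδ' : Tendsto δ atTop (𝓝[>] 0) :=
    tendsto_nhdsWithin_iff.2 ⟨hδ, Eventually.of_forall hδpos⟩
  have hJ : ∀ n, (D (K (finalState Ω T ι f₀ (v n))) (gn n) : ℝ) + γ (δ n) * ‖v n‖ ^ 2 ≤
      δ n + γ (δ n) * ‖vhat‖ ^ 2 := fun n => by
    have h1 := isMinOn_iff.1 (hv n) vhat (mem_univ _)
    simp only [regFunctional, hvhat] at h1
    linarith [hDgn n]
  -- Drop the discrepancy and divide by `γ (δ n)`; the quotient converges, hence is bounded.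
  have hsq : ∀ n, ‖v n‖ ^ 2 ≤ δ n / γ (δ n) + ‖vhat‖ ^ 2 := fun n => by
    have h1 := hγpos _ (hδpos n)
    have h2 := NNReal.coe_nonneg (D (K (finalState Ω T ι f₀ (v n))) (gn n))
    rw [← sub_le_iff_le_add, le_div_iff₀ h1]
    linarith [hJ n]
  obtain ⟨C, hC⟩ := (hδγ.comp hδ').bddAbove_range
  have hR : ∀ n, ‖v n‖ ≤ √(C + ‖vhat‖ ^ 2) := fun n => by
    refine Real.le_sqrt_of_sq_le ((hsq n).trans ?_)
    gcongr
    exact hC ⟨n, rfl⟩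
  have hDlim : Tendsto (fun n => D (K (finalState Ω T ι f₀ (v n))) (gn n)) atTop (𝓝 0) := by
    rw [← NNReal.tendsto_coe]
    have h1 : Tendsto (fun n => δ n + γ (δ n) * ‖vhat‖ ^ 2) atTop (𝓝 0) := by
      simpa using hδ.add ((hγ.comp hδ').mul_const (‖vhat‖ ^ 2))
    refine squeeze_zero (fun n => NNReal.coe_nonneg _) (fun n => ?_) h1
    have h2 := mul_nonneg (hγpos _ (hδpos n)).le (sq_nonneg ‖v n‖)
    linarith [hJ n]
  obtain ⟨φ, w, hφ, hw⟩ := exists_subseq_weak_tendsto h𝒱 v hR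
  refine ⟨φ, w, hφ, hw, hD.eq_of_eq_zero _ _ ?_⟩
  have hF := (hK.tendsto _).comp (tendsto_finalState hι hΩo hΩb.measure_lt_top.ne hα0 hT f₀
    (fun k => hR (φ k)) hw)
  -- Property 2 passes from the data `gn (φ k)`, against which the discrepancy tends to zero, to the
  -- fixed datum `g`.
  have hlim := hD.liminf_le _ _ _ _ hF (hgn.comp hφ.tendsto_atTop)
  have h0 : Tendsto (fun k => (D (K (finalState Ω T ι f₀ (v (φ k)))) (gn (φ k)) : ℝ≥0∞)) atTop
      (𝓝 0) := by
    rw [← ENNReal.coe_zero, ENNReal.tendsto_coe]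
    exact hDlim.comp hφ.tendsto_atTop
  simp only [Function.comp_apply] at hlim
  rw [h0.liminf_eq, nonpos_iff_eq_zero] at hlim
  by_contra hne
  have hpos : 0 < D (K (finalState Ω T ι f₀ w)) g := pos_iff_ne_zero.2 hne
  -- By lower semicontinuity the discrepancies to `g` eventually exceed a positive `y` below the
  -- limit value, against their lower limit being zero.
  obtain ⟨y, hy0, hy⟩ := exists_between hpos
  have hev := hF.eventually (hD.lowerSemicontinuous_left g _ y hy)
  have hle : (y : ℝ≥0∞) ≤ liminf (fun k =>
      (D (K (finalState Ω T ι f₀ (v (φ k)))) g : ℝ≥0∞)) atTop :=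
    le_liminf_of_le (by isBoundedDefault) (hev.mono fun k hk => ENNReal.coe_le_coe.2 hk.le)
  rw [hlim] at hle
  exact hy0.ne' (by exact_mod_cast nonpos_iff_eq_zero.1 hle)
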